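/- Let $n\ge 1$, and let $\Phi:\mathbb R^n\to[0,\infty)$ be radial and $C^\infty$, supported in the closed ball $\{|z|\le 2\}$, with $\Phi=1$ on $\{|z|<1\}$. For $j=1,\dots,n$ put $K_j(z)=\dfrac{z_j}{|z|^{n+1}}\Phi(z)$ and define the truncated Riesz transform $$R_jf(x)=\mathrm{p.v.}\int_{\mathbb R^n}K_j(x-y)f(y)\,dy=\lim_{\varepsilon\to0^+}\int_{|x-y|>\varepsilon}K_j(x-y)f(y)\,dy .$$ A weight is a nonnegative locally integrable function $w$ on $\mathbb R^n$ that is not almost everywhere zero. Let $Q$ run through the cubes with sides parallel to the axes, and let $|Q|$ be the volume of $Q$. For $1<p<\infty$ and $\frac1p+\frac1{p'}=1$, $w\in A_p^{loc}$ means that $$\sup_{|Q|\le1}\frac1{|Q|^p}\int_Qw\,dx\left(\int_Qw^{-p'/p}\,dx\right)^{p/p'}<\infty ,$$ and $w\in A_1^{loc}$ means that $$\sup_{|Q|\le1}\frac1{|Q|}\int_Qw\,dx\;\operatorname*{ess\,sup}_{y\in Q}\,w(y)^{-1}<\infty .$$ For $1\le p<\infty$ let $\|f\|_{L^p_w}=\left(\int_{\mathbb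 R^n}|f|^pw\,dx\right)^{1/p}$, let $L^p_w$ be the space of complex-valued measurable functions $f$ with $\|f\|_{L^p_w}<\infty$, and let $\|g\|_{L^{1,\infty}_w}=\sup_{\lambda>0}\lambda\int_{\{|g|>\lambda\}}w\,dx$. Then: (i) If $1<p<\infty$ and $w\in A_p^{loc}$, there is a finite constant $C_{p,w}$ such that for every $j$ and every $f\in L^p_w$ the integrals and the limit defining $R_jf(x)$ exist for almost every $x$, $R_jf$ is measurable, and $$\|R_jf\|_{L^p_w}\le C_{p,w}\|f\|_{L^p_w}.$$ (ii) If $w\in A_1^{loc}$, there is a finite constant $C_w$ such that for every $j$ and every $f\in L^1_w$ the integrals and the limit defining $R_jf(x)$ exist for almost every $x$, $R_jf$ is measurable, and $$\|R_jf\|_{L^{1,\infty}_w}\le C_w\|f\|_{L^1_w}.$$ The constants may also depend on the fixed data $n$ and $\Phi$. -/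

import Mathlib

open MeasureTheory Filter Topology
open scoped NNReal ENNReal

noncomputable section

/-- The closed cube `Q(x,t)` with centre `x`, sidelength `t` and sides parallel to the axes. -/
def cube {n : ℕ} (x : EuclideanSpace ℝ (Fin n)) (t : ℝ) : Set (EuclideanSpace ℝ (Fin n)) :=
  {y | ∀ i, |y i - x i| ≤ t / 2}

/-- The measure `w dx`. -/
def weightMeasure {n : ℕ} (w : EuclideanSpace ℝ (Fin n) → ℝ) :
    Measure (EuclideanSpace ℝ (Fin n)) :=
  (volume : Measure (EuclideanSpace ℝ (Fin n))).withDensity fun x => ENNReal.ofReal (w x)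

/-- A weight: nonnegative, locally integrable, and not almost everywhere zero. -/
structure IsWeight {n : ℕ} (w : EuclideanSpace ℝ (Fin n) → ℝ) : Prop where
  nonneg : ∀ x, 0 ≤ w x
  locallyIntegrable : LocallyIntegrable w volume
  not_ae_zero : ¬ (w =ᵐ[volume] 0)

/-- The local Muckenhoupt constant for `1 < p < ∞`, with `p' = p.conjExponent = p / (p - 1)`:
the supremum over cubes `Q` with `|Q| ≤ 1` of
`|Q|^(-p) * (∫_Q w) * (∫_Q w^(-p'/p))^(p/p')`, in `[0,∞]` (where `0` to a negative power is `∞`). -/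
def apLocConst {n : ℕ} (p : ℝ) (w : EuclideanSpace ℝ (Fin n) → ℝ) : ℝ≥0∞ :=
  ⨆ (x : EuclideanSpace ℝ (Fin n)) (t : ℝ) (_ : 0 < t) (_ : volume (cube x t) ≤ 1),
    ((∫⁻ y in cube x t, ENNReal.ofReal (w y)) *
      (∫⁻ y in cube x t, ENNReal.ofReal (w y) ^ (-(p.conjExponent / p))) ^ (p / p.conjExponent))
        / volume (cube x t) ^ p

/-- The local `A_1` constant: the supremum over cubes `Q` with `|Q| ≤ 1` of
`|Q|⁻¹ * (∫_Q w) * ess sup_Q w⁻¹`, in `[0,∞]`. -/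
def a1LocConst {n : ℕ} (w : EuclideanSpace ℝ (Fin n) → ℝ) : ℝ≥0∞ :=
  ⨆ (x : EuclideanSpace ℝ (Fin n)) (t : ℝ) (_ : 0 < t) (_ : volume (cube x t) ≤ 1),
    ((∫⁻ y in cube x t, ENNReal.ofReal (w y)) *
      essSup (fun y => (ENNReal.ofReal (w y))⁻¹) (volume.restrict (cube x t)))
        / volume (cube x t)

/-- `w ∈ A_p^loc`, for `1 < p < ∞`. -/
def IsApLoc {n : ℕ} (p : ℝ) (w : EuclideanSpace ℝ (Fin n) → ℝ) : Prop :=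
  IsWeight w ∧ apLocConst p w < ∞

/-- `w ∈ A_1^loc`. -/
def IsA1Loc {n : ℕ} (w : EuclideanSpace ℝ (Fin n) → ℝ) : Prop :=
  IsWeight w ∧ a1LocConst w < ∞

/-- The weak `L¹` quantity `sup_{t>0} t * μ {|g| > t}`. -/
def weakL1Norm {n : ℕ} (g : EuclideanSpace ℝ (Fin n) → ℂ)
    (μ : Measure (EuclideanSpace ℝ (Fin n))) : ℝ≥0∞ :=
  ⨆ (t : ℝ) (_ : 0 < t), ENNReal.ofReal t * μ {x | t < ‖g x‖}

/-- The cutoff functions used to truncate the Riesz kernels: nonnegative, radial, smooth,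
supported in the closed ball of radius `2`, and equal to `1` on the unit ball. -/
structure IsRadialCutoff {n : ℕ} (Φ : EuclideanSpace ℝ (Fin n) → ℝ) : Prop where
  nonneg : ∀ z, 0 ≤ Φ z
  radial : ∀ z z', ‖z‖ = ‖z'‖ → Φ z = Φ z'
  smooth : ContDiff ℝ (⊤ : ℕ∞) Φ
  supp : tsupport Φ ⊆ Metric.closedBall 0 2
  eq_one : ∀ z ∈ Metric.ball (0 : EuclideanSpace ℝ (Fin n)) 1, Φ z = 1

/-- The kernel `K_j(z) = z_j / |z|^(n+1) * Φ(z)`. -/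
def rieszKernel {n : ℕ} (Φ : EuclideanSpace ℝ (Fin n) → ℝ) (j : Fin n)
    (z : EuclideanSpace ℝ (Fin n)) : ℝ :=
  z j / ‖z‖ ^ (n + 1) * Φ z

/-- The integral `∫_{|x-y|>ε} K_j(x-y) f(y) dy`. -/
def rieszCut {n : ℕ} (Φ : EuclideanSpace ℝ (Fin n) → ℝ) (j : Fin n)
    (f : EuclideanSpace ℝ (Fin n) → ℂ) (ε : ℝ) (x : EuclideanSpace ℝ (Fin n)) : ℂ :=
  ∫ y in {y | ε < ‖x - y‖}, rieszKernel Φ j (x - y) • f y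

/-- The principal value integral defining the truncated Riesz transform of `f` exists at `x`. -/
def RieszExistsAt {n : ℕ} (Φ : EuclideanSpace ℝ (Fin n) → ℝ) (j : Fin n)
    (f : EuclideanSpace ℝ (Fin n) → ℂ) (x : EuclideanSpace ℝ (Fin n)) : Prop :=
  (∀ ε : ℝ, 0 < ε →
    IntegrableOn (fun y => rieszKernel Φ j (x - y) • f y) {y | ε < ‖x - y‖} volume) ∧
  ∃ l : ℂ, Tendsto (fun ε : ℝ => rieszCut Φ j f ε x) (𝓝[>] 0) (𝓝 l)

/-- The truncated Riesz transform `R_j f(x) = p.v. ∫ K_j(x-y) f(y) dy`, meaningful at the points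
where the principal value exists. -/
def truncRiesz {n : ℕ} (Φ : EuclideanSpace ℝ (Fin n) → ℝ) (j : Fin n)
    (f : EuclideanSpace ℝ (Fin n) → ℂ) (x : EuclideanSpace ℝ (Fin n)) : ℂ :=
  limUnder (𝓝[>] (0 : ℝ)) fun ε => rieszCut Φ j f ε x

end

/-! The singular kernel is replaced by the smooth truncations `rieszTrunc Φ j N`, which are
continuous, have range 2 and satisfy Calderón–Zygmund bounds uniform in `N`
(`exists_isCZKernel_rieszTrunc`). The norm inequalities are proved for convolution with such
kernels, with constants independent of `N`, and pass to the limit by Fatou's lemma.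

Existence of the limit is an unweighted matter, because `L^p_w` lies in `L^1_loc`. Each truncation
is a sum of dilates of one odd Schwartz function, so the Fourier transforms are uniformly bounded
and Plancherel gives an `L²` bound. A Calderón–Zygmund decomposition turns it into weak type (1,1)
(`conv_weak_type`), and a Cotlar argument into weak type (1,1) for the supremum over all truncations
(`exists_maximal_truncation_weak_type`). Hence the smooth truncations converge almost everywhere. At
Lebesgue points the sharp truncations have the same limit, since the two kernels differ by a bounded
odd kernel living at scale `ε`.

Because the kernels have finite range, only balls of bounded radius matter. The conditions on cubes
of volume at most 1 extend to such balls by chaining the doubling property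
(`IsApPair.exists_of_pos`).

For the strong type, a stopping-time step (`exists_sparse_step`) bounds the localised operator by an
average, off subcubes of half the volume. Iterated, it bounds `∫_Q |Tf| G` by `ν(Q)` for every
measure `ν` that dominates the products of averages on large subsets of cubes
(`exists_lintegral_conv_mul_le`). With `G = w |Tf| ^ (p - 1)`, the Muckenhoupt condition and Young's
inequality produce such a `ν` from the maximal functions relative to `w` and to its dual weight.
These are bounded operators by doubling alone, and a small Young parameter lets `∫_Q |Tf| ^ p w` be
absorbed. The unit cubes are summed with bounded overlap (`exists_lintegral_conv_rpow_le`).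

For the weak type, `A_1 ⊆ A_2` supplies the bound on `L²_w`, and the Calderón–Zygmund argument of
`conv_weak_type` is run with the measure `w dx`. -/

/-! ### Maximal operators of doubling measures. -/

section Maximal

variable {X : Type*} [PseudoMetricSpace X] [MeasurableSpace X]

/-- The points lying in some ball of radius at most `R` over which the `μ`-average of `φ`
exceeds `t`. -/
def maxSet (μ : Measure X) (φ : X → ℝ≥0∞) (t : ℝ≥0∞) (R : ℝ) : Set X :=
  {x | ∃ c r, 0 < r ∧ r ≤ R ∧ x ∈ Metric.ball c r ∧
    t * μ (Metric.ball c r) < ∫⁻ y in Metric.ball c r, φ y ∂μ}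

/-- The uncentred maximal function over balls of radius at most `R`. -/
noncomputable def maxFn (μ : Measure X) (φ : X → ℝ≥0∞) (R : ℝ) (x : X) : ℝ≥0∞ :=
  ⨆ (c : X) (r : ℝ) (_ : 0 < r) (_ : r ≤ R) (_ : x ∈ Metric.ball c r),
    (∫⁻ y in Metric.ball c r, φ y ∂μ) / μ (Metric.ball c r)

lemma le_maxFn {μ : Measure X} {φ : X → ℝ≥0∞} {R : ℝ} {x c : X} {r : ℝ} (hr : 0 < r) (hR : r ≤ R)
    (hx : x ∈ Metric.ball c r) :
    (∫⁻ y in Metric.ball c r, φ y ∂μ) / μ (Metric.ball c r) ≤ maxFn μ φ R x :=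
  le_iSup_of_le c <| le_iSup_of_le r <| le_iSup_of_le hr <| le_iSup_of_le hR <|
    le_iSup_of_le hx le_rfl

lemma exists_of_lt_maxFn {μ : Measure X} {φ : X → ℝ≥0∞} {R : ℝ} {x : X} {t : ℝ≥0∞}
    (h : t < maxFn μ φ R x) : ∃ c r, 0 < r ∧ r ≤ R ∧ x ∈ Metric.ball c r ∧
      t < (∫⁻ y in Metric.ball c r, φ y ∂μ) / μ (Metric.ball c r) := by
  simp only [maxFn, lt_iSup_iff] at h
  obtain ⟨c, r, h1, h2, h3, h4⟩ := h
  exact ⟨c, r, h1, h2, h3, h4⟩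

lemma isOpen_lt_maxFn (μ : Measure X) (φ : X → ℝ≥0∞) (R : ℝ) (t : ℝ≥0∞) :
    IsOpen {x | t < maxFn μ φ R x} := by
  rw [isOpen_iff_mem_nhds]
  intro x hx
  obtain ⟨c, r, h1, h2, h3, h4⟩ := exists_of_lt_maxFn hx
  filter_upwards [Metric.isOpen_ball.mem_nhds h3] with y hy
  exact h4.trans_le (le_maxFn h1 h2 hy)

lemma isOpen_maxSet (μ : Measure X) (φ : X → ℝ≥0∞) (t : ℝ≥0∞) (R : ℝ) :
    IsOpen (maxSet μ φ t R) := by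
  rw [isOpen_iff_mem_nhds]
  rintro x ⟨c, r, h1, h2, h3, h4⟩
  filter_upwards [Metric.isOpen_ball.mem_nhds h3] with y hy
  exact ⟨c, r, h1, h2, hy, h4⟩

/-- The weak type `(1,1)` inequality for the maximal operator of a doubling measure. -/
theorem measure_maxSet_le [BorelSpace X] [SecondCountableTopology X] {μ : Measure X} {D : ℝ≥0∞}
    {R : ℝ}
    (hD : ∀ c r, 0 < r → r ≤ R → μ (Metric.ball c (5 * r)) ≤ D * μ (Metric.ball c r))
    (φ : X → ℝ≥0∞) (t : ℝ≥0∞) :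
    t * μ (maxSet μ φ t R) ≤ D * ∫⁻ x, φ x ∂μ := by
  let T : Set (X × ℝ) := {b | 0 < b.2 ∧ b.2 ≤ R ∧
    t * μ (Metric.ball b.1 b.2) < ∫⁻ y in Metric.ball b.1 b.2, φ y ∂μ}
  obtain ⟨u, huT, hdisj, hcov⟩ := Vitali.exists_disjoint_subfamily_covering_enlargement_ball T
    Prod.fst Prod.snd R (fun a ha => ha.2.1) 5 (by norm_num)
  have hcount : u.Countable := hdisj.countable_of_isOpen (fun _ _ => Metric.isOpen_ball)
    fun a ha => Metric.nonempty_ball.2 (huT ha).1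
  have hsub : maxSet μ φ t R ⊆ ⋃ b ∈ u, Metric.ball b.1 (5 * b.2) := by
    rintro x ⟨c, r, h1, h2, h3, h4⟩
    obtain ⟨b, hb, hsub⟩ := hcov (c, r) ⟨h1, h2, h4⟩
    exact Set.mem_biUnion hb (hsub h3)
  calc t * μ (maxSet μ φ t R) ≤ t * ∑' b : u, μ (Metric.ball b.1.1 (5 * b.1.2)) := by
        gcongr
        exact (measure_mono hsub).trans (measure_biUnion_le μ hcount _)
    _ = ∑' b : u, t * μ (Metric.ball b.1.1 (5 * b.1.2)) := ENNReal.tsum_mul_left.symm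
    _ ≤ ∑' b : u, D * ∫⁻ y in Metric.ball b.1.1 b.1.2, φ y ∂μ := by
        refine ENNReal.tsum_le_tsum fun b => ?_
        calc t * μ (Metric.ball b.1.1 (5 * b.1.2))
            ≤ t * (D * μ (Metric.ball b.1.1 b.1.2)) := by
              gcongr; exact hD _ _ (huT b.2).1 (huT b.2).2.1
          _ = D * (t * μ (Metric.ball b.1.1 b.1.2)) := by ring
          _ ≤ _ := by gcongr; exact (huT b.2).2.2.le
    _ = D * ∫⁻ y in ⋃ b ∈ u, Metric.ball b.1 b.2, φ y ∂μ := by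
        rw [ENNReal.tsum_mul_left, lintegral_biUnion hcount (fun _ _ => measurableSet_ball) hdisj]
    _ ≤ D * ∫⁻ x, φ x ∂μ := by gcongr; exact Measure.restrict_le_self

/-- The weak type `(1,1)` inequality without restriction on the radii. -/
theorem measure_iUnion_maxSet_le [BorelSpace X] [SecondCountableTopology X] {μ : Measure X}
    {D : ℝ≥0∞}
    (hD : ∀ c r, 0 < r → μ (Metric.ball c (5 * r)) ≤ D * μ (Metric.ball c r))
    (φ : X → ℝ≥0∞) (t : ℝ≥0∞) :
    t * μ (⋃ R : ℕ, maxSet μ φ t R) ≤ D * ∫⁻ x, φ x ∂μ := by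
  have hm : Monotone fun R : ℕ => maxSet μ φ t R := by
    rintro R R' hR x ⟨c, r, h1, h2, h3, h4⟩
    exact ⟨c, r, h1, h2.trans (by exact_mod_cast hR), h3, h4⟩
  rw [hm.measure_iUnion, ENNReal.mul_iSup]
  exact iSup_le fun R => measure_maxSet_le (fun c r h _ => hD c r h) φ t

lemma setLIntegral_le_of_notMem_iUnion_maxSet {μ : Measure X} {φ : X → ℝ≥0∞} {t : ℝ≥0∞} {x c : X}
    {r : ℝ} (hx : x ∉ ⋃ R : ℕ, maxSet μ φ t R) (hr : 0 < r) (hxc : x ∈ Metric.ball c r) :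
    ∫⁻ y in Metric.ball c r, φ y ∂μ ≤ t * μ (Metric.ball c r) := by
  by_contra! h
  obtain ⟨N, hN⟩ := exists_nat_ge r
  exact hx (Set.mem_iUnion.2 ⟨N, c, r, hr, hN, hxc, h⟩)

/-- A geometric series is comparable to its largest term, here the one with `2 ^ k < t ≤ 2 ^ (k +
1)`. With `rpow_le_tsum_zpow` it replaces the layer-cake integral by a sum over dyadic levels. -/
lemma tsum_zpow_rpow_le {s : ℝ} (hs : 0 < s) : ∃ C : ℝ≥0, ∀ t : ℝ≥0∞,
    ∑' k : ℤ, (if (2 : ℝ≥0∞) ^ k < t then ((2 : ℝ≥0∞) ^ k) ^ s else 0) ≤ C * t ^ s := by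
  have hlt : (2 : ℝ≥0∞) ^ (-s) < 1 := ENNReal.rpow_lt_one_of_one_lt_of_neg (by norm_num) (by linarith)
  set C : ℝ≥0∞ := (1 - (2 : ℝ≥0∞) ^ (-s))⁻¹ with hC
  have hC0 : C ≠ 0 := by simp [hC]
  have hCt : C ≠ ∞ := by simpa [hC, tsub_eq_zero_iff_le] using hlt
  refine ⟨C.toNNReal, fun t => ?_⟩
  rw [ENNReal.coe_toNNReal hCt]
  rcases eq_or_ne t 0 with rfl | h0
  · simp
  rcases eq_or_ne t ∞ with rfl | htop
  · simp [ENNReal.top_rpow_of_pos hs, ENNReal.mul_top hC0]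
  obtain ⟨K, hK1, hK2⟩ := ENNReal.exists_mem_Ioc_zpow h0 htop (y := 2) (by norm_num) (by norm_num)
  have hinj : Function.Injective fun j : ℕ => K - (j : ℤ) := by intro a b h; simpa using h
  rw [← hinj.tsum_eq]
  · calc _ ≤ ∑' j : ℕ, ((2 : ℝ≥0∞) ^ K) ^ s * ((2 : ℝ≥0∞) ^ (-s)) ^ j := by
          refine ENNReal.tsum_le_tsum fun j => ?_
          split_ifs
          · apply le_of_eq
            rw [← ENNReal.rpow_intCast, ← ENNReal.rpow_intCast, ← ENNReal.rpow_natCast,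
              ← ENNReal.rpow_mul, ← ENNReal.rpow_mul, ← ENNReal.rpow_mul,
              ← ENNReal.rpow_add _ _ (by norm_num) (by norm_num)]
            congr 1; push_cast; ring
          · exact zero_le
      _ = C * ((2 : ℝ≥0∞) ^ K) ^ s := by
          rw [ENNReal.tsum_mul_left, ENNReal.tsum_geometric, mul_comm]
      _ ≤ C * t ^ s := by gcongr
  · intro k hk
    have hk' : (2 : ℝ≥0∞) ^ k < t := by
      by_contra h; simp [h] at hk
    have : k < K + 1 := by
      by_contra! h
      exact absurd ((hk'.trans_le hK2).trans_le (ENNReal.zpow_le_of_le (by norm_num) h)) (lt_irrefl _)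
    exact ⟨(K - k).toNat, by simp only; omega⟩

lemma rpow_le_tsum_zpow {s : ℝ} (hs : 0 < s) (t : ℝ≥0∞) :
    t ^ s ≤ ∑' k : ℤ, (if (2 : ℝ≥0∞) ^ k < t then ((2 : ℝ≥0∞) ^ (k + 1)) ^ s else 0) := by
  rcases eq_or_ne t 0 with rfl | h0
  · simp [ENNReal.zero_rpow_of_pos hs]
  rcases eq_or_ne t ∞ with rfl | htop
  · have h2 : ∀ k : ℤ, (2 : ℝ≥0∞) ^ k < ∞ := fun k =>
      (ENNReal.zpow_lt_top (by norm_num) (by norm_num) k)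
    simp only [h2, if_true]
    rw [ENNReal.top_rpow_of_pos hs]
    have hinj : Function.Injective fun j : ℕ => (j : ℤ) := Nat.cast_injective
    refine le_trans ?_ (ENNReal.tsum_comp_le_tsum_of_injective hinj _)
    rw [← ENNReal.tsum_const_eq_top_of_ne_zero (α := ℕ) (c := 1) one_ne_zero]
    refine ENNReal.tsum_le_tsum fun j => ?_
    refine ENNReal.one_le_rpow ?_ hs
    have : ((2 : ℝ≥0∞) ^ ((j : ℤ) + 1)) = 2 ^ (j + 1) := by exact_mod_cast zpow_natCast (2 : ℝ≥0∞) (j + 1)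
    rw [this]
    exact one_le_pow₀ (by norm_num)
  obtain ⟨K, hK1, hK2⟩ := ENNReal.exists_mem_Ioc_zpow h0 htop (y := 2) (by norm_num) (by norm_num)
  refine le_trans ?_ (ENNReal.le_tsum K)
  rw [if_pos hK1]
  gcongr

/-- The strong type `(p,p)` inequality for the maximal operator of a doubling measure. -/
theorem lintegral_maxFn_rpow_le {p : ℝ} (hp : 1 < p) (D : ℝ≥0) : ∃ C : ℝ≥0,
    ∀ {X : Type} [PseudoMetricSpace X] [MeasurableSpace X] [BorelSpace X]
      [SecondCountableTopology X] (μ : Measure X) (R : ℝ),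
      (∀ c r, 0 < r → r ≤ R → μ (Metric.ball c (5 * r)) ≤ D * μ (Metric.ball c r)) →
      ∀ φ : X → ℝ≥0∞, Measurable φ →
        ∫⁻ x, maxFn μ φ R x ^ p ∂μ ≤ C * ∫⁻ x, φ x ^ p ∂μ := by
  -- The weak type bound contributes one factor `φ`, so the levels are summed with exponent `p - 1`;
  -- its positivity is where `p > 1` enters.
  obtain ⟨C, hC⟩ := tsum_zpow_rpow_le (s := p - 1) (by linarith)
  refine ⟨4 ^ p * D * C, fun {X} _ _ _ _ μ R hD φ hφ => ?_⟩
  have h2k : ∀ k : ℤ, (2 : ℝ≥0∞) ^ k ≠ 0 := fun k =>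
    (ENNReal.zpow_pos (by norm_num) (by norm_num) k).ne'
  have h2t : ∀ k : ℤ, (2 : ℝ≥0∞) ^ k ≠ ∞ := fun k =>
    (ENNReal.zpow_lt_top (by norm_num) (by norm_num) k).ne
  have hset : ∀ k : ℤ, MeasurableSet {x | (2 : ℝ≥0∞) ^ k < maxFn μ φ R x} := fun k =>
    (isOpen_lt_maxFn μ φ R _).measurableSet
  have hset' : ∀ k : ℤ, MeasurableSet {x | (2 : ℝ≥0∞) ^ k < φ x} := fun k => hφ measurableSet_Ioi
  -- the level sets of the maximal function are controlled by the large part of `φ`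
  have hweak : ∀ k : ℤ, (2 : ℝ≥0∞) ^ k * μ {x | (2 : ℝ≥0∞) ^ (k + 1) < maxFn μ φ R x} ≤
      D * ∫⁻ x in {x | (2 : ℝ≥0∞) ^ k < φ x}, φ x ∂μ := by
    intro k
    rw [← lintegral_indicator (hset' k)]
    refine le_trans (mul_le_mul_right (measure_mono fun x hx => ?_) _)
      (measure_maxSet_le hD _ ((2 : ℝ≥0∞) ^ k))
    obtain ⟨c, r, h1, h2, h3, h4⟩ := exists_of_lt_maxFn hx
    refine ⟨c, r, h1, h2, h3, ?_⟩
    have h5 := ENNReal.mul_lt_of_lt_div h4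
    -- The part of `φ` below `2 ^ k` adds at most `2 ^ k` to an average. An average above `2 ^ (k +
    -- 1)` leaves more than `2 ^ k` for the part above.
    have hsplit : ∫⁻ y in Metric.ball c r, φ y ∂μ ≤
        (∫⁻ y in Metric.ball c r, Set.indicator {x | (2 : ℝ≥0∞) ^ k < φ x} φ y ∂μ)
          + (2 : ℝ≥0∞) ^ k * μ (Metric.ball c r) := by
      rw [← setLIntegral_const, ← lintegral_add_right _ measurable_const]
      refine lintegral_mono fun y => ?_
      by_cases hy : (2 : ℝ≥0∞) ^ k < φ y
      · simp [Set.indicator, hy]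
      · simpa only [Set.indicator, Set.mem_ofPred_eq, hy, if_false, zero_add] using not_lt.1 hy
    have h6 : (2 : ℝ≥0∞) ^ (k + 1) * μ (Metric.ball c r) =
        (2 : ℝ≥0∞) ^ k * μ (Metric.ball c r) + (2 : ℝ≥0∞) ^ k * μ (Metric.ball c r) := by
      rw [ENNReal.zpow_add (by norm_num) (by norm_num), zpow_one]; ring
    rw [h6] at h5
    exact lt_of_add_lt_add_right (h5.trans_le hsplit)
  have hterm : ∀ k : ℤ, ((2 : ℝ≥0∞) ^ (k + 1 + 1)) ^ p *
      μ {x | (2 : ℝ≥0∞) ^ (k + 1) < maxFn μ φ R x} ≤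
      4 ^ p * D * (((2 : ℝ≥0∞) ^ k) ^ (p - 1) * ∫⁻ x in {x | (2 : ℝ≥0∞) ^ k < φ x}, φ x ∂μ) := by
    intro k
    have : ((2 : ℝ≥0∞) ^ (k + 1 + 1)) ^ p = 4 ^ p * (((2 : ℝ≥0∞) ^ k) ^ (p - 1) * (2 : ℝ≥0∞) ^ k) := by
      have e : ((2 : ℝ≥0∞) ^ k) ^ (p - 1) * (2 : ℝ≥0∞) ^ k = ((2 : ℝ≥0∞) ^ k) ^ p := by
        nth_rw 2 [← ENNReal.rpow_one ((2 : ℝ≥0∞) ^ k)]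
        rw [← ENNReal.rpow_add _ _ (h2k k) (h2t k)]; congr 1; ring
      rw [e, ← ENNReal.mul_rpow_of_nonneg _ _ (by linarith : (0 : ℝ) ≤ p)]
      congr 1
      rw [add_assoc, ENNReal.zpow_add (by norm_num) (by norm_num), mul_comm]
      congr 1
      norm_num
    calc _ = 4 ^ p * ((2 : ℝ≥0∞) ^ k) ^ (p - 1) *
          ((2 : ℝ≥0∞) ^ k * μ {x | (2 : ℝ≥0∞) ^ (k + 1) < maxFn μ φ R x}) := by rw [this]; ring
      _ ≤ 4 ^ p * ((2 : ℝ≥0∞) ^ k) ^ (p - 1) *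
          (D * ∫⁻ x in {x | (2 : ℝ≥0∞) ^ k < φ x}, φ x ∂μ) := 
            mul_le_mul_right (hweak k) _
      _ = _ := by ring
  calc ∫⁻ x, maxFn μ φ R x ^ p ∂μ
      ≤ ∫⁻ x, ∑' k : ℤ, (if (2 : ℝ≥0∞) ^ k < maxFn μ φ R x then
          ((2 : ℝ≥0∞) ^ (k + 1)) ^ p else 0) ∂μ :=
        lintegral_mono fun x => rpow_le_tsum_zpow (by linarith) _
    _ = ∑' k : ℤ, ((2 : ℝ≥0∞) ^ (k + 1)) ^ p * μ {x | (2 : ℝ≥0∞) ^ k < maxFn μ φ R x} := by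
        rw [lintegral_tsum fun k => (Measurable.ite (hset k) measurable_const
          measurable_const).aemeasurable]
        refine tsum_congr fun k => ?_
        rw [← lintegral_indicator_const (hset k)]
        exact lintegral_congr fun x => by simp [Set.indicator]
    _ = ∑' k : ℤ, ((2 : ℝ≥0∞) ^ (k + 1 + 1)) ^ p *
          μ {x | (2 : ℝ≥0∞) ^ (k + 1) < maxFn μ φ R x} :=
        ((Equiv.addRight (1 : ℤ)).tsum_eq _).symm
    _ ≤ ∑' k : ℤ, 4 ^ p * D *
          (((2 : ℝ≥0∞) ^ k) ^ (p - 1) * ∫⁻ x in {x | (2 : ℝ≥0∞) ^ k < φ x}, φ x ∂μ) :=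
        ENNReal.tsum_le_tsum hterm
    _ = 4 ^ p * D * ∫⁻ x, φ x * ∑' k : ℤ,
          (if (2 : ℝ≥0∞) ^ k < φ x then ((2 : ℝ≥0∞) ^ k) ^ (p - 1) else 0) ∂μ := by
        rw [ENNReal.tsum_mul_left]
        congr 1
        simp_rw [← ENNReal.tsum_mul_left]
        rw [lintegral_tsum fun k => ?_]
        swap
        · exact (hφ.mul (Measurable.ite (hset' k) measurable_const measurable_const)).aemeasurable
        refine tsum_congr fun k => ?_
        rw [← lintegral_const_mul _ hφ, ← lintegral_indicator (hset' k)]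
        refine lintegral_congr fun x => ?_
        by_cases hx : (2 : ℝ≥0∞) ^ k < φ x <;> simp [Set.indicator, hx, mul_comm]
    _ ≤ 4 ^ p * D * ∫⁻ x, C * φ x ^ p ∂μ := by
        refine mul_le_mul_right (lintegral_mono fun x => ?_) _
        calc _ ≤ φ x * (C * φ x ^ (p - 1)) := by gcongr; exact hC _
          _ = C * (φ x ^ (1 : ℝ) * φ x ^ (p - 1)) := by rw [ENNReal.rpow_one]; ring
          _ = C * φ x ^ p := by
            rw [← ENNReal.rpow_add_of_nonneg _ _ (by norm_num) (by linarith)]; congr 2; ring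
    _ = _ := by
        rw [lintegral_const_mul _ (hφ.pow_const p), ENNReal.coe_mul, ENNReal.coe_mul,
          ENNReal.coe_rpow_of_nonneg _ (by linarith : (0 : ℝ) ≤ p)]
        push_cast; ring

end Maximal

/-- Euclidean space `ℝⁿ`. -/
abbrev Eu (n : ℕ) := EuclideanSpace ℝ (Fin n)

/-! ### Dyadic grids, stopping cubes and Lebesgue points. -/

section Cells

variable {n : ℕ}

/-- The volume of the unit ball. -/
noncomputable def ballVol (n : ℕ) : ℝ≥0 := (volume (Metric.ball (0 : Eu n) 1)).toNNReal

lemma ballVol_coe (n : ℕ) : (ballVol n : ℝ≥0∞) = volume (Metric.ball (0 : Eu n) 1) :=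
  ENNReal.coe_toNNReal measure_ball_lt_top.ne

lemma ballVol_pos (n : ℕ) : 0 < ballVol n := by
  have := Metric.measure_ball_pos volume (0 : Eu n) one_pos
  rw [← ballVol_coe] at this
  exact_mod_cast this

lemma volume_ball_eq (c : Eu n) {r : ℝ} (hr : 0 < r) :
    volume (Metric.ball c r) = ballVol n * ENNReal.ofReal r ^ n := by
  rw [Measure.addHaar_ball_of_pos _ _ hr, ballVol_coe, mul_comm, finrank_euclideanSpace_fin,
    ENNReal.ofReal_pow hr.le]

lemma volume_ball_mul (c c' : Eu n) {a r : ℝ} (ha : 0 < a) (hr : 0 < r) :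
    volume (Metric.ball c (a * r)) = ENNReal.ofReal a ^ n * volume (Metric.ball c' r) := by
  rw [volume_ball_eq _ (mul_pos ha hr), volume_ball_eq _ hr, ENNReal.ofReal_mul ha.le, mul_pow]
  ring

/-- The multi-index of the half-open cube of the grid of mesh `ℓ` containing `x`. -/
noncomputable def cellIdx (ℓ : ℝ) (x : Eu n) : Fin n → ℤ := fun i => ⌊x i / ℓ⌋

/-- The half-open cubes of the grid of mesh `ℓ`. -/
def cell (ℓ : ℝ) (m : Fin n → ℤ) : Set (Eu n) := {x | cellIdx ℓ x = m}

/-- The centre of a grid cube. -/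
noncomputable def cellCenter (ℓ : ℝ) (m : Fin n → ℤ) : Eu n :=
  WithLp.toLp 2 fun i => (m i + 1 / 2) * ℓ

lemma measurable_cellIdx (ℓ : ℝ) : Measurable (cellIdx (n := n) ℓ) := by
  refine measurable_pi_lambda _ fun i => Int.measurable_floor.comp ?_
  exact (by fun_prop : Measurable fun x : Eu n => x i / ℓ)

lemma measurableSet_cell (ℓ : ℝ) (m : Fin n → ℤ) : MeasurableSet (cell ℓ m) :=
  measurable_cellIdx ℓ (measurableSet_singleton m)

lemma mem_cell_self (ℓ : ℝ) (x : Eu n) : x ∈ cell ℓ (cellIdx ℓ x) := rfl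

lemma disjoint_cell (ℓ : ℝ) {m m' : Fin n → ℤ} (h : m ≠ m') :
    Disjoint (cell ℓ m) (cell ℓ m') :=
  Set.disjoint_left.2 fun _ hx hx' => h (hx.symm.trans hx')

lemma iUnion_cell (ℓ : ℝ) : ⋃ m : Fin n → ℤ, cell ℓ m = Set.univ :=
  Set.eq_univ_of_forall fun x => Set.mem_iUnion.2 ⟨_, mem_cell_self ℓ x⟩

lemma volume_cell {ℓ : ℝ} (hℓ : 0 < ℓ) (m : Fin n → ℤ) :
    volume (cell ℓ m) = ENNReal.ofReal ℓ ^ n := by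
  have h : cell ℓ m = (MeasurableEquiv.toLp 2 (Fin n → ℝ)).symm ⁻¹'
      (Set.univ.pi fun i => Set.Ico (m i * ℓ : ℝ) ((m i + 1) * ℓ)) := by
    ext x
    simp only [cell, cellIdx, Set.mem_ofPred_eq, funext_iff, Set.mem_preimage, Set.mem_pi,
      Set.mem_univ, true_imp_iff, Set.mem_Ico, Int.floor_eq_iff, le_div_iff₀ hℓ, div_lt_iff₀ hℓ]
    rfl
  rw [h, (EuclideanSpace.volume_preserving_symm_measurableEquiv_toLp (Fin n)).measure_preimage
    (MeasurableSet.univ_pi fun i => measurableSet_Ico).nullMeasurableSet, Real.volume_pi_Ico]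
  have : ∀ i, ((m i + 1 : ℝ) * ℓ - m i * ℓ) = ℓ := fun i => by ring
  simp [this]

lemma cell_nonempty {ℓ : ℝ} (hℓ : 0 < ℓ) (m : Fin n → ℤ) : cellCenter ℓ m ∈ cell ℓ m := by
  simp only [cell, cellIdx, Set.mem_ofPred_eq, funext_iff, cellCenter, Int.floor_eq_iff,
    le_div_iff₀ hℓ, div_lt_iff₀ hℓ]
  intro i
  constructor <;> nlinarith

lemma dist_cellCenter_le {ℓ : ℝ} (hℓ : 0 < ℓ) {m : Fin n → ℤ} {x : Eu n} (hx : x ∈ cell ℓ m) :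
    dist x (cellCenter ℓ m) ≤ n * ℓ / 2 := by
  rw [EuclideanSpace.dist_eq]
  refine Real.sqrt_le_iff.2 ⟨by positivity, ?_⟩
  have h1 : ∀ i, dist (x i) (cellCenter ℓ m i) ^ 2 ≤ ℓ ^ 2 / 4 := by
    intro i
    have := congrFun hx i
    simp only [cellIdx, Int.floor_eq_iff, le_div_iff₀ hℓ, div_lt_iff₀ hℓ] at this
    rw [Real.dist_eq, sq_abs]
    simp only [cellCenter]
    nlinarith [this.1, this.2]
  calc _ ≤ ∑ i : Fin n, ℓ ^ 2 / 4 := Finset.sum_le_sum fun i _ => h1 i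
    _ = n * (ℓ ^ 2 / 4) := by simp
    -- The crude `n` in place of `√n` keeps square roots out of the later constants.
    _ ≤ n ^ 2 * (ℓ ^ 2 / 4) := by
      gcongr
      exact_mod_cast Nat.le_self_pow two_ne_zero n
    _ = _ := by ring

/-- The grids of mesh `ℓ` and `ℓ / 2` are nested because `⌊y / 2⌋ = ⌊⌊y⌋ / 2⌋`; this makes the
dyadic cubes a tree. -/
lemma cellIdx_half (ℓ : ℝ) (x : Eu n) : cellIdx ℓ x = fun i => cellIdx (ℓ / 2) x i / 2 := by
  funext i
  have := Int.floor_div_natCast (x i / (ℓ / 2)) 2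
  simp only [cellIdx]
  rw [Nat.cast_two] at this
  push_cast at this
  rw [← this]
  congr 1
  rcases eq_or_ne ℓ 0 with rfl | h
  · simp
  · field_simp

lemma cellIdx_eq_of_le {s : ℝ} {x y : Eu n} {j k : ℕ} (hjk : j ≤ k)
    (h : cellIdx (s / 2 ^ k) x = cellIdx (s / 2 ^ k) y) :
    cellIdx (s / 2 ^ j) x = cellIdx (s / 2 ^ j) y := by
  induction k, hjk using Nat.le_induction with
  | base => exact h
  | succ k _ ih =>
    refine ih ?_
    rw [cellIdx_half, cellIdx_half (x := y)]
    have e : s / 2 ^ k / 2 = s / 2 ^ (k + 1) := by rw [pow_succ]; field_simp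
    rw [e, h]

/-- The dyadic cubes of side `s / 2 ^ k`. -/
abbrev dyadic (s : ℝ) (q : ℕ × (Fin n → ℤ)) : Set (Eu n) := cell (s / 2 ^ q.1) q.2

/-- The maximal dyadic cubes on which the `ν`-density exceeds `t`. -/
theorem exists_stopping_cubes (ν : Measure (Eu n)) (t : ℝ≥0∞) {s : ℝ} (hs : 0 < s) :
    ∃ S : Set (ℕ × (Fin n → ℤ)), S.PairwiseDisjoint (dyadic s) ∧
      (∀ q ∈ S, t * volume (dyadic s q) < ν (dyadic s q)) ∧
      (∀ q ∈ S, q.1 ≠ 0 → ν (dyadic s q) ≤ 2 ^ n * (t * volume (dyadic s q))) ∧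
      ∀ x k, t * volume (cell (s / 2 ^ k) (cellIdx (s / 2 ^ k) x)) <
        ν (cell (s / 2 ^ k) (cellIdx (s / 2 ^ k) x)) → x ∈ ⋃ q ∈ S, dyadic s q := by
  let bad : ℕ → Eu n → Prop := fun k x =>
    t * volume (cell (s / 2 ^ k) (cellIdx (s / 2 ^ k) x)) <
      ν (cell (s / 2 ^ k) (cellIdx (s / 2 ^ k) x))
  have hbad : ∀ {j k : ℕ} {x y : Eu n}, j ≤ k → cellIdx (s / 2 ^ k) x = cellIdx (s / 2 ^ k) y →
      bad j x → bad j y := by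
    intro j k x y hjk hxy h
    simpa only [bad, cellIdx_eq_of_le hjk hxy] using h
  have hpos : ∀ k : ℕ, 0 < s / 2 ^ k := fun k => by positivity
  -- Badness at levels up to `q.1` is constant on the cube, so the condition says that the cube is
  -- bad and no ancestor is. The upper bound for `ν` comes from the parent, whose volume is `2 ^ n`
  -- times larger; cubes at level 0 have none.
  refine ⟨{q | ∀ x ∈ dyadic s q, bad q.1 x ∧ ∀ j < q.1, ¬ bad j x}, ?_, ?_, ?_, ?_⟩
  · rintro ⟨k, m⟩ hq ⟨k', m'⟩ hq' hne
    refine Set.disjoint_left.2 fun x hx hx' => hne ?_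
    have h1 := hq x hx
    have h2 := hq' x hx'
    obtain rfl : k = k' := le_antisymm (not_lt.1 fun h => h1.2 _ h h2.1)
      (not_lt.1 fun h => h2.2 _ h h1.1)
    exact Prod.ext rfl (hx.symm.trans hx')
  · rintro ⟨k, m⟩ hq
    have hc := cell_nonempty (hpos k) m
    have := (hq _ hc).1
    have e : cellIdx (s / 2 ^ k) (cellCenter (s / 2 ^ k) m) = m := hc
    simpa only [bad, e] using this
  · rintro ⟨k, m⟩ hq hk
    obtain ⟨k, rfl⟩ := Nat.exists_eq_succ_of_ne_zero hk
    have hc := cell_nonempty (hpos (k + 1)) m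
    set c := cellCenter (s / 2 ^ (k + 1)) m
    have h1 := (hq _ hc).2 k (Nat.lt_succ_self k)
    simp only [bad, not_lt] at h1
    have hsub : dyadic s (k + 1, m) ⊆ cell (s / 2 ^ k) (cellIdx (s / 2 ^ k) c) := fun x hx =>
      cellIdx_eq_of_le (Nat.le_succ k) (hx.trans hc.symm)
    refine (measure_mono hsub).trans (h1.trans_eq ?_)
    rw [volume_cell (hpos k), volume_cell (hpos (k + 1))]
    have : s / 2 ^ k = 2 * (s / 2 ^ (k + 1)) := by rw [pow_succ]; field_simp
    rw [this, ENNReal.ofReal_mul (by norm_num), mul_pow]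
    simp only [ENNReal.ofReal_ofNat]
    ring
  · intro x k hk
    classical
    have hex : ∃ k, bad k x := ⟨k, hk⟩
    refine Set.mem_biUnion (x := (Nat.find hex, cellIdx (s / 2 ^ Nat.find hex) x)) ?_
      (mem_cell_self _ x)
    intro y hy
    have hy' : cellIdx (s / 2 ^ Nat.find hex) y = cellIdx (s / 2 ^ Nat.find hex) x := hy
    exact ⟨hbad le_rfl hy'.symm (Nat.find_spec hex),
      fun j hj h => Nat.find_min hex hj (hbad hj.le hy' h)⟩

lemma cell_subset_closedBall {ℓ : ℝ} (hℓ : 0 < ℓ) {m : Fin n → ℤ} {x : Eu n}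
    (hx : x ∈ cell ℓ m) : cell ℓ m ⊆ Metric.closedBall x (n * ℓ) := by
  intro y hy
  have h1 := dist_cellCenter_le hℓ hx
  have h2 := dist_cellCenter_le hℓ hy
  rw [Metric.mem_closedBall]
  have := dist_triangle_right y x (cellCenter ℓ m)
  linarith

lemma ae_tendsto_lintegral_enorm_sub_div {F : Type*} [NormedAddCommGroup F] {f : Eu n → F}
    (hf : LocallyIntegrable f volume) : ∀ᵐ x, Tendsto (fun r : ℝ =>
      (∫⁻ y in Metric.closedBall x r, ‖f y - f x‖ₑ) / volume (Metric.closedBall x r))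
      (𝓝[>] 0) (𝓝 0) := by
  filter_upwards [(Besicovitch.vitaliFamily (volume : Measure (Eu n))).ae_tendsto_lintegral_enorm_sub_div
    hf] with x hx
  exact hx.comp (Besicovitch.tendsto_filterAt volume x)

/-- A function is almost everywhere bounded by any bound for its averages over the dyadic cubes
containing the point. -/
theorem ae_enorm_le_of_dyadic_averages_le {F : Type*} [NormedAddCommGroup F] (hn : 0 < n)
    {f : Eu n → F} (hf : LocallyIntegrable f volume) {s : ℝ} (hs : 0 < s) :
    ∀ᵐ x, ∀ t : ℝ≥0∞, (∀ k : ℕ, ∫⁻ y in cell (s / 2 ^ k) (cellIdx (s / 2 ^ k) x), ‖f y‖ₑ ≤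
      t * volume (cell (s / 2 ^ k) (cellIdx (s / 2 ^ k) x))) → ‖f x‖ₑ ≤ t := by
  filter_upwards [ae_tendsto_lintegral_enorm_sub_div hf] with x hx t ht
  have hpos : ∀ k : ℕ, 0 < s / 2 ^ k := fun k => by positivity
  have hlim : Tendsto (fun k : ℕ => (n : ℝ) * (s / 2 ^ k)) atTop (𝓝[>] 0) := by
    refine tendsto_nhdsWithin_iff.2 ⟨?_, Eventually.of_forall fun k => ?_⟩
    · have : Tendsto (fun k : ℕ => n * s * ((1 / 2 : ℝ)) ^ k) atTop (𝓝 (n * s * 0)) :=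
        (tendsto_pow_atTop_nhds_zero_of_lt_one (by norm_num) (by norm_num)).const_mul _
      simpa [div_eq_mul_inv, mul_assoc] using this
    · have := hpos k
      exact mul_pos (by exact_mod_cast hn) this
  have h1 := hx.comp hlim
  -- compare the ball with the cube
  set D : ℝ≥0∞ := ballVol n * (n : ℝ≥0∞) ^ n with hD
  have hDt : D ≠ ∞ := by simp [hD, ENNReal.mul_eq_top]
  have hvol : ∀ k : ℕ, volume (Metric.closedBall x (n * (s / 2 ^ k))) =
      D * volume (cell (s / 2 ^ k) (cellIdx (s / 2 ^ k) x)) := by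
    intro k
    have : Nonempty (Fin n) := ⟨⟨0, hn⟩⟩
    rw [Measure.addHaar_closedBall_eq_addHaar_ball,
      volume_ball_eq _ (mul_pos (by exact_mod_cast hn) (hpos k)), volume_cell (hpos k),
      ENNReal.ofReal_mul (by positivity), mul_pow, ENNReal.ofReal_natCast, hD]
    ring
  have hkey : ∀ k : ℕ, ‖f x‖ₑ ≤ t + D * ((∫⁻ y in Metric.closedBall x (n * (s / 2 ^ k)),
      ‖f y - f x‖ₑ) / volume (Metric.closedBall x (n * (s / 2 ^ k)))) := by
    intro k
    set Q := cell (s / 2 ^ k) (cellIdx (s / 2 ^ k) x) with hQ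
    have hQ0 : volume Q ≠ 0 := by rw [hQ, volume_cell (hpos k)]; simp [hpos k]
    have hQt : volume Q ≠ ∞ := by rw [hQ, volume_cell (hpos k)]; simp
    have hsub : Q ⊆ Metric.closedBall x (n * (s / 2 ^ k)) :=
      cell_subset_closedBall (hpos k) (mem_cell_self _ x)
    have h2 : ‖f x‖ₑ * volume Q ≤ t * volume Q +
        ∫⁻ y in Metric.closedBall x (n * (s / 2 ^ k)), ‖f y - f x‖ₑ := by
      calc ‖f x‖ₑ * volume Q = ∫⁻ y in Q, ‖f x‖ₑ := (setLIntegral_const _ _).symm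
        _ ≤ ∫⁻ y in Q, (‖f y‖ₑ + ‖f y - f x‖ₑ) := by
          refine lintegral_mono fun y => ?_
          have := enorm_sub_le (E := F) (a := f y) (b := f y - f x)
          simpa using this
        _ = (∫⁻ y in Q, ‖f y‖ₑ) + ∫⁻ y in Q, ‖f y - f x‖ₑ :=
          lintegral_add_left' hf.aestronglyMeasurable.restrict.enorm _
        _ ≤ _ := add_le_add (ht k) (lintegral_mono_set hsub)
    rw [hvol k]
    have h3 : D * ((∫⁻ y in Metric.closedBall x (n * (s / 2 ^ k)), ‖f y - f x‖ₑ) /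
        (D * volume Q)) = (∫⁻ y in Metric.closedBall x (n * (s / 2 ^ k)), ‖f y - f x‖ₑ) /
        volume Q := by
      have hD0 : D ≠ 0 := by
        have := (ballVol_pos n).ne'
        simp [hD, this, hn.ne']
      rw [← mul_div_assoc, ENNReal.mul_div_mul_left _ _ hD0 hDt]
    rw [h3]
    calc ‖f x‖ₑ = ‖f x‖ₑ * volume Q / volume Q := (ENNReal.mul_div_cancel_right hQ0 hQt).symm
      _ ≤ (t * volume Q + ∫⁻ y in Metric.closedBall x (n * (s / 2 ^ k)), ‖f y - f x‖ₑ) /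
          volume Q := by gcongr
      _ = _ := by rw [ENNReal.add_div, ENNReal.mul_div_cancel_right hQ0 hQt]
  have h4 := (ENNReal.Tendsto.const_mul h1 (Or.inr hDt)).const_add t
  rw [mul_zero, add_zero] at h4
  exact ge_of_tendsto' h4 hkey

end Cells

/-! ### Calderón–Zygmund kernels of finite range. -/

section Kernels

variable {n : ℕ}

/-- A decaying kernel is controlled by the growth of the measure. -/
theorem lintegral_compl_ball_le {ν : Measure (Eu n)} {c : Eu n} {ρ : ℝ} (hρ : 0 < ρ) {Λ : ℝ≥0∞}
    (hν : ∀ r, ρ ≤ r → ν (Metric.ball c r) ≤ Λ * ENNReal.ofReal r ^ n) :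
    ∫⁻ y in (Metric.ball c ρ)ᶜ, ENNReal.ofReal (ρ / dist y c ^ (n + 1)) ∂ν ≤
      2 ^ (n + 1) * Λ := by
  have hpos : ∀ j : ℕ, 0 < 2 ^ j * ρ := fun j => by positivity
  -- On the annulus `2 ^ j * ρ ≤ dist y c < 2 ^ (j + 1) * ρ` the integrand is at most `ρ / (2 ^ j *
  -- ρ) ^ (n + 1)`, and the mass is at most `Λ * (2 ^ (j + 1) * ρ) ^ n`. The products decay like `2
  -- ^ (-j)`.
  calc ∫⁻ y in (Metric.ball c ρ)ᶜ, ENNReal.ofReal (ρ / dist y c ^ (n + 1)) ∂ν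
      ≤ ∫⁻ y, ∑' j : ℕ, (Metric.ball c (2 ^ (j + 1) * ρ)).indicator
          (fun _ => ENNReal.ofReal (ρ / (2 ^ j * ρ) ^ (n + 1))) y ∂ν := by
        rw [← lintegral_indicator measurableSet_ball.compl]
        refine lintegral_mono fun y => ?_
        by_cases hy : y ∈ Metric.ball c ρ
        · simp [hy]
        · rw [Set.indicator_of_mem hy]
          rw [Metric.mem_ball, not_lt] at hy
          obtain ⟨j, h1, h2⟩ := exists_nat_pow_near ((one_le_div hρ).2 hy) one_lt_two
          rw [le_div_iff₀ hρ] at h1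
          rw [div_lt_iff₀ hρ] at h2
          refine le_trans ?_ (ENNReal.le_tsum j)
          rw [Set.indicator_of_mem (Metric.mem_ball.2 h2)]
          have := hpos j
          gcongr
    _ = ∑' j : ℕ, ENNReal.ofReal (ρ / (2 ^ j * ρ) ^ (n + 1)) *
          ν (Metric.ball c (2 ^ (j + 1) * ρ)) := by
        rw [lintegral_tsum fun j => (measurable_const.indicator measurableSet_ball).aemeasurable]
        exact tsum_congr fun j => lintegral_indicator_const measurableSet_ball _
    _ ≤ ∑' j : ℕ, 2 ^ n * Λ * (2⁻¹ : ℝ≥0∞) ^ j := by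
        refine ENNReal.tsum_le_tsum fun j => ?_
        have h1 : ρ ≤ 2 ^ (j + 1) * ρ := le_mul_of_one_le_left hρ.le (one_le_pow₀ (by norm_num))
        calc _ ≤ ENNReal.ofReal (ρ / (2 ^ j * ρ) ^ (n + 1)) *
              (Λ * ENNReal.ofReal (2 ^ (j + 1) * ρ) ^ n) := by gcongr; exact hν _ h1
          _ = Λ * ENNReal.ofReal (ρ / (2 ^ j * ρ) ^ (n + 1) * (2 ^ (j + 1) * ρ) ^ n) := by
              rw [ENNReal.ofReal_mul (p := ρ / (2 ^ j * ρ) ^ (n + 1)) (by positivity),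
                ENNReal.ofReal_pow (by positivity)]
              ring
          _ = Λ * ENNReal.ofReal (2 ^ n * (2⁻¹) ^ j) := by
              congr 2
              rw [inv_pow]
              field_simp
              ring
          _ = _ := by
              rw [ENNReal.ofReal_mul (by positivity), ENNReal.ofReal_pow (by norm_num),
                ENNReal.ofReal_pow (by norm_num), ENNReal.ofReal_inv_of_pos (by norm_num)]
              simp only [ENNReal.ofReal_ofNat]
              ring
    _ = _ := by
        rw [ENNReal.tsum_mul_left, ENNReal.tsum_geometric, ENNReal.one_sub_inv_two, inv_inv]
        ring

/-- Continuous Calderón–Zygmund kernels supported in the ball of radius `2`. -/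
structure IsCZKernel (A : ℝ≥0) (K : Eu n → ℝ) : Prop where
  cont : Continuous K
  supp : ∀ z, 2 < ‖z‖ → K z = 0
  size : ∀ z, |K z| * ‖z‖ ^ n ≤ A
  reg : ∀ z z', 2 * ‖z - z'‖ ≤ ‖z‖ → |K z - K z'| * ‖z‖ ^ (n + 1) ≤ A * ‖z - z'‖

/-- The convolution `∫ K(x-y) f(y) dy`. -/
noncomputable def conv (K : Eu n → ℝ) (f : Eu n → ℂ) (x : Eu n) : ℂ := ∫ y, K (x - y) • f y

variable {A : ℝ≥0} {K : Eu n → ℝ}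

lemma IsCZKernel.hasCompactSupport (hK : IsCZKernel A K) : HasCompactSupport K :=
  HasCompactSupport.intro (isCompact_closedBall 0 2) fun z hz => hK.supp z (by simpa using hz)

lemma IsCZKernel.exists_bound (hK : IsCZKernel A K) : ∃ B : ℝ≥0, ∀ z, ‖K z‖ₑ ≤ B := by
  obtain ⟨B, hB⟩ := hK.hasCompactSupport.exists_bound_of_continuous hK.cont
  refine ⟨B.toNNReal, fun z => ?_⟩
  rw [← ofReal_norm]
  exact ENNReal.ofReal_le_ofReal (hB z)

lemma IsCZKernel.integrable (hK : IsCZKernel A K) {f : Eu n → ℂ} (hf : LocallyIntegrable f volume)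
    (x : Eu n) : Integrable (fun y => K (x - y) • f y) := by
  refine hf.integrable_smul_left_of_hasCompactSupport (hK.cont.comp (by fun_prop)) ?_
  exact hK.hasCompactSupport.comp_homeomorph (Homeomorph.subLeft x)

lemma IsCZKernel.continuous_conv (hK : IsCZKernel A K) {f : Eu n → ℂ}
    (hf : LocallyIntegrable f volume) : Continuous (conv K f) :=
  hK.hasCompactSupport.continuous_convolution_right
    (ContinuousLinearMap.lsmul ℝ ℝ (E := ℂ)).flip hf hK.cont

lemma enorm_conv_le (K : Eu n → ℝ) (f : Eu n → ℂ) (x : Eu n) :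
    ‖conv K f x‖ₑ ≤ ∫⁻ y, ‖K (x - y)‖ₑ * ‖f y‖ₑ := by
  refine (enorm_integral_le_lintegral_enorm _).trans_eq ?_
  simp_rw [enorm_smul]

lemma conv_congr_ae {f g : Eu n → ℂ} (h : f =ᵐ[volume] g) (x : Eu n) :
    conv K f x = conv K g x :=
  integral_congr_ae (h.mono fun y hy => by simp only [hy])

/-- The finite range of the kernel is what makes hypotheses on small cubes sufficient; each later
localisation rests on it. -/
lemma IsCZKernel.conv_congr (hK : IsCZKernel A K) {f g : Eu n → ℂ} {x : Eu n}
    (h : ∀ y, dist y x ≤ 2 → f y = g y) : conv K f x = conv K g x := by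
  refine integral_congr_ae (Eventually.of_forall fun y => ?_)
  by_cases hy : dist y x ≤ 2
  · simp only [h y hy]
  · have : K (x - y) = 0 := hK.supp _ (by rwa [dist_comm, dist_eq_norm, not_le] at hy)
    simp [this]

lemma IsCZKernel.conv_add (hK : IsCZKernel A K) {f g : Eu n → ℂ} (hf : LocallyIntegrable f volume)
    (hg : LocallyIntegrable g volume) (x : Eu n) :
    conv K (f + g) x = conv K f x + conv K g x := by
  simp only [conv, Pi.add_apply, smul_add]
  exact integral_add (hK.integrable hf x) (hK.integrable hg x)

lemma IsCZKernel.conv_sub (hK : IsCZKernel A K) {f g : Eu n → ℂ} (hf : LocallyIntegrable f volume)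
    (hg : LocallyIntegrable g volume) (x : Eu n) :
    conv K (f - g) x = conv K f x - conv K g x := by
  simp only [conv, Pi.sub_apply, smul_sub]
  exact integral_sub (hK.integrable hf x) (hK.integrable hg x)

lemma IsCZKernel.conv_indicator_add (hK : IsCZKernel A K) {f : Eu n → ℂ}
    (hf : LocallyIntegrable f volume) {S : Set (Eu n)} (hS : MeasurableSet S) (x : Eu n) :
    conv K f x = conv K (S.indicator f) x + conv K (Sᶜ.indicator f) x := by
  rw [← hK.conv_add (hf.indicator hS) (hf.indicator hS.compl), Set.indicator_self_add_compl]

lemma IsCZKernel.enorm_sub_le (hK : IsCZKernel A K) {z a : Eu n} {ρ : ℝ} (ha : ‖a‖ ≤ ρ)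
    (hρ : 0 < ρ) (hz : 2 * ρ ≤ ‖z‖) :
    ‖K z - K (z + a)‖ₑ ≤ A * ENNReal.ofReal (ρ / ‖z‖ ^ (n + 1)) := by
  have h := hK.reg z (z + a) (by simpa using by linarith)
  have hz0 : 0 < ‖z‖ := by linarith
  rw [← ofReal_norm, ← ENNReal.ofReal_coe_nnreal, ← ENNReal.ofReal_mul (p := (A : ℝ)) A.2]
  refine ENNReal.ofReal_le_ofReal ?_
  rw [Real.norm_eq_abs, ← mul_div_assoc, le_div_iff₀ (by positivity)]
  refine h.trans ?_
  have : ‖z - (z + a)‖ ≤ ρ := by simpa using ha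
  exact mul_le_mul_of_nonneg_left this A.2

/-- Away from the support of `f` the convolution oscillates little. -/
theorem IsCZKernel.enorm_conv_sub_le (hK : IsCZKernel A K) {f : Eu n → ℂ}
    (hf : LocallyIntegrable f volume) {c x x' : Eu n} {ρ : ℝ} (hρ : 0 < ρ) (hx : dist x c ≤ ρ)
    (hx' : dist x' c ≤ ρ) (hfc : ∀ y ∈ Metric.ball c (2 * ρ), f y = 0) {Λ : ℝ≥0∞}
    (hΛ : ∀ r, 2 * ρ ≤ r → ∫⁻ y in Metric.ball c r, ‖f y‖ₑ ≤ Λ * ENNReal.ofReal r ^ n) :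
    ‖conv K f x - conv K f x'‖ₑ ≤ A * 2 ^ (n + 2) * Λ := by
  have hfm : AEMeasurable (fun y => ‖f y‖ₑ) volume := hf.aestronglyMeasurable.enorm
  have hpt : ∀ y, 2 * ρ ≤ dist y c → ‖K (x - y) - K (x' - y)‖ₑ ≤
      2 * A * ENNReal.ofReal (2 * ρ / dist y c ^ (n + 1)) := by
    intro y hy
    have e : ‖c - y‖ = dist y c := by rw [dist_comm, dist_eq_norm]
    have h1 := hK.enorm_sub_le (z := c - y) (a := x - c) (by rwa [← dist_eq_norm]) hρ
      (by rwa [e])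
    have h2 := hK.enorm_sub_le (z := c - y) (a := x' - c) (by rwa [← dist_eq_norm]) hρ
      (by rwa [e])
    rw [show c - y + (x - c) = x - y by abel, e] at h1
    rw [show c - y + (x' - c) = x' - y by abel, e] at h2
    have h3 : ENNReal.ofReal (ρ / dist y c ^ (n + 1)) ≤
        ENNReal.ofReal (2 * ρ / dist y c ^ (n + 1)) := by gcongr; linarith
    calc ‖K (x - y) - K (x' - y)‖ₑ = ‖(K (c - y) - K (x' - y)) - (K (c - y) - K (x - y))‖ₑ := by
          congr 1; ring
      _ ≤ ‖K (c - y) - K (x' - y)‖ₑ + ‖K (c - y) - K (x - y)‖ₑ := _root_.enorm_sub_le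
      _ ≤ A * ENNReal.ofReal (2 * ρ / dist y c ^ (n + 1)) +
          A * ENNReal.ofReal (2 * ρ / dist y c ^ (n + 1)) := by
          gcongr
          · exact h2.trans (by gcongr)
          · exact h1.trans (by gcongr)
      _ = _ := by ring
  have e : conv K f x - conv K f x' = ∫ y, (K (x - y) - K (x' - y)) • f y := by
    rw [conv, conv, ← integral_sub (hK.integrable hf x) (hK.integrable hf x')]
    simp only [sub_smul]
  have hmeas : Measurable fun y : Eu n => ENNReal.ofReal (2 * ρ / dist y c ^ (n + 1)) := by
    fun_prop
  rw [e]
  calc _ ≤ ∫⁻ y, ‖(K (x - y) - K (x' - y)) • f y‖ₑ := enorm_integral_le_lintegral_enorm _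
    _ ≤ ∫⁻ y, (Metric.ball c (2 * ρ))ᶜ.indicator (fun y => 2 * A *
          (‖f y‖ₑ * ENNReal.ofReal (2 * ρ / dist y c ^ (n + 1)))) y := by
        refine lintegral_mono fun y => ?_
        rw [enorm_smul]
        by_cases hy : y ∈ Metric.ball c (2 * ρ)
        · simp [hfc y hy]
        · rw [Set.indicator_of_mem hy]
          calc _ ≤ 2 * A * ENNReal.ofReal (2 * ρ / dist y c ^ (n + 1)) * ‖f y‖ₑ := by
                gcongr; exact hpt y (by simpa using hy)
            _ = _ := by ring
    _ = 2 * A * ∫⁻ y in (Metric.ball c (2 * ρ))ᶜ, ENNReal.ofReal (2 * ρ / dist y c ^ (n + 1))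
          ∂(volume.withDensity fun y => ‖f y‖ₑ) := by
        rw [lintegral_indicator measurableSet_ball.compl, lintegral_const_mul' _ _ (by finiteness),
          restrict_withDensity measurableSet_ball.compl,
          lintegral_withDensity_eq_lintegral_mul₀ hfm.restrict hmeas.aemeasurable]
        rfl
    _ ≤ 2 * A * (2 ^ (n + 1) * Λ) := by
        gcongr
        refine lintegral_compl_ball_le (by positivity) fun r hr => ?_
        rw [withDensity_apply _ measurableSet_ball]
        exact hΛ r hr
    _ = _ := by ring

end Kernels

/-! ### The local A₁ condition for measures and the Calderón–Zygmund decomposition. -/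

section WeakType

variable {n : ℕ} {A : ℝ≥0} {K : Eu n → ℝ}

/-- The local `A₁` condition for a measure, on balls of radius at most `R`. -/
def IsA1Measure (μ : Measure (Eu n)) (A₁ : ℝ≥0) (R : ℝ) : Prop :=
  ∀ c r, 0 < r → r ≤ R → ∀ g : Eu n → ℝ≥0∞, AEMeasurable g volume →
    μ (Metric.ball c r) * ∫⁻ y in Metric.ball c r, g y ≤
      A₁ * volume (Metric.ball c r) * ∫⁻ y in Metric.ball c r, g y ∂μ

lemma isA1Measure_volume (R : ℝ) : IsA1Measure (volume : Measure (Eu n)) 1 R := by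
  intro c r _ _ g _
  simp

lemma IsA1Measure.measure_ball_mul_le {μ : Measure (Eu n)} {A₁ : ℝ≥0} {R : ℝ}
    (h : IsA1Measure μ A₁ R) {c : Eu n} {r : ℝ} (hr : 0 < r) (hR : r ≤ R) {S : Set (Eu n)}
    (hS : MeasurableSet S) (hSc : S ⊆ Metric.ball c r) {g : Eu n → ℝ≥0∞}
    (hg : AEMeasurable g volume) :
    μ (Metric.ball c r) * ∫⁻ y in S, g y ≤
      A₁ * (ballVol n * ENNReal.ofReal r ^ n) * ∫⁻ y in S, g y ∂μ := by
  have := h c r hr hR (S.indicator g) (hg.indicator hS)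
  rwa [setLIntegral_indicator hS, setLIntegral_indicator hS, Set.inter_eq_left.2 hSc,
    volume_ball_eq c hr] at this

lemma cell_subset_ball_center (hn : 0 < n) {ℓ : ℝ} (hℓ : 0 < ℓ) (m : Fin n → ℤ) {r : ℝ}
    (hr : n * ℓ ≤ r) : cell ℓ m ⊆ Metric.ball (cellCenter ℓ m) r := by
  intro y hy
  have h1 := dist_cellCenter_le hℓ hy
  have : (0 : ℝ) < n := by exact_mod_cast hn
  have : 0 < n * ℓ := by positivity
  rw [Metric.mem_ball]
  linarith

/-- The decay of the convolution of a Calderón–Zygmund kernel with a cancelling function supported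
on a grid cube. -/
noncomputable def cellTail (ℓ : ℝ) (m : Fin n → ℤ) : Eu n → ℝ≥0∞ :=
  (Metric.ball (cellCenter ℓ m) (8 * n)).indicator
    fun x => ENNReal.ofReal (n * ℓ / dist x (cellCenter ℓ m) ^ (n + 1))

lemma measurable_cellTail (ℓ : ℝ) (m : Fin n → ℤ) : Measurable (cellTail ℓ m) :=
  Measurable.indicator (by fun_prop) measurableSet_ball

/-- The tail of a cancelling function supported on a small cube. -/
lemma IsCZKernel.enorm_setIntegral_cell_le (hK : IsCZKernel A K) (hn : 0 < n) {ℓ : ℝ} (hℓ : 0 < ℓ)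
    (hℓ1 : ℓ ≤ 1) (m : Fin n → ℤ) {b : Eu n → ℂ} (hb : LocallyIntegrable b volume)
    (hb0 : ∫ y in cell ℓ m, b y = 0) (hbi : IntegrableOn b (cell ℓ m) volume) {x : Eu n}
    (hx : x ∉ Metric.ball (cellCenter ℓ m) (8 * n * ℓ)) :
    ‖∫ y in cell ℓ m, K (x - y) • b y‖ₑ ≤ A * (∫⁻ y in cell ℓ m, ‖b y‖ₑ) *
      cellTail ℓ m x := by
  have hn1 : (1 : ℝ) ≤ n := by exact_mod_cast hn
  unfold cellTail
  set c := cellCenter ℓ m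
  rw [Metric.mem_ball, not_lt] at hx
  have hnl : n * ℓ ≤ n := by nlinarith
  have hnl0 : 0 < n * ℓ := by positivity
  by_cases hxR : x ∈ Metric.ball c (8 * n)
  · rw [Set.indicator_of_mem hxR]
    have e : ∫ y in cell ℓ m, K (x - y) • b y = ∫ y in cell ℓ m, (K (x - y) - K (x - c)) • b y := by
      simp only [sub_smul]
      have hi : IntegrableOn (fun y => K (x - c) • b y) (cell ℓ m) volume := by
        exact hbi.smul (K (x - c))
      rw [integral_sub (hK.integrable hb x).integrableOn hi, integral_smul, hb0, smul_zero,
        sub_zero]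
    rw [e]
    calc _ ≤ ∫⁻ y in cell ℓ m, ‖(K (x - y) - K (x - c)) • b y‖ₑ :=
          enorm_integral_le_lintegral_enorm _
      _ ≤ ∫⁻ y in cell ℓ m, A * ENNReal.ofReal (n * ℓ / dist x c ^ (n + 1)) * ‖b y‖ₑ := by
          refine setLIntegral_mono' (measurableSet_cell _ _) fun y hy => ?_
          rw [enorm_smul]
          gcongr
          have h1 := dist_cellCenter_le hℓ hy
          have h2 := hK.enorm_sub_le (z := x - c) (a := c - y) (ρ := n * ℓ)
            (by rw [← dist_eq_norm, dist_comm]; linarith) hnl0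
            (by rw [← dist_eq_norm]; linarith)
          rw [sub_add_sub_cancel, ← dist_eq_norm x c] at h2
          rwa [← enorm_neg, neg_sub]
      _ = _ := by rw [lintegral_const_mul' _ _ (by finiteness)]; ring
  · rw [Metric.mem_ball, not_lt] at hxR
    -- The cube lies within `n / 2` of its centre and `x` is at distance at least `8 * n` from it,
    -- beyond the range 2 of the kernel.
    have : ∫ y in cell ℓ m, K (x - y) • b y = 0 := by
      refine setIntegral_eq_zero_of_forall_eq_zero fun y hy => ?_
      have h1 := dist_cellCenter_le hℓ hy
      have h2 := dist_triangle_left x c y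
      rw [hK.supp (x - y) (by rw [← dist_eq_norm, dist_comm]; linarith), zero_smul]
    rw [this]
    simp

/-- Let `F` and `G` be the integrals of `g` over the cube against `dx` and `dμ`. The A₁ inequality
on balls about the cube reads `μ(B) ≤ A₁ |B| G / F`, a growth bound for `μ` to which
`lintegral_compl_ball_le` applies; the factor `F` in front cancels. -/
lemma IsA1Measure.lintegral_tail_le {μ : Measure (Eu n)} {A₁ : ℝ≥0}
    (h : IsA1Measure μ A₁ (8 * n)) (hn : 0 < n) {ℓ : ℝ} (hℓ : 0 < ℓ) (hℓ1 : ℓ ≤ 1)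
    (m : Fin n → ℤ) {g : Eu n → ℝ≥0∞} (hg : AEMeasurable g volume)
    (h0 : ∫⁻ y in cell ℓ m, g y ≠ 0) (ht : ∫⁻ y in cell ℓ m, g y ≠ ∞) :
    (∫⁻ y in cell ℓ m, g y) * (∫⁻ x in (Metric.ball (cellCenter ℓ m) (8 * n * ℓ))ᶜ,
      cellTail ℓ m x ∂μ) ≤
      2 ^ (n + 1) * (A₁ * ballVol n) * ∫⁻ y in cell ℓ m, g y ∂μ := by
  have hn1 : (1 : ℝ) ≤ n := by exact_mod_cast hn
  unfold cellTail
  set c := cellCenter ℓ m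
  set F := ∫⁻ y in cell ℓ m, g y
  set G := ∫⁻ y in cell ℓ m, g y ∂μ
  have hnl : n * ℓ ≤ n := by nlinarith
  have hnl0 : 0 < n * ℓ := by positivity
  -- The tail is supported in the ball of radius `8 * n`. Restricting `μ` to it extends the growth
  -- bound to radii beyond the range of the A₁ condition.
  have hgrow : ∀ r, n * ℓ ≤ r → μ.restrict (Metric.ball c (8 * n)) (Metric.ball c r) ≤
      (A₁ * ballVol n * G / F) * ENNReal.ofReal r ^ n := by
    intro r hr
    have key : ∀ r, n * ℓ ≤ r → r ≤ 8 * n → μ (Metric.ball c r) ≤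
        (A₁ * ballVol n * G / F) * ENNReal.ofReal r ^ n := by
      intro r hr hr'
      have h1 := h.measure_ball_mul_le (by linarith) hr' (measurableSet_cell ℓ m)
        (cell_subset_ball_center hn hℓ m hr) hg
      rw [← ENNReal.le_div_iff_mul_le (Or.inl h0) (Or.inl ht)] at h1
      refine h1.trans_eq ?_
      simp only [div_eq_mul_inv]
      ring
    rcases le_total r (8 * n) with h8 | h8
    · exact (Measure.restrict_apply_le _ _).trans (key r hr h8)
    · calc _ ≤ μ (Metric.ball c (8 * n)) := by
            rw [Measure.restrict_apply measurableSet_ball]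
            exact measure_mono Set.inter_subset_right
        _ ≤ _ := key _ (by linarith) le_rfl
        _ ≤ _ := by gcongr
  have h2 := lintegral_compl_ball_le hnl0 hgrow
  calc _ = F * ∫⁻ x in (Metric.ball c (8 * n * ℓ))ᶜ, ENNReal.ofReal (n * ℓ / dist x c ^ (n + 1))
        ∂(μ.restrict (Metric.ball c (8 * n))) := by
        rw [setLIntegral_indicator measurableSet_ball, Measure.restrict_restrict
          measurableSet_ball.compl, Set.inter_comm]
    _ ≤ F * ∫⁻ x in (Metric.ball c (n * ℓ))ᶜ, ENNReal.ofReal (n * ℓ / dist x c ^ (n + 1))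
        ∂(μ.restrict (Metric.ball c (8 * n))) := by
        gcongr
        nlinarith
    _ ≤ F * (2 ^ (n + 1) * (A₁ * ballVol n * G / F)) := by gcongr
    _ = 2 ^ (n + 1) * (A₁ * ballVol n) * (G * F / F) := by simp only [div_eq_mul_inv]; ring
    _ = _ := by rw [ENNReal.mul_div_cancel_right h0 ht]

lemma IsA1Measure.measure_ball_cell_mul_le {μ : Measure (Eu n)} {A₁ : ℝ≥0}
    (h : IsA1Measure μ A₁ (8 * n)) (hn : 0 < n) {ℓ : ℝ} (hℓ : 0 < ℓ) (hℓ1 : ℓ ≤ 1)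
    (m : Fin n → ℤ) {g : Eu n → ℝ≥0∞} (hg : AEMeasurable g volume) :
    μ (Metric.ball (cellCenter ℓ m) (8 * n * ℓ)) * ∫⁻ y in cell ℓ m, g y ≤
      A₁ * ballVol n * (8 * n) ^ n * (∫⁻ y in cell ℓ m, g y ∂μ) * volume (cell ℓ m) := by
  have hn1 : (1 : ℝ) ≤ n := by exact_mod_cast hn
  have := h.measure_ball_mul_le (c := cellCenter ℓ m) (r := 8 * n * ℓ) (by positivity)
    (by nlinarith) (measurableSet_cell ℓ m) (cell_subset_ball_center hn hℓ m (by nlinarith)) hg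
  refine this.trans_eq ?_
  rw [volume_cell hℓ, ENNReal.ofReal_mul (by positivity), mul_pow,
    ENNReal.ofReal_mul (by norm_num), ENNReal.ofReal_natCast]
  simp only [ENNReal.ofReal_ofNat]
  ring

lemma integrableOn_cell {f : Eu n → ℂ} (hf : LocallyIntegrable f volume) {ℓ : ℝ} (hℓ : 0 < ℓ)
    (m : Fin n → ℤ) : IntegrableOn f (cell ℓ m) volume :=
  (hf.integrableOn_isCompact (isCompact_closedBall (cellCenter ℓ m) (n * ℓ))).mono_set
    (cell_subset_closedBall hℓ (cell_nonempty hℓ m))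

lemma volume_cell_ne_zero {ℓ : ℝ} (hℓ : 0 < ℓ) (m : Fin n → ℤ) : volume (cell ℓ m) ≠ 0 := by
  rw [volume_cell hℓ]; simp [hℓ]

lemma volume_cell_ne_top {ℓ : ℝ} (hℓ : 0 < ℓ) (m : Fin n → ℤ) : volume (cell ℓ m) ≠ ∞ := by
  rw [volume_cell hℓ]; simp

lemma enorm_setAverage_mul_le {f : Eu n → ℂ} {S : Set (Eu n)} (hS : volume S ≠ ∞) :
    ‖⨍ y in S, f y‖ₑ * volume S ≤ ∫⁻ y in S, ‖f y‖ₑ := by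
  refine le_trans (le_of_eq ?_) (enorm_integral_le_lintegral_enorm _)
  rw [← measure_smul_setAverage f hS, enorm_smul, mul_comm, Real.enorm_of_nonneg measureReal_nonneg,
    ofReal_measureReal hS]

/-- The Calderón–Zygmund decomposition of a locally integrable function at height `t`, with
stopping cubes of side at most `1`. -/
theorem exists_cz_decomposition (hn : 0 < n) {f : Eu n → ℂ} (hf : LocallyIntegrable f volume)
    {t : ℝ≥0∞} (ht : t ≠ ∞) :
    ∃ (S : Set (ℕ × (Fin n → ℤ))) (g b : Eu n → ℂ),
      S.PairwiseDisjoint (dyadic 1) ∧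
      (∀ q ∈ S, t * volume (dyadic 1 q) < ∫⁻ y in dyadic 1 q, ‖f y‖ₑ) ∧
      LocallyIntegrable g volume ∧ LocallyIntegrable b volume ∧ f = g + b ∧
      (∀ᵐ x, ‖g x‖ₑ ≤ 2 ^ n * t) ∧
      (∀ x ∉ ⋃ q ∈ S, dyadic 1 q, g x = f x) ∧
      (∀ q ∈ S, ∀ x ∈ dyadic 1 q, ‖g x‖ₑ * volume (dyadic 1 q) ≤ ∫⁻ y in dyadic 1 q, ‖f y‖ₑ) ∧
      (∀ q ∈ S, q.1 ≠ 0 → ∫ y in dyadic 1 q, b y = 0) ∧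
      (∀ q ∈ S, ∫⁻ y in dyadic 1 q, ‖b y‖ₑ ≤ 2 * ∫⁻ y in dyadic 1 q, ‖f y‖ₑ) := by
  classical
  have hpos : ∀ k : ℕ, (0 : ℝ) < 1 / 2 ^ k := fun k => by positivity
  have hfm : AEMeasurable (fun y => ‖f y‖ₑ) volume := hf.aestronglyMeasurable.enorm
  obtain ⟨S, hdisj, hlow, hup, hcov⟩ := exists_stopping_cubes
    (volume.withDensity fun y => ‖f y‖ₑ) t (s := 1) one_pos
  simp only [withDensity_apply _ (measurableSet_cell _ _)] at hlow hup hcov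
  -- On a stopping cube of side 1 the average of `f` has no upper bound, so the good function is 0
  -- there and the bad one keeps all of `f`, without cancellation.
  let a : ℕ × (Fin n → ℤ) → ℂ := fun q => if q.1 = 0 then 0 else ⨍ y in dyadic 1 q, f y
  have ha : ∀ q, ‖a q‖ₑ * volume (dyadic 1 q) ≤ ∫⁻ y in dyadic 1 q, ‖f y‖ₑ := by
    intro q
    by_cases hq : q.1 = 0
    · simp [a, hq]
    · simp only [a, hq, if_false]
      exact enorm_setAverage_mul_le (volume_cell_ne_top (hpos _) _)
  set U := ⋃ q ∈ S, dyadic 1 q with hU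
  have hUm : MeasurableSet U := .biUnion S.to_countable fun q _ => measurableSet_cell _ _
  -- the step function given by the averages
  obtain ⟨h, hhm, hh⟩ := exists_measurable_piecewise
    (fun o : Option S => o.elim Uᶜ fun q => dyadic 1 q.1)
    (by rintro (_ | q); exacts [hUm.compl, measurableSet_cell _ _])
    (fun o _ => o.elim (0 : ℂ) fun q => a q.1) (fun _ => measurable_const)
    (by
      rintro (_ | q) (_ | q') hne x ⟨hx, hx'⟩
      · rfl
      · exact absurd (Set.mem_biUnion q'.2 hx') hx
      · exact absurd (Set.mem_biUnion q.2 hx) hx'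
      · refine absurd hx' (Set.disjoint_left.1 (hdisj q.2 q'.2 fun h => hne ?_) hx)
        rw [Subtype.ext h])
  have hh0 : ∀ x ∉ U, h x = 0 := fun x hx => hh none hx
  have hhq : ∀ q ∈ S, ∀ x ∈ dyadic 1 q, h x = a q := fun q hq x hx => hh (some ⟨q, hq⟩) hx
  set g := Uᶜ.indicator f + h with hg
  have hgU : ∀ x ∉ U, g x = f x := fun x hx => by simp [hg, hx, hh0 x hx]
  have hgq : ∀ q ∈ S, ∀ x ∈ dyadic 1 q, g x = a q := fun q hq x hx => by
    have : x ∈ U := Set.mem_biUnion hq hx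
    simp [hg, this, hhq q hq x hx]
  have hgb : ∀ᵐ x, ‖g x‖ₑ ≤ 2 ^ n * t := by
    filter_upwards [ae_enorm_le_of_dyadic_averages_le hn hf (s := 1) one_pos] with x hx
    by_cases hxU : x ∈ U
    · obtain ⟨q, hq, hxq⟩ := Set.mem_iUnion₂.1 hxU
      rw [hgq q hq x hxq]
      by_cases hq0 : q.1 = 0
      · simp [a, hq0]
      · refine (ENNReal.mul_le_mul_iff_left (volume_cell_ne_zero (hpos q.1) q.2)
          (volume_cell_ne_top (hpos q.1) q.2)).1 ?_
        exact (ha q).trans ((hup q hq hq0).trans_eq (by ring))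
    · rw [hgU x hxU]
      refine (hx t fun k => ?_).trans (le_mul_of_one_le_left zero_le (one_le_pow₀ (by norm_num)))
      by_contra! hcon
      exact hxU (hcov x k hcon)
  have hgi : LocallyIntegrable g volume := by
    have hgm : AEStronglyMeasurable g volume :=
      (hf.aestronglyMeasurable.indicator hUm.compl).add hhm.aestronglyMeasurable
    have : MemLp g ∞ volume := by
      refine ⟨hgm, ?_⟩
      rw [eLpNorm_exponent_top]
      refine (essSup_le_of_ae_le _ hgb).trans_lt ?_
      exact ENNReal.mul_lt_top (by simp) ht.lt_top
    exact this.locallyIntegrable le_top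
  refine ⟨S, g, f - g, hdisj, hlow, hgi, hf.sub hgi, by simp, hgb, hgU, ?_, ?_, ?_⟩
  · intro q hq x hx
    rw [hgq q hq x hx]
    exact ha q
  · intro q hq hq0
    have hfi := integrableOn_cell hf (hpos q.1) q.2
    have e : ∫ y in dyadic 1 q, (f - g) y = ∫ y in dyadic 1 q, (f y - a q) :=
      setIntegral_congr_fun (measurableSet_cell _ _) fun y hy => by
        simp only [Pi.sub_apply, hgq q hq y hy]
    rw [e, integral_sub hfi (integrableOn_const (volume_cell_ne_top (hpos q.1) q.2)),
      setIntegral_const]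
    simp only [a, hq0, if_false]
    rw [measure_smul_setAverage f (volume_cell_ne_top (hpos q.1) q.2), sub_self]
  · intro q hq
    calc ∫⁻ y in dyadic 1 q, ‖(f - g) y‖ₑ ≤ ∫⁻ y in dyadic 1 q, (‖f y‖ₑ + ‖a q‖ₑ) := by
          refine setLIntegral_mono' (measurableSet_cell _ _) fun y hy => ?_
          rw [Pi.sub_apply, hgq q hq y hy]
          exact enorm_sub_le
      _ = (∫⁻ y in dyadic 1 q, ‖f y‖ₑ) + ‖a q‖ₑ * volume (dyadic 1 q) := by
          rw [lintegral_add_right _ measurable_const, setLIntegral_const]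
      _ ≤ _ := by rw [two_mul]; gcongr; exact ha q

end WeakType

/-! ### Weak type (1,1) with respect to an A₁ measure. -/

section WeakTypeBound

variable {n : ℕ}

set_option maxHeartbeats 1000000 in
/-- Weak type `(1,1)` for Calderón–Zygmund convolutions with respect to an `A₁` measure, given the
strong type `(2,2)`. -/
theorem conv_weak_type (hn : 0 < n) (A A₁ B : ℝ≥0) : ∃ C : ℝ≥0, ∀ μ : Measure (Eu n),
    IsA1Measure μ A₁ (8 * n) → μ ≪ volume → ∀ K : Eu n → ℝ, IsCZKernel A K →
    (∀ f : Eu n → ℂ, LocallyIntegrable f volume →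
      ∫⁻ x, ‖conv K f x‖ₑ ^ 2 ∂μ ≤ B * ∫⁻ x, ‖f x‖ₑ ^ 2 ∂μ) →
    ∀ f : Eu n → ℂ, LocallyIntegrable f volume → ∀ t : ℝ≥0∞,
      t * μ {x | t < ‖conv K f x‖ₑ} ≤ C * ∫⁻ x, ‖f x‖ₑ ∂μ := by
  set C₁ : ℝ≥0 := A₁ * ballVol n * (8 * n) ^ n with hC₁
  set C₂ : ℝ≥0 := A * 2 * (2 ^ (n + 1) * (A₁ * ballVol n)) with hC₂
  refine ⟨C₁ + 4 * B * 2 ^ n * (1 + C₁) + 2 * C₂, fun μ hμ hac K hK hL2 f hf t => ?_⟩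
  rcases eq_or_ne t 0 with rfl | ht0
  · simp
  rcases eq_or_ne t ∞ with rfl | ht
  · simp
  obtain ⟨S, g, b, hdisj, hlow, hg, hb, hfgb, hgbd, hgU, hgQ, hb0, hbQ⟩ :=
    exists_cz_decomposition hn hf ht
  have hn1 : (1 : ℝ) ≤ n := by exact_mod_cast hn
  have hpos : ∀ k : ℕ, (0 : ℝ) < 1 / 2 ^ k := fun k => by positivity
  have hle : ∀ k : ℕ, (1 : ℝ) / 2 ^ k ≤ 1 := fun k =>
    div_le_one_of_le₀ (one_le_pow₀ (by norm_num)) (by positivity)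
  have hfm : AEMeasurable (fun y => ‖f y‖ₑ) volume := hf.aestronglyMeasurable.enorm
  have hSc : S.Countable := S.to_countable
  have hv0 : ∀ q : ℕ × (Fin n → ℤ), volume (dyadic 1 q) ≠ 0 := fun q =>
    volume_cell_ne_zero (hpos _) _
  have hvt : ∀ q : ℕ × (Fin n → ℤ), volume (dyadic 1 q) ≠ ∞ := fun q =>
    volume_cell_ne_top (hpos _) _
  set U := ⋃ q ∈ S, dyadic 1 q with hU
  have hUm : MeasurableSet U := .biUnion hSc fun q _ => measurableSet_cell _ _
  let Bq : ℕ × (Fin n → ℤ) → Set (Eu n) := fun q =>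
    Metric.ball (cellCenter (1 / 2 ^ q.1) q.2) (8 * n * (1 / 2 ^ q.1))
  set E := ⋃ q ∈ S, Bq q with hE
  have hEm : MeasurableSet E := .biUnion hSc fun q _ => measurableSet_ball
  set I := ∫⁻ x, ‖f x‖ₑ ∂μ with hI
  -- the sum of the integrals over the cubes
  have hsumU : ∑' q : S, ∫⁻ y in dyadic 1 q.1, ‖f y‖ₑ ∂μ = ∫⁻ y in U, ‖f y‖ₑ ∂μ :=
    (lintegral_biUnion hSc (fun q _ => measurableSet_cell _ _) hdisj _).symm
  have hsum : ∑' q : S, ∫⁻ y in dyadic 1 q.1, ‖f y‖ₑ ∂μ ≤ I :=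
    hsumU.le.trans (setLIntegral_le_lintegral _ _)
  have hball : ∀ q, μ (Bq q) * ∫⁻ y in dyadic 1 q, ‖f y‖ₑ ≤
      C₁ * (∫⁻ y in dyadic 1 q, ‖f y‖ₑ ∂μ) * volume (dyadic 1 q) := by
    intro q
    have := hμ.measure_ball_cell_mul_le hn (hpos q.1) (hle q.1) q.2 hfm
    refine this.trans_eq ?_
    rw [hC₁]
    push_cast
    rfl
  -- the exceptional set
  have hEbd : t * μ E ≤ C₁ * I := by
    calc t * μ E ≤ t * ∑' q : S, μ (Bq q.1) := by gcongr; exact measure_biUnion_le μ hSc _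
      _ = ∑' q : S, t * μ (Bq q.1) := ENNReal.tsum_mul_left.symm
      _ ≤ ∑' q : S, C₁ * ∫⁻ y in dyadic 1 q.1, ‖f y‖ₑ ∂μ := by
        refine ENNReal.tsum_le_tsum fun q => ?_
        refine (ENNReal.mul_le_mul_iff_left (hv0 q.1) (hvt q.1)).1 ?_
        calc t * μ (Bq q.1) * volume (dyadic 1 q.1)
            = μ (Bq q.1) * (t * volume (dyadic 1 q.1)) := by ring
          _ ≤ μ (Bq q.1) * ∫⁻ y in dyadic 1 q.1, ‖f y‖ₑ := by gcongr; exact (hlow q.1 q.2).le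
          _ ≤ _ := hball q.1
      _ ≤ C₁ * I := by rw [ENNReal.tsum_mul_left]; gcongr
  -- the good part
  have hg1 : ∫⁻ x, ‖g x‖ₑ ∂μ ≤ (1 + C₁) * I := by
    rw [← lintegral_add_compl _ hUm]
    have h1 : ∫⁻ x in Uᶜ, ‖g x‖ₑ ∂μ ≤ I := by
      rw [setLIntegral_congr_fun hUm.compl (g := fun x => ‖f x‖ₑ)
        fun x hx => by simp only [hgU x hx]]
      exact setLIntegral_le_lintegral _ _
    have h2 : ∫⁻ x in U, ‖g x‖ₑ ∂μ ≤ C₁ * I := by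
      rw [hU, lintegral_biUnion hSc (fun q _ => measurableSet_cell _ _) hdisj]
      calc _ ≤ ∑' q : S, C₁ * ∫⁻ y in dyadic 1 q.1, ‖f y‖ₑ ∂μ := by
            refine ENNReal.tsum_le_tsum fun q => ?_
            refine (ENNReal.mul_le_mul_iff_left (hv0 q.1) (hvt q.1)).1 ?_
            calc (∫⁻ x in dyadic 1 q.1, ‖g x‖ₑ ∂μ) * volume (dyadic 1 q.1)
                = ∫⁻ x in dyadic 1 q.1, ‖g x‖ₑ * volume (dyadic 1 q.1) ∂μ :=
                  (lintegral_mul_const' _ _ (hvt q.1)).symm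
              _ ≤ ∫⁻ x in dyadic 1 q.1, (∫⁻ y in dyadic 1 q.1, ‖f y‖ₑ) ∂μ :=
                  setLIntegral_mono' (measurableSet_cell _ _) fun x hx => hgQ q.1 q.2 x hx
              _ = μ (dyadic 1 q.1) * ∫⁻ y in dyadic 1 q.1, ‖f y‖ₑ := by
                  rw [setLIntegral_const, mul_comm]
              _ ≤ μ (Bq q.1) * ∫⁻ y in dyadic 1 q.1, ‖f y‖ₑ := by
                  gcongr
                  refine cell_subset_ball_center hn (hpos _) _ ?_
                  have := hpos q.1.1
                  nlinarith
              _ ≤ _ := hball q.1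
        _ ≤ C₁ * I := by rw [ENNReal.tsum_mul_left]; gcongr
    calc _ ≤ C₁ * I + I := add_le_add h2 h1
      _ = _ := by ring
  have hgood : t * μ {x | t / 2 ≤ ‖conv K g x‖ₑ} ≤ 4 * B * 2 ^ n * (1 + C₁) * I := by
    have hm : AEMeasurable (fun x => ‖conv K g x‖ₑ ^ 2) μ :=
      ((hK.continuous_conv hg).measurable.enorm.pow_const 2).aemeasurable
    have h1 := mul_meas_ge_le_lintegral₀ hm ((t / 2) ^ 2)
    have h2 : ∫⁻ x, ‖g x‖ₑ ^ 2 ∂μ ≤ 2 ^ n * t * ((1 + C₁) * I) := by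
      calc _ ≤ ∫⁻ x, 2 ^ n * t * ‖g x‖ₑ ∂μ := by
            refine lintegral_mono_ae (Filter.Eventually.mono (hac.ae_le hgbd) fun x hx => ?_)
            rw [sq]
            exact mul_le_mul_left hx _
        _ = 2 ^ n * t * ∫⁻ x, ‖g x‖ₑ ∂μ := lintegral_const_mul' _ _ (by finiteness)
        _ ≤ _ := by gcongr
    -- Chebyshev in `L²` produces `t ^ 2` on the left, and the sup bound on `g` produces one `t` on
    -- the right; the common factor cancels.
    refine (ENNReal.mul_le_mul_iff_right ht0 ht).1 ?_
    calc t * (t * μ {x | t / 2 ≤ ‖conv K g x‖ₑ})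
        ≤ t * (t * μ {x | (t / 2) ^ 2 ≤ ‖conv K g x‖ₑ ^ 2}) := by
          refine mul_le_mul_right (mul_le_mul_right (measure_mono fun x hx => ?_) _) _
          exact pow_le_pow_left₀ zero_le (show t / 2 ≤ _ from hx) 2
      _ = 4 * ((t / 2) ^ 2 * μ {x | (t / 2) ^ 2 ≤ ‖conv K g x‖ₑ ^ 2}) := by
          have : (4 : ℝ≥0∞) * (t / 2) ^ 2 = t * t := by
            rw [show (4 : ℝ≥0∞) = 2 ^ 2 by norm_num, ← mul_pow,
              ENNReal.mul_div_cancel (by norm_num) (by norm_num), sq]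
          rw [← mul_assoc, ← mul_assoc, this]
      _ ≤ 4 * (B * (2 ^ n * t * ((1 + C₁) * I))) := by
          exact mul_le_mul_right (h1.trans ((hL2 g hg).trans (mul_le_mul_right h2 _))) _
      _ = _ := by ring
  -- the bad part
  have hbad : t * μ (Eᶜ ∩ {x | t / 2 ≤ ‖conv K b x‖ₑ}) ≤ 2 * C₂ * I := by
    obtain ⟨F, hF⟩ : ∃ F : ℕ × (Fin n → ℤ) → ℝ≥0∞, ∀ q, F q = ∫⁻ y in dyadic 1 q, ‖f y‖ₑ :=
      ⟨_, fun _ => rfl⟩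
    have hFt : ∀ q, F q ≠ ∞ := fun q => hF q ▸ (integrableOn_cell hf (hpos q.1) q.2).2.ne
    have hbU : ∀ y ∉ U, b y = 0 := by
      intro y hy
      have h1 := congrFun hfgb y
      rw [Pi.add_apply, hgU y hy] at h1
      simpa using h1
    have hpt : ∀ x ∉ E, ‖conv K b x‖ₑ ≤ ∑' q : S, A * (2 * F q.1) * cellTail (1 / 2 ^ q.1.1) q.1.2 x := by
      intro x hx
      have e : conv K b x = ∑' q : S, ∫ y in dyadic 1 q.1, K (x - y) • b y := by
        rw [conv, ← setIntegral_eq_integral_of_forall_compl_eq_zero (s := U)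
          (fun y hy => by rw [hbU y hy, smul_zero]), hU, Set.biUnion_eq_iUnion,
          integral_iUnion (s := fun q : S => dyadic 1 q.1) (fun q => measurableSet_cell _ _)
            (fun q q' h => hdisj q.2 q'.2 fun h' => h (Subtype.ext h'))
            (hK.integrable hb x).integrableOn]
      rw [e]
      refine enorm_tsum_le_tsum_enorm.trans (ENNReal.tsum_le_tsum fun q => ?_)
      have hxq : x ∉ Bq q.1 := fun h => hx (Set.mem_biUnion q.2 h)
      -- Cubes of side 1 have no cancellation, but `x` lies outside the ball of radius `8 * n` about
      -- such a cube, where the kernel does not reach it.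
      by_cases hq0 : q.1.1 = 0
      · have : ∫ y in dyadic 1 q.1, K (x - y) • b y = 0 := by
          refine setIntegral_eq_zero_of_forall_eq_zero fun y hy => ?_
          have h1 := dist_cellCenter_le (hpos _) hy
          simp only [Bq, Metric.mem_ball, not_lt] at hxq
          have h2 := dist_triangle_left x (cellCenter (1 / 2 ^ q.1.1) q.1.2) y
          rw [hq0] at h1 h2 hxq
          rw [hK.supp (x - y) (by rw [← dist_eq_norm, dist_comm]; linarith), zero_smul]
        rw [this, enorm_zero]
        exact zero_le
      · refine (hK.enorm_setIntegral_cell_le hn (hpos q.1.1) (hle q.1.1) q.1.2 hb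
          (hb0 q.1 q.2 hq0) (integrableOn_cell hb (hpos _) _) hxq).trans ?_
        exact mul_le_mul_left (mul_le_mul_right ((hbQ q.1 q.2).trans_eq (by rw [hF])) _) _
    have hint : ∫⁻ x in Eᶜ, ‖conv K b x‖ₑ ∂μ ≤ C₂ * I := by
      calc _ ≤ ∫⁻ x in Eᶜ, ∑' q : S, A * (2 * F q.1) * cellTail (1 / 2 ^ q.1.1) q.1.2 x ∂μ :=
            setLIntegral_mono' hEm.compl hpt
        _ = ∑' q : S, A * 2 * (F q.1 * ∫⁻ x in Eᶜ, cellTail (1 / 2 ^ q.1.1) q.1.2 x ∂μ) := by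
            rw [lintegral_tsum fun q => ((measurable_cellTail _ _).const_mul _).aemeasurable]
            refine tsum_congr fun q => ?_
            rw [lintegral_const_mul _ (measurable_cellTail _ _)]
            ring
        _ ≤ ∑' q : S, A * 2 * (2 ^ (n + 1) * (A₁ * ballVol n) *
              ∫⁻ y in dyadic 1 q.1, ‖f y‖ₑ ∂μ) := by
            refine ENNReal.tsum_le_tsum fun q => mul_le_mul_right ?_ _
            have hq0 : F q.1 ≠ 0 := by rw [hF]; exact (zero_le.trans_lt (hlow q.1 q.2)).ne'
            have hqt := hFt q.1
            rw [hF] at hq0 hqt ⊢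
            refine le_trans (mul_le_mul_right ?_ _) (hμ.lintegral_tail_le hn (hpos q.1.1)
              (hle q.1.1) q.1.2 hfm hq0 hqt)
            exact lintegral_mono_set (Set.compl_subset_compl.2 fun x hx => Set.mem_biUnion q.2 hx)
        _ ≤ C₂ * I := by
            rw [ENNReal.tsum_mul_left, ENNReal.tsum_mul_left, ← mul_assoc, hC₂]
            push_cast
            gcongr
    have hm : AEMeasurable (fun x => ‖conv K b x‖ₑ) (μ.restrict Eᶜ) :=
      (hK.continuous_conv hb).measurable.enorm.aemeasurable
    have h1 := mul_meas_ge_le_lintegral₀ hm (t / 2)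
    rw [Measure.restrict_apply (measurableSet_le measurable_const
      (hK.continuous_conv hb).measurable.enorm), Set.inter_comm] at h1
    calc t * μ (Eᶜ ∩ {x | t / 2 ≤ ‖conv K b x‖ₑ})
        = 2 * (t / 2 * μ (Eᶜ ∩ {x | t / 2 ≤ ‖conv K b x‖ₑ})) := by
          rw [← mul_assoc, ENNReal.mul_div_cancel (by norm_num) (by norm_num)]
      _ ≤ 2 * (C₂ * I) := mul_le_mul_right (h1.trans hint) _
      _ = _ := by ring
  have hcover : {x | t < ‖conv K f x‖ₑ} ⊆
      E ∪ {x | t / 2 ≤ ‖conv K g x‖ₑ} ∪ (Eᶜ ∩ {x | t / 2 ≤ ‖conv K b x‖ₑ}) := by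
    intro x hx
    by_contra hcon
    simp only [Set.mem_union, Set.mem_inter_iff, Set.mem_ofPred_eq, Set.mem_compl_iff, not_or,
      not_and, not_le] at hcon
    obtain ⟨⟨h1, h2⟩, h3⟩ := hcon
    have h4 := h3 h1
    have h5 : ‖conv K f x‖ₑ < t / 2 + t / 2 := by
      rw [hfgb, hK.conv_add hg hb]
      exact (enorm_add_le _ _).trans_lt (ENNReal.add_lt_add h2 h4)
    rw [ENNReal.add_halves] at h5
    exact lt_asymm hx h5
  calc t * μ {x | t < ‖conv K f x‖ₑ}
      ≤ t * (μ E + μ {x | t / 2 ≤ ‖conv K g x‖ₑ} + μ (Eᶜ ∩ {x | t / 2 ≤ ‖conv K b x‖ₑ})) := by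
        gcongr
        exact (measure_mono hcover).trans ((measure_union_le _ _).trans
          (add_le_add_left (measure_union_le _ _) _))
    _ = t * μ E + t * μ {x | t / 2 ≤ ‖conv K g x‖ₑ} +
          t * μ (Eᶜ ∩ {x | t / 2 ≤ ‖conv K b x‖ₑ}) := by ring
    _ ≤ C₁ * I + 4 * B * 2 ^ n * (1 + C₁) * I + 2 * C₂ * I :=
        add_le_add (add_le_add hEbd hgood) hbad
    _ = _ := by push_cast; ring

end WeakTypeBound

/-! ### Plancherel bounds and the smooth truncations of the Riesz kernel. -/

section LTwo

variable {n : ℕ} {A : ℝ≥0} {K : Eu n → ℝ}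

open scoped FourierTransform SchwartzMap ContDiff

lemma lintegral_enorm_sq_eq {μ : Measure (Eu n)} (f : Eu n → ℂ) :
    ∫⁻ x, ‖f x‖ₑ ^ 2 ∂μ = eLpNorm f 2 μ ^ 2 := by
  have := eLpNorm_nnreal_pow_eq_lintegral (f := f) (μ := μ) (p := 2) (by norm_num)
  simpa using this.symm

/-- Plancherel's theorem for convolutions with Schwartz functions. -/
lemma eLpNorm_conv_schwartz_le (hKc : HasCompactSupport K) (hKs : ContDiff ℝ ∞ K) {M : ℝ≥0}
    (hM : ∀ ξ, ‖𝓕 (fun z => (K z : ℂ)) ξ‖ ≤ M) (g : 𝓢(Eu n, ℂ)) :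
    eLpNorm (conv K g) 2 volume ≤ M * eLpNorm g 2 volume := by
  have hs : ContDiff ℝ ∞ fun z => (K z : ℂ) := Complex.ofRealCLM.contDiff.comp hKs
  have hc : HasCompactSupport fun z => (K z : ℂ) :=
    hKc.comp_left (g := fun r : ℝ => (r : ℂ)) Complex.ofReal_zero
  let κ : 𝓢(Eu n, ℂ) := hc.toSchwartzMap hs
  let h : 𝓢(Eu n, ℂ) := SchwartzMap.convolution (ContinuousLinearMap.mul ℂ ℂ) g κ
  have hh : conv K g = h := by
    funext x
    rw [SchwartzMap.convolution_apply]
    refine integral_congr_ae (Eventually.of_forall fun y => ?_)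
    simp [κ, mul_comm]
  have hF : ∀ ξ, ‖𝓕 h ξ‖ ≤ M * ‖𝓕 g ξ‖ := by
    intro ξ
    have : 𝓕 h ξ = 𝓕 g ξ * 𝓕 κ ξ := by
      rw [SchwartzMap.fourier_convolution_apply,
        Real.fourier_mul_convolution_eq g.integrable κ.integrable]
      rfl
    rw [this, norm_mul, mul_comm]
    exact mul_le_mul_of_nonneg_right (hM ξ) (norm_nonneg _)
  have hint : ∀ u : 𝓢(Eu n, ℂ), ENNReal.ofReal (∫ x, ‖u x‖ ^ 2) = eLpNorm u 2 volume ^ 2 := by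
    intro u
    rw [← lintegral_enorm_sq_eq, ofReal_integral_eq_lintegral_ofReal
      ((u.memLp 2 volume).integrable_norm_pow (by norm_num)) (Eventually.of_forall fun x => by positivity)]
    exact lintegral_congr fun x => by rw [ENNReal.ofReal_pow (norm_nonneg _), ofReal_norm]
  rw [hh, ← ENNReal.pow_le_pow_left_iff (n := 2) two_ne_zero, mul_pow, ← hint, ← hint,
    ← SchwartzMap.integral_norm_sq_fourier, ← SchwartzMap.integral_norm_sq_fourier g,
    ← ENNReal.ofReal_coe_nnreal, ← ENNReal.ofReal_pow (p := (M : ℝ)) M.2,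
    ← ENNReal.ofReal_mul (by positivity)]
  refine ENNReal.ofReal_le_ofReal ?_
  rw [← integral_const_mul]
  refine integral_mono (((𝓕 h).memLp 2 volume).integrable_norm_pow (by norm_num))
    ((((𝓕 g).memLp 2 volume).integrable_norm_pow (by norm_num)).const_mul _) fun ξ => ?_
  have := pow_le_pow_left₀ (norm_nonneg _) (hF ξ) 2
  rwa [mul_pow] at this

/-- The `L²` bound for convolution with a smooth kernel with bounded Fourier transform. -/
theorem IsCZKernel.lintegral_conv_sq_le (hK : IsCZKernel A K) (hKs : ContDiff ℝ ∞ K) {M : ℝ≥0}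
    (hM0 : 0 < M) (hM : ∀ ξ, ‖𝓕 (fun z => (K z : ℂ)) ξ‖ ≤ M) {f : Eu n → ℂ}
    (hf : LocallyIntegrable f volume) :
    ∫⁻ x, ‖conv K f x‖ₑ ^ 2 ≤ (M ^ 2 : ℝ≥0) * ∫⁻ x, ‖f x‖ₑ ^ 2 := by
  rw [lintegral_enorm_sq_eq, lintegral_enorm_sq_eq, ENNReal.coe_pow, ← mul_pow]
  refine pow_le_pow_left₀ zero_le ?_ 2
  -- `0 < M` serves the case of infinite norm, as `0 * ∞ = 0`.
  rcases eq_or_ne (eLpNorm f 2 volume) ∞ with htop | htop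
  · rw [htop, ENNReal.mul_top (by exact_mod_cast hM0.ne')]
    exact le_top
  have hfL : MemLp f 2 volume := ⟨hf.aestronglyMeasurable, htop.lt_top⟩
  have happ : ∀ k : ℕ, ∃ g : 𝓢(Eu n, ℂ), eLpNorm (f - ⇑g) 2 volume ≤
      ENNReal.ofReal (1 / ((k : ℝ) + 1)) := by
    intro k
    obtain ⟨g, h1, h2, h3⟩ := hfL.exist_eLpNorm_sub_le (by norm_num) (by norm_num)
      (Nat.one_div_pos_of_nat (n := k))
    exact ⟨h1.toSchwartzMap h2, h3⟩
  choose g hg using happ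
  have hε : Tendsto (fun k : ℕ => ENNReal.ofReal (1 / ((k : ℝ) + 1))) atTop (𝓝 0) := by
    have := (ENNReal.continuous_ofReal.tendsto 0).comp
      (tendsto_one_div_add_atTop_nhds_zero_nat (𝕜 := ℝ))
    rwa [ENNReal.ofReal_zero] at this
  have hgl : ∀ k, LocallyIntegrable (g k) volume := fun k => (g k).continuous.locallyIntegrable
  -- Since `K` is in `L²`, Cauchy–Schwarz turns `L²` approximation of `f` into convergence of the
  -- convolutions at every point, and Fatou's lemma transfers the bound.
  have hKL : MemLp K 2 volume := hK.cont.memLp_of_hasCompactSupport hK.hasCompactSupport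
  have hpt : ∀ x, Tendsto (fun k => conv K (g k) x) atTop (𝓝 (conv K f x)) := by
    intro x
    rw [tendsto_iff_edist_tendsto_0]
    have hb : ∀ k, edist (conv K (g k) x) (conv K f x) ≤
        eLpNorm K 2 volume * ENNReal.ofReal (1 / ((k : ℝ) + 1)) := by
      intro k
      rw [edist_comm, edist_eq_enorm_sub, ← hK.conv_sub hf (hgl k)]
      have h1 : eLpNorm (fun y => K (x - y)) 2 volume = eLpNorm K 2 volume :=
        eLpNorm_comp_measurePreserving hKL.1 (volume.measurePreserving_sub_left x)
      have h2 : AEStronglyMeasurable (fun y => K (x - y)) volume :=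
        (hK.cont.comp (by fun_prop)).aestronglyMeasurable
      have h3 := eLpNorm_smul_le_mul_eLpNorm (p := 2) (q := 2) (r := 1)
        (hf.sub (hgl k)).aestronglyMeasurable h2
      rw [h1] at h3
      calc ‖conv K (f - ⇑(g k)) x‖ₑ ≤ ∫⁻ y, ‖K (x - y) • (f - ⇑(g k)) y‖ₑ :=
            enorm_integral_le_lintegral_enorm _
        _ = eLpNorm ((fun y => K (x - y)) • (f - ⇑(g k))) 1 volume := by
            rw [eLpNorm_one_eq_lintegral_enorm]; rfl
        _ ≤ eLpNorm K 2 volume * eLpNorm (f - ⇑(g k)) 2 volume := h3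
        _ ≤ _ := by gcongr; exact hg k
    refine tendsto_of_tendsto_of_tendsto_of_le_of_le tendsto_const_nhds ?_ (fun _ => zero_le) hb
    simpa using ENNReal.Tendsto.const_mul hε (Or.inr hKL.2.ne)
  have hgn : ∀ k, eLpNorm (conv K (g k)) 2 volume ≤
      M * (eLpNorm f 2 volume + ENNReal.ofReal (1 / ((k : ℝ) + 1))) := by
    intro k
    refine (eLpNorm_conv_schwartz_le hK.hasCompactSupport hKs hM (g k)).trans ?_
    gcongr
    have e : (g k : Eu n → ℂ) = f - (f - ⇑(g k)) := by simp
    calc eLpNorm (g k) 2 volume = eLpNorm (f - (f - ⇑(g k))) 2 volume := by rw [← e]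
      _ ≤ eLpNorm f 2 volume + eLpNorm (f - ⇑(g k)) 2 volume :=
        eLpNorm_sub_le hf.aestronglyMeasurable (hf.sub (hgl k)).aestronglyMeasurable (by norm_num)
      _ ≤ _ := by gcongr; exact hg k
  have hlim : Tendsto (fun k : ℕ => M * (eLpNorm f 2 volume + ENNReal.ofReal (1 / ((k : ℝ) + 1))))
      atTop (𝓝 (M * eLpNorm f 2 volume)) := by
    have := ENNReal.Tendsto.const_mul (hε.const_add (eLpNorm f 2 volume))
      (Or.inr (ENNReal.coe_ne_top (r := M)))
    simpa using this
  calc eLpNorm (conv K f) 2 volume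
      ≤ liminf (fun k => eLpNorm (conv K (g k)) 2 volume) atTop :=
        Lp.eLpNorm_lim_le_liminf_eLpNorm
          (fun k => (hK.continuous_conv (hgl k)).aestronglyMeasurable) _ (Eventually.of_forall hpt)
    _ ≤ liminf (fun k : ℕ => M * (eLpNorm f 2 volume + ENNReal.ofReal (1 / ((k : ℝ) + 1)))) atTop :=
        liminf_le_liminf (Eventually.of_forall hgn)
    _ = _ := hlim.liminf_eq

/-! ### The truncated Riesz kernels -/

/-- The smoothly truncated Riesz kernel, vanishing for `‖z‖ < 2 ^ (-N)`. -/
noncomputable def rieszTrunc (Φ : Eu n → ℝ) (j : Fin n) (N : ℕ) (z : Eu n) : ℝ :=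
  z j / ‖z‖ ^ (n + 1) * (Φ z - Φ ((2 : ℝ) ^ N • z))

variable {Φ : Eu n → ℝ} {j : Fin n}

lemma IsRadialCutoff.eq_zero (hΦ : IsRadialCutoff Φ) {z : Eu n} (hz : 2 < ‖z‖) : Φ z = 0 := by
  by_contra h
  have := hΦ.supp (subset_tsupport Φ h)
  rw [mem_closedBall_zero_iff] at this
  linarith

lemma IsRadialCutoff.eq_one_of_norm_lt (hΦ : IsRadialCutoff Φ) {z : Eu n} (hz : ‖z‖ < 1) : Φ z = 1 :=
  hΦ.eq_one z (by simpa using hz)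

lemma IsRadialCutoff.hasCompactSupport (hΦ : IsRadialCutoff Φ) : HasCompactSupport Φ :=
  HasCompactSupport.intro (isCompact_closedBall 0 2) fun z hz => hΦ.eq_zero (by simpa using hz)

lemma IsRadialCutoff.exists_bound (hΦ : IsRadialCutoff Φ) : ∃ S : ℝ≥0, ∀ z, Φ z ≤ S := by
  obtain ⟨B, hB⟩ := hΦ.hasCompactSupport.exists_bound_of_continuous hΦ.smooth.continuous
  exact ⟨B.toNNReal, fun z => (le_abs_self _).trans ((hB z).trans (Real.le_coe_toNNReal B))⟩

lemma norm_two_pow_smul (N : ℕ) (z : Eu n) : ‖(2 : ℝ) ^ N • z‖ = 2 ^ N * ‖z‖ := by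
  rw [norm_smul, norm_pow, Real.norm_ofNat]

lemma rieszTrunc_eq_zero_of_lt (hΦ : IsRadialCutoff Φ) (N : ℕ) {z : Eu n}
    (hz : 2 ^ N * ‖z‖ < 1) : rieszTrunc Φ j N z = 0 := by
  have h1 : (1 : ℝ) ≤ 2 ^ N := one_le_pow₀ (by norm_num)
  have h2 : ‖z‖ < 1 := by nlinarith [norm_nonneg z]
  rw [rieszTrunc, hΦ.eq_one_of_norm_lt h2, hΦ.eq_one_of_norm_lt (by rwa [norm_two_pow_smul]),
    sub_self, mul_zero]

lemma rieszTrunc_eq_zero (hΦ : IsRadialCutoff Φ) (N : ℕ) {z : Eu n} (hz : 2 < ‖z‖) :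
    rieszTrunc Φ j N z = 0 := by
  have h1 : (1 : ℝ) ≤ 2 ^ N := one_le_pow₀ (by norm_num)
  rw [rieszTrunc, hΦ.eq_zero hz, hΦ.eq_zero (by rw [norm_two_pow_smul]; nlinarith), sub_self,
    mul_zero]

lemma rieszTrunc_eq_rieszKernel (hΦ : IsRadialCutoff Φ) (N : ℕ) {z : Eu n}
    (hz : 2 < 2 ^ N * ‖z‖) : rieszTrunc Φ j N z = rieszKernel Φ j z := by
  rw [rieszTrunc, hΦ.eq_zero (z := (2 : ℝ) ^ N • z) (by rwa [norm_two_pow_smul]), sub_zero, rieszKernel]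

lemma rieszTrunc_neg (hΦ : IsRadialCutoff Φ) (N : ℕ) (z : Eu n) :
    rieszTrunc Φ j N (-z) = -rieszTrunc Φ j N z := by
  simp only [rieszTrunc, norm_neg, PiLp.neg_apply, smul_neg]
  rw [hΦ.radial (-z) z (norm_neg z), hΦ.radial (-(_ • z)) _ (norm_neg _)]
  ring

/-- Since `z j / ‖z‖ ^ (n + 1)` is homogeneous of degree `-n`, the difference of cutoffs telescopes
into `L¹`-normalised dilates of one smooth function. Regularity and the Fourier bound are both read
off from this sum. -/
lemma rieszTrunc_eq_sum (N : ℕ) (z : Eu n) : rieszTrunc Φ j N z =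
    ∑ i ∈ Finset.range N, ((2 : ℝ) ^ i) ^ n * rieszTrunc Φ j 1 ((2 : ℝ) ^ i • z) := by
  have hterm : ∀ i : ℕ, ((2 : ℝ) ^ i) ^ n * rieszTrunc Φ j 1 ((2 : ℝ) ^ i • z) =
      z j / ‖z‖ ^ (n + 1) * (Φ ((2 : ℝ) ^ i • z) - Φ ((2 : ℝ) ^ (i + 1) • z)) := by
    intro i
    rw [rieszTrunc, norm_two_pow_smul, smul_smul, ← pow_add, add_comm 1 i, PiLp.smul_apply,
      smul_eq_mul]
    rcases eq_or_ne z 0 with rfl | hz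
    · simp
    have : ‖z‖ ≠ 0 := norm_ne_zero_iff.2 hz
    rw [mul_pow, ← mul_assoc]
    congr 1
    field_simp
    ring
  rw [Finset.sum_congr rfl fun i _ => hterm i, ← Finset.mul_sum, Finset.sum_range_sub']
  simp [rieszTrunc]

lemma abs_rieszTrunc_mul_le {S : ℝ≥0} (hΦ : IsRadialCutoff Φ) (hS : ∀ z, Φ z ≤ S) (N : ℕ)
    (z : Eu n) : |rieszTrunc Φ j N z| * ‖z‖ ^ n ≤ S := by
  rcases eq_or_ne z 0 with rfl | hz
  · simp [rieszTrunc]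
  have hz0 : 0 < ‖z‖ := norm_pos_iff.2 hz
  have h1 : |z j| ≤ ‖z‖ := PiLp.norm_apply_le z j
  have h2 : |Φ z - Φ ((2 : ℝ) ^ N • z)| ≤ S := by
    rw [abs_le]
    constructor <;> linarith [hΦ.nonneg z, hS z, hΦ.nonneg ((2 : ℝ) ^ N • z), hS ((2 : ℝ) ^ N • z)]
  rw [rieszTrunc, abs_mul, abs_div, abs_of_nonneg (pow_nonneg hz0.le (n + 1))]
  calc _ = |z j| / ‖z‖ * |Φ z - Φ ((2 : ℝ) ^ N • z)| := by rw [pow_succ]; field_simp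
    _ ≤ 1 * S := by
      gcongr
      exact div_le_one_of_le₀ h1 hz0.le
    _ = S := one_mul _

lemma abs_rieszKernel_mul_le {S : ℝ≥0} (hΦ : IsRadialCutoff Φ) (hS : ∀ z, Φ z ≤ S)
    (z : Eu n) : |rieszKernel Φ j z| * ‖z‖ ^ n ≤ S := by
  rcases eq_or_ne z 0 with rfl | hz
  · simp [rieszKernel]
  have hz0 : 0 < ‖z‖ := norm_pos_iff.2 hz
  have h1 : |z j| ≤ ‖z‖ := PiLp.norm_apply_le z j
  rw [rieszKernel, abs_mul, abs_div, abs_of_nonneg (pow_nonneg hz0.le (n + 1)),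
    abs_of_nonneg (hΦ.nonneg z)]
  calc _ = |z j| / ‖z‖ * Φ z := by rw [pow_succ]; field_simp
    _ ≤ 1 * S := by
      gcongr
      · exact hΦ.nonneg z
      · exact div_le_one_of_le₀ h1 hz0.le
      · exact hS z
    _ = S := one_mul _

/-- The kernel vanishes near the origin, the only point where the norm is not smooth. -/
lemma contDiff_rieszTrunc_one (hΦ : IsRadialCutoff Φ) : ContDiff ℝ ∞ (rieszTrunc Φ j 1) := by
  rw [contDiff_iff_contDiffAt]
  intro z
  rcases eq_or_ne z 0 with rfl | hz
  · refine (contDiffAt_const (c := (0 : ℝ))).congr_of_eventuallyEq ?_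
    filter_upwards [Metric.ball_mem_nhds (0 : Eu n) (by norm_num : (0 : ℝ) < 1 / 2)] with z hz
    rw [mem_ball_zero_iff] at hz
    exact rieszTrunc_eq_zero_of_lt hΦ 1 (by linarith)
  · have hn : ContDiffAt ℝ ∞ (fun z : Eu n => ‖z‖) z := contDiffAt_norm ℝ hz
    have hj : ContDiffAt ℝ ∞ (fun z : Eu n => z j) z :=
      (EuclideanSpace.proj (𝕜 := ℝ) j).contDiff.contDiffAt
    have h2 : ContDiff ℝ ∞ fun z : Eu n => Φ ((2 : ℝ) ^ 1 • z) :=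
      hΦ.smooth.comp (contDiff_const_smul _)
    exact (hj.div (hn.pow _) (pow_ne_zero _ (norm_ne_zero_iff.2 hz))).mul
      (hΦ.smooth.contDiffAt.sub h2.contDiffAt)

lemma contDiff_rieszTrunc (hΦ : IsRadialCutoff Φ) (N : ℕ) : ContDiff ℝ ∞ (rieszTrunc Φ j N) := by
  have : rieszTrunc Φ j N = fun z =>
      ∑ i ∈ Finset.range N, ((2 : ℝ) ^ i) ^ n * rieszTrunc Φ j 1 ((2 : ℝ) ^ i • z) :=
    funext fun z => rieszTrunc_eq_sum N z
  rw [this]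
  exact ContDiff.sum fun i _ => contDiff_const.mul
    ((contDiff_rieszTrunc_one hΦ).comp (contDiff_const_smul _))

lemma sum_two_pow_pow_le {m : ℕ} (hm : m ≠ 0) {a : ℝ} (ha : 0 < a) (N : ℕ) :
    ∑ i ∈ Finset.range N, (if (2 : ℝ) ^ i ≤ a then ((2 : ℝ) ^ i) ^ m else 0) ≤ 2 * a ^ m := by
  have h1 : ∀ N : ℕ, ∑ i ∈ Finset.range N, ((2 : ℝ) ^ i) ^ m ≤ ((2 : ℝ) ^ N) ^ m := by
    intro N
    induction N with
    | zero => simp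
    | succ N ih =>
      rw [Finset.sum_range_succ, pow_succ 2 N, mul_pow]
      have : (2 : ℝ) ≤ 2 ^ m := le_self_pow₀ (by norm_num) hm
      nlinarith [pow_pos (pow_pos (two_pos (α := ℝ)) N) m]
  induction N with
  | zero => simp; positivity
  | succ N ih =>
    rw [Finset.sum_range_succ]
    split_ifs with h
    · calc _ ≤ ((2 : ℝ) ^ N) ^ m + ((2 : ℝ) ^ N) ^ m := by
            gcongr
            refine le_trans (Finset.sum_le_sum fun i _ => ?_) (h1 N)
            split_ifs
            · exact le_rfl
            · positivity
        _ = 2 * ((2 : ℝ) ^ N) ^ m := by ring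
        _ ≤ _ := by gcongr
    · simpa using ih

/-- The extra summand is the whole tail of the geometric series from `N` on, `2 * 2 ^ (-N)`.
Carrying it along lets the induction close. -/
lemma sum_two_pow_inv_le {a : ℝ} (ha : 0 < a) (N : ℕ) :
    ∑ i ∈ Finset.range N, (if a < (2 : ℝ) ^ i then ((2 : ℝ) ^ i)⁻¹ else 0) +
      (if a < (2 : ℝ) ^ N then 2 * ((2 : ℝ) ^ N)⁻¹ else 0) ≤ 2 / a := by
  induction N with
  | zero =>
    simp only [Finset.range_zero, Finset.sum_empty, pow_zero, zero_add, inv_one, mul_one]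
    split_ifs with h
    · rw [le_div_iff₀ ha]; linarith
    · positivity
  | succ N ih =>
    rw [Finset.sum_range_succ]
    by_cases h : a < (2 : ℝ) ^ N
    · have h' : a < (2 : ℝ) ^ (N + 1) := by rw [pow_succ]; nlinarith [pow_pos (two_pos (α := ℝ)) N]
      simp only [h, h', if_true] at ih ⊢
      have : 2 * ((2 : ℝ) ^ (N + 1))⁻¹ = ((2 : ℝ) ^ N)⁻¹ := by rw [pow_succ]; field_simp
      linarith
    · have h0 : ∑ i ∈ Finset.range N, (if a < (2 : ℝ) ^ i then ((2 : ℝ) ^ i)⁻¹ else 0) = 0 := by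
        refine Finset.sum_eq_zero fun i hi => if_neg fun hi' => h (hi'.trans_le ?_)
        exact pow_le_pow_right₀ (by norm_num) (Finset.mem_range.1 hi).le
      rw [h0, if_neg h]
      split_ifs with h'
      · rw [zero_add, zero_add, ← div_eq_mul_inv]
        gcongr
      · simp; positivity

/-- The truncated kernels satisfy the Calderón–Zygmund conditions uniformly. -/
theorem exists_isCZKernel_rieszTrunc (hΦ : IsRadialCutoff Φ) : ∃ A : ℝ≥0, ∀ (j : Fin n) (N : ℕ),
    IsCZKernel A (rieszTrunc Φ j N) := by
  obtain ⟨S, hS⟩ := hΦ.exists_bound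
  have hL : ∀ j : Fin n, ∃ L : ℝ≥0, LipschitzWith L (rieszTrunc Φ j 1) := fun j =>
    ContDiff.lipschitzWith_of_hasCompactSupport (HasCompactSupport.intro (isCompact_closedBall 0 2)
      fun z hz => rieszTrunc_eq_zero hΦ 1 (by simpa using hz)) (contDiff_rieszTrunc_one hΦ) (by simp)
  choose L hL using hL
  -- Summing the Lipschitz constants over all directions makes the constant independent of `j`.
  refine ⟨S + (∑ j, L j) * (2 * 4 ^ (n + 1)), fun j N => ⟨(contDiff_rieszTrunc hΦ N).continuous,
    fun z hz => rieszTrunc_eq_zero hΦ N hz, fun z => ?_, fun z z' hzz => ?_⟩⟩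
  · refine (abs_rieszTrunc_mul_le hΦ hS N z).trans ?_
    push_cast
    have : (0 : ℝ) ≤ (∑ j, (L j : ℝ)) * (2 * 4 ^ (n + 1)) := by positivity
    linarith
  · rcases eq_or_ne z 0 with rfl | hz
    · have : ‖(0 : Eu n) - z'‖ = 0 := by
        have := norm_nonneg ((0 : Eu n) - z'); rw [norm_zero] at hzz; linarith
      rw [this, norm_zero]
      simp
    have hz0 : 0 < ‖z‖ := norm_pos_iff.2 hz
    -- The `i`-th dilate has Lipschitz constant `L j * (2 ^ i) ^ (n + 1)`. When `2 ^ i * ‖z‖ > 4`,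
    -- both dilated points have norm above 2, because `‖z'‖ ≥ ‖z‖ / 2`, and the term is zero.
    have hterm : ∀ i : ℕ, |((2 : ℝ) ^ i) ^ n * rieszTrunc Φ j 1 ((2 : ℝ) ^ i • z) -
        ((2 : ℝ) ^ i) ^ n * rieszTrunc Φ j 1 ((2 : ℝ) ^ i • z')| ≤
        L j * ‖z - z'‖ * (if (2 : ℝ) ^ i ≤ 4 / ‖z‖ then ((2 : ℝ) ^ i) ^ (n + 1) else 0) := by
      intro i
      have hi : (0 : ℝ) < 2 ^ i := by positivity
      split_ifs with h
      · rw [← mul_sub, abs_mul, abs_of_pos (pow_pos hi n)]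
        have := (hL j).dist_le_mul ((2 : ℝ) ^ i • z) ((2 : ℝ) ^ i • z')
        rw [Real.dist_eq, dist_eq_norm, ← smul_sub, norm_two_pow_smul] at this
        calc _ ≤ ((2 : ℝ) ^ i) ^ n * (L j * (2 ^ i * ‖z - z'‖)) := by gcongr
          _ = _ := by ring
      · rw [not_le, div_lt_iff₀ hz0] at h
        have h1 : ‖z‖ ≤ 2 * ‖z'‖ := by
          have := norm_sub_norm_le z z'
          linarith
        rw [rieszTrunc_eq_zero hΦ 1 (by rw [norm_two_pow_smul]; linarith),
          rieszTrunc_eq_zero hΦ 1 (by rw [norm_two_pow_smul]; nlinarith)]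
        simp
    have hsum : |rieszTrunc Φ j N z - rieszTrunc Φ j N z'| ≤
        L j * ‖z - z'‖ * (2 * (4 / ‖z‖) ^ (n + 1)) := by
      rw [rieszTrunc_eq_sum, rieszTrunc_eq_sum N z', ← Finset.sum_sub_distrib]
      refine (Finset.abs_sum_le_sum_abs _ _).trans ((Finset.sum_le_sum fun i _ => hterm i).trans ?_)
      rw [← Finset.mul_sum]
      gcongr
      exact sum_two_pow_pow_le (Nat.succ_ne_zero n) (by positivity) N
    have hLj : (L j : ℝ) ≤ ∑ j, (L j : ℝ) :=
      Finset.single_le_sum (f := fun j => (L j : ℝ)) (fun i _ => (L i).2) (Finset.mem_univ j)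
    calc _ ≤ L j * ‖z - z'‖ * (2 * (4 / ‖z‖) ^ (n + 1)) * ‖z‖ ^ (n + 1) := by gcongr
      _ = L j * (2 * 4 ^ (n + 1)) * ‖z - z'‖ := by rw [div_pow]; field_simp
      _ ≤ _ := by
        push_cast
        have : (0 : ℝ) ≤ S := S.2
        gcongr
        nlinarith [pow_pos (by norm_num : (0 : ℝ) < 4) (n + 1)]

lemma fourier_two_pow_smul (h : Eu n → ℂ) (i : ℕ) (ξ : Eu n) :
    𝓕 (fun z => (((2 : ℝ) ^ i) ^ n : ℝ) • h ((2 : ℝ) ^ i • z)) ξ = 𝓕 h (((2 : ℝ) ^ i)⁻¹ • ξ) := by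
  have hi : (0 : ℝ) < 2 ^ i := by positivity
  rw [Real.fourier_eq, Real.fourier_eq]
  have h1 := Measure.integral_comp_smul (volume : Measure (Eu n))
    (fun v => Real.fourierChar (-inner ℝ v (((2 : ℝ) ^ i)⁻¹ • ξ)) • h v) ((2 : ℝ) ^ i)
  rw [finrank_euclideanSpace_fin, abs_of_pos (by positivity), eq_inv_smul_iff₀ (by positivity),
    ← integral_smul] at h1
  rw [← h1]
  refine integral_congr_ae (Eventually.of_forall fun v => ?_)
  simp only [inner_smul_left, inner_smul_right, RCLike.conj_to_real]
  rw [← mul_assoc, inv_mul_cancel₀ hi.ne', one_mul, smul_comm]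

/-- Oddness kills the mean, hence the Fourier transform at 0. The first bound is then the mean value
inequality and the second is Schwartz decay. -/
lemma exists_norm_fourier_le (κ : 𝓢(Eu n, ℂ)) (hκ : ∀ z, κ (-z) = -κ z) : ∃ C : ℝ, 0 ≤ C ∧
    ∀ ξ, ‖𝓕 (κ : Eu n → ℂ) ξ‖ ≤ C * ‖ξ‖ ∧ ‖ξ‖ * ‖𝓕 (κ : Eu n → ℂ) ξ‖ ≤ C := by
  have h0 : 𝓕 (κ : Eu n → ℂ) 0 = 0 := by
    rw [Real.fourier_eq]
    simp only [inner_zero_right, neg_zero, AddChar.map_zero_eq_one, one_smul]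
    have h1 := integral_neg_eq_self (fun v => κ v) volume
    simp only [hκ, integral_neg] at h1
    exact self_eq_neg.1 h1.symm
  obtain ⟨F, hF⟩ : ∃ F : 𝓢(Eu n, ℂ), (F : Eu n → ℂ) = 𝓕 (κ : Eu n → ℂ) := ⟨𝓕 κ, rfl⟩
  rw [← hF] at h0 ⊢
  obtain ⟨C₁, hC₁, h1⟩ := F.decay 1 0
  obtain ⟨C₂, hC₂, h2⟩ := F.decay 0 1
  simp only [pow_one, norm_iteratedFDeriv_zero] at h1
  simp only [pow_zero, one_mul, norm_iteratedFDeriv_one] at h2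
  refine ⟨C₁ + C₂, by positivity, fun ξ => ⟨?_, (h1 ξ).trans (by linarith)⟩⟩
  have := convex_univ.norm_image_sub_le_of_norm_fderiv_le (𝕜 := ℝ) (f := F) (C := C₂)
    (fun x _ => F.differentiableAt) (fun x _ => h2 x) (Set.mem_univ 0) (Set.mem_univ ξ)
  rw [h0, sub_zero, sub_zero] at this
  exact this.trans (by gcongr; linarith)

/-- The Fourier transforms of the truncated kernels are uniformly bounded. -/
theorem exists_norm_fourier_rieszTrunc_le (hΦ : IsRadialCutoff Φ) : ∃ M : ℝ≥0, 0 < M ∧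
    ∀ (j : Fin n) (N : ℕ) (ξ : Eu n), ‖𝓕 (fun z => (rieszTrunc Φ j N z : ℂ)) ξ‖ ≤ M := by
  have hκ : ∀ j : Fin n, ∃ κ : 𝓢(Eu n, ℂ), ∀ z, κ z = (rieszTrunc Φ j 1 z : ℂ) := fun j =>
    have hcs : HasCompactSupport fun z => (rieszTrunc Φ j 1 z : ℂ) :=
      HasCompactSupport.intro (isCompact_closedBall 0 2) fun z hz => by
        simp [rieszTrunc_eq_zero hΦ 1 (by simpa using hz : 2 < ‖z‖)]
    have hsm : ContDiff ℝ ∞ fun z => (rieszTrunc Φ j 1 z : ℂ) :=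
      Complex.ofRealCLM.contDiff.comp (contDiff_rieszTrunc_one hΦ)
    ⟨hcs.toSchwartzMap hsm, fun _ => rfl⟩
  choose κ hκ using hκ
  choose C hC0 hC using fun j => exists_norm_fourier_le (κ j) fun z => by
    rw [hκ, hκ, rieszTrunc_neg hΦ]; simp
  refine ⟨1 + 4 * ∑ j, (C j).toNNReal, by positivity, fun j N ξ => ?_⟩
  have hint : ∀ i : ℕ, Integrable fun z : Eu n =>
      (((2 : ℝ) ^ i) ^ n : ℝ) • κ j ((2 : ℝ) ^ i • z) := by
    intro i
    have := (κ j).integrable (μ := volume).comp_smul (by positivity : ((2 : ℝ) ^ i) ≠ 0)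
    exact this.smul (((2 : ℝ) ^ i) ^ n)
  have hsum : 𝓕 (fun z => (rieszTrunc Φ j N z : ℂ)) ξ =
      ∑ i ∈ Finset.range N, 𝓕 (κ j : Eu n → ℂ) (((2 : ℝ) ^ i)⁻¹ • ξ) := by
    have e1 : (fun z => (rieszTrunc Φ j N z : ℂ)) = fun z =>
        ∑ i ∈ Finset.range N, (((2 : ℝ) ^ i) ^ n : ℝ) • κ j ((2 : ℝ) ^ i • z) := by
      funext z
      rw [rieszTrunc_eq_sum]
      push_cast
      refine Finset.sum_congr rfl fun i _ => ?_
      simp [hκ]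
    rw [e1, Real.fourier_eq]
    simp only [Finset.smul_sum]
    rw [integral_finsetSum]
    · refine Finset.sum_congr rfl fun i _ => ?_
      rw [← fourier_two_pow_smul, Real.fourier_eq]
    · intro i _
      exact (Real.fourierIntegral_convergent_iff ξ).2 (hint i)
  rw [hsum]
  have hbound : ∑ i ∈ Finset.range N, ‖𝓕 (κ j : Eu n → ℂ) (((2 : ℝ) ^ i)⁻¹ • ξ)‖ ≤ 4 * C j := by
    rcases eq_or_ne ξ 0 with rfl | hξ
    · have h0 : 𝓕 (κ j : Eu n → ℂ) 0 = 0 := norm_le_zero_iff.1 (by simpa using (hC j 0).1)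
      simp [h0, hC0]
    have hξ0 : 0 < ‖ξ‖ := norm_pos_iff.2 hξ
    have hn : ∀ i : ℕ, ‖((2 : ℝ) ^ i)⁻¹ • ξ‖ = ((2 : ℝ) ^ i)⁻¹ * ‖ξ‖ := fun i => by
      rw [norm_smul, norm_inv, norm_pow, Real.norm_ofNat]
    -- Decay is used for `2 ^ i ≤ ‖ξ‖` and the zero at the origin for the other `i`. The two
    -- geometric sums are dominated by their terms near `2 ^ i ≈ ‖ξ‖`, uniformly in `N` and `ξ`.
    have hterm : ∀ i : ℕ, ‖𝓕 (κ j : Eu n → ℂ) (((2 : ℝ) ^ i)⁻¹ • ξ)‖ ≤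
        C j / ‖ξ‖ * (if (2 : ℝ) ^ i ≤ ‖ξ‖ then ((2 : ℝ) ^ i) ^ 1 else 0) +
        C j * ‖ξ‖ * (if ‖ξ‖ < (2 : ℝ) ^ i then ((2 : ℝ) ^ i)⁻¹ else 0) := by
      intro i
      have hi : (0 : ℝ) < 2 ^ i := by positivity
      by_cases h : (2 : ℝ) ^ i ≤ ‖ξ‖
      · rw [if_pos h, if_neg (not_lt.2 h), mul_zero, add_zero, pow_one]
        have := (hC j (((2 : ℝ) ^ i)⁻¹ • ξ)).2
        rw [hn] at this
        calc ‖𝓕 (κ j : Eu n → ℂ) (((2 : ℝ) ^ i)⁻¹ • ξ)‖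
            = (((2 : ℝ) ^ i)⁻¹ * ‖ξ‖ * ‖𝓕 (κ j : Eu n → ℂ) (((2 : ℝ) ^ i)⁻¹ • ξ)‖) / ‖ξ‖ * 2 ^ i := by
              field_simp
          _ ≤ _ := by gcongr
      · rw [if_neg h, if_pos (not_le.1 h), mul_zero, zero_add]
        have := (hC j (((2 : ℝ) ^ i)⁻¹ • ξ)).1
        rw [hn] at this
        exact this.trans_eq (by ring)
    calc _ ≤ ∑ i ∈ Finset.range N, _ := Finset.sum_le_sum fun i _ => hterm i
      _ = C j / ‖ξ‖ * ∑ i ∈ Finset.range N, (if (2 : ℝ) ^ i ≤ ‖ξ‖ then ((2 : ℝ) ^ i) ^ 1 else 0) +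
          C j * ‖ξ‖ * ∑ i ∈ Finset.range N, (if ‖ξ‖ < (2 : ℝ) ^ i then ((2 : ℝ) ^ i)⁻¹ else 0) := by
          rw [Finset.sum_add_distrib, Finset.mul_sum, Finset.mul_sum]
      _ ≤ C j / ‖ξ‖ * (2 * ‖ξ‖ ^ 1) + C j * ‖ξ‖ * (2 / ‖ξ‖) := by
          have hC0' := hC0 j
          have h2 := sum_two_pow_inv_le hξ0 N
          have h3 : (0 : ℝ) ≤ if ‖ξ‖ < (2 : ℝ) ^ N then 2 * ((2 : ℝ) ^ N)⁻¹ else 0 := by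
            split_ifs <;> positivity
          gcongr
          · exact sum_two_pow_pow_le one_ne_zero hξ0 N
          · linarith
      _ = _ := by field_simp; ring
  refine (norm_sum_le _ _).trans (hbound.trans ?_)
  have h1 : C j ≤ ∑ j, ((C j).toNNReal : ℝ) :=
    (Real.le_coe_toNNReal _).trans (Finset.single_le_sum (f := fun j => ((C j).toNNReal : ℝ))
      (fun i _ => NNReal.coe_nonneg _) (Finset.mem_univ j))
  push_cast
  linarith

/-- The uniform `L²` bound for the truncated operators. -/
theorem exists_lintegral_conv_rieszTrunc_sq_le (hΦ : IsRadialCutoff Φ) : ∃ B : ℝ≥0,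
    ∀ (j : Fin n) (N : ℕ) (f : Eu n → ℂ), LocallyIntegrable f volume →
      ∫⁻ x, ‖conv (rieszTrunc Φ j N) f x‖ₑ ^ 2 ≤ B * ∫⁻ x, ‖f x‖ₑ ^ 2 := by
  obtain ⟨A, hA⟩ := exists_isCZKernel_rieszTrunc hΦ
  obtain ⟨M, hM0, hM⟩ := exists_norm_fourier_rieszTrunc_le hΦ
  exact ⟨M ^ 2, fun j N f hf =>
    (hA j N).lintegral_conv_sq_le (contDiff_rieszTrunc hΦ N) hM0 (hM j N) hf⟩

/-- The uniform weak type `(1,1)` bound for the truncated operators. -/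
theorem exists_conv_rieszTrunc_weak_type (hn : 0 < n) (hΦ : IsRadialCutoff Φ) : ∃ W : ℝ≥0,
    ∀ (j : Fin n) (N : ℕ) (f : Eu n → ℂ), LocallyIntegrable f volume → ∀ t : ℝ≥0∞,
      t * volume {x | t < ‖conv (rieszTrunc Φ j N) f x‖ₑ} ≤ W * ∫⁻ x, ‖f x‖ₑ := by
  obtain ⟨A, hA⟩ := exists_isCZKernel_rieszTrunc hΦ
  obtain ⟨B, hB⟩ := exists_lintegral_conv_rieszTrunc_sq_le hΦ
  obtain ⟨W, hW⟩ := conv_weak_type hn A 1 B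
  exact ⟨W, fun j N => hW volume (isA1Measure_volume _) .rfl _ (hA j N) (hB j N)⟩

end LTwo

/-! ### Truncations of Lipschitz functions and the maximal truncated operator. -/

section PrincipalValue

variable {n : ℕ} {Φ : Eu n → ℝ} {j : Fin n}

lemma integrable_bounded_kernel {D : Eu n → ℝ} (hD : Measurable D) {M r : ℝ}
    (hM : ∀ z, |D z| ≤ M) (hr : ∀ z, r < ‖z‖ → D z = 0) {f : Eu n → ℂ}
    (hf : LocallyIntegrable f volume) (x : Eu n) : Integrable fun y => D (x - y) • f y := by
  have h1 : Integrable ((Metric.closedBall x r).indicator f) :=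
    (integrable_indicator_iff measurableSet_closedBall).2
      (hf.integrableOn_isCompact (isCompact_closedBall x r))
  refine (h1.norm.const_mul M).mono'
    ((hD.comp (by fun_prop)).aestronglyMeasurable.smul hf.aestronglyMeasurable)
    (Eventually.of_forall fun y => ?_)
  rw [norm_smul]
  by_cases hy : y ∈ Metric.closedBall x r
  · rw [Set.indicator_of_mem hy]
    exact mul_le_mul_of_nonneg_right (hM _) (norm_nonneg _)
  · rw [hr (x - y) (by rwa [Metric.mem_closedBall, not_le, dist_comm, dist_eq_norm] at hy)]
    simp [hy]

/-- A bounded odd kernel only sees the oscillation of the function. -/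
lemma enorm_integral_odd_kernel_le {D : Eu n → ℝ} (hD : Measurable D) {M : ℝ≥0} {r : ℝ}
    (hM : ∀ z, |D z| ≤ M) (hr : ∀ z, r < ‖z‖ → D z = 0) (hodd : ∀ z, D (-z) = -D z)
    {f : Eu n → ℂ} (hf : LocallyIntegrable f volume) (x : Eu n) :
    ‖∫ y, D (x - y) • f y‖ₑ ≤ M * ∫⁻ y in Metric.closedBall x r, ‖f y - f x‖ₑ := by
  have hc : LocallyIntegrable (fun _ : Eu n => f x) volume := continuous_const.locallyIntegrable
  have h0 : ∫ y, D (x - y) • f x = 0 := by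
    rw [integral_smul_const, integral_sub_left_eq_self (fun z => D z) volume x]
    have h1 := integral_neg_eq_self D volume
    simp only [hodd, integral_neg] at h1
    rw [self_eq_neg.1 h1.symm, zero_smul]
  have e : ∫ y, D (x - y) • f y = ∫ y, D (x - y) • (f y - f x) := by
    simp only [smul_sub]
    rw [integral_sub (integrable_bounded_kernel hD hM hr hf x)
      (integrable_bounded_kernel hD hM hr hc x), h0, sub_zero]
  rw [e, ← lintegral_const_mul' _ _ (by finiteness), ← lintegral_indicator measurableSet_closedBall]
  refine (enorm_integral_le_lintegral_enorm _).trans (lintegral_mono fun y => ?_)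
  by_cases hy : y ∈ Metric.closedBall x r
  · rw [Set.indicator_of_mem hy, enorm_smul]
    refine mul_le_mul_left ?_ _
    rw [← ofReal_norm, ← ENNReal.ofReal_coe_nnreal]
    exact ENNReal.ofReal_le_ofReal (hM _)
  · rw [hr (x - y) (by rwa [Metric.mem_closedBall, not_le, dist_comm, dist_eq_norm] at hy)]
    simp

lemma abs_le_of_mul_norm_pow_le {a S R : ℝ} {z : Eu n} (hR : 0 < R) (ha : |a| * ‖z‖ ^ n ≤ S)
    (hz : 1 ≤ R * ‖z‖) : |a| ≤ S * R ^ n := by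
  calc |a| ≤ |a| * (R * ‖z‖) ^ n := le_mul_of_one_le_right (abs_nonneg _) (one_le_pow₀ hz)
    _ = (|a| * ‖z‖ ^ n) * R ^ n := by rw [mul_pow]; ring
    _ ≤ S * R ^ n := by gcongr

/-- The truncated integrals of a smooth function with compact support form a Cauchy sequence. -/
lemma cauchySeq_conv_rieszTrunc (hΦ : IsRadialCutoff Φ) {g : Eu n → ℂ} {L : ℝ≥0}
    (hg : LipschitzWith L g) (x : Eu n) : CauchySeq fun N => conv (rieszTrunc Φ j N) g x := by
  obtain ⟨A, hA⟩ := exists_isCZKernel_rieszTrunc hΦ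
  have hgl : LocallyIntegrable g volume := hg.continuous.locallyIntegrable
  set C : ℝ≥0 := 2 * A * 2 ^ n * L * 2 * (ballVol n * 3 ^ n) with hC
  refine cauchySeq_of_edist_le_of_tsum_ne_top (fun N => C * (2⁻¹ : ℝ≥0∞) ^ N) (fun N => ?_) ?_
  swap
  · rw [ENNReal.tsum_mul_left, ENNReal.tsum_geometric, ENNReal.one_sub_inv_two, inv_inv]
    finiteness
  have h2 : (0 : ℝ) < 2 ^ N := by positivity
  -- Consecutive kernels agree for `‖z‖ > 2 * 2 ^ (-N)`, and their difference is odd and of size `2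
  -- ^ (N * n)`. Only the oscillation of `g` at that scale is seen, which is of order `2 ^ (-N)`.
  set D : Eu n → ℝ := fun z => rieszTrunc Φ j N z - rieszTrunc Φ j (N + 1) z with hD
  have hDm : Measurable D := ((hA j N).cont.sub (hA j (N + 1)).cont).measurable
  have hDM : ∀ z, |D z| ≤ ((2 * A * (2 * 2 ^ N) ^ n : ℝ≥0) : ℝ) := by
    intro z
    have h3 : (0 : ℝ) ≤ 2 * A * (2 * 2 ^ N) ^ n := by positivity
    push_cast
    rcases lt_or_ge (2 * 2 ^ N * ‖z‖) 1 with hz | hz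
    · rw [hD]
      simp only
      rw [rieszTrunc_eq_zero_of_lt hΦ N (by nlinarith [norm_nonneg z]),
        rieszTrunc_eq_zero_of_lt hΦ (N + 1) (by rw [pow_succ]; linarith)]
      simpa using h3
    · have h4 := abs_le_of_mul_norm_pow_le (by positivity) ((hA j N).size z) hz
      have h5 := abs_le_of_mul_norm_pow_le (by positivity) ((hA j (N + 1)).size z) hz
      exact (abs_sub _ _).trans (by linarith)
  have hDr : ∀ z, 2 * (2 ^ N : ℝ)⁻¹ < ‖z‖ → D z = 0 := by
    intro z hz
    rw [← div_eq_mul_inv, div_lt_iff₀ h2] at hz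
    rw [hD]
    simp only
    rw [rieszTrunc_eq_rieszKernel hΦ N (by linarith), rieszTrunc_eq_rieszKernel hΦ (N + 1)
      (by rw [pow_succ]; nlinarith [norm_nonneg z]), sub_self]
  have hDo : ∀ z, D (-z) = -D z := fun z => by
    simp only [hD, rieszTrunc_neg hΦ]; ring
  have e : conv (rieszTrunc Φ j N) g x - conv (rieszTrunc Φ j (N + 1)) g x =
      ∫ y, D (x - y) • g y := by
    rw [conv, conv, ← integral_sub ((hA j N).integrable hgl x) ((hA j (N + 1)).integrable hgl x)]
    simp only [hD, sub_smul]
  rw [edist_eq_enorm_sub, e]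
  refine (enorm_integral_odd_kernel_le hDm hDM hDr hDo hgl x).trans ?_
  have h6 : ∫⁻ y in Metric.closedBall x (2 * (2 ^ N : ℝ)⁻¹), ‖g y - g x‖ₑ ≤
      L * ENNReal.ofReal (2 * (2 ^ N : ℝ)⁻¹) * (ballVol n * ENNReal.ofReal (3 * (2 ^ N : ℝ)⁻¹) ^ n) := by
    calc _ ≤ ∫⁻ y in Metric.closedBall x (2 * (2 ^ N : ℝ)⁻¹),
          L * ENNReal.ofReal (2 * (2 ^ N : ℝ)⁻¹) := by
          refine setLIntegral_mono' measurableSet_closedBall fun y hy => ?_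
          rw [← edist_eq_enorm_sub]
          refine (hg y x).trans (mul_le_mul_right ?_ _)
          rw [edist_dist]
          exact ENNReal.ofReal_le_ofReal hy
      _ ≤ _ := by
          rw [setLIntegral_const]
          refine mul_le_mul_right ?_ _
          -- The closed ball of radius `2 * 2 ^ (-N)` is put inside the open ball of radius `3 * 2 ^
          -- (-N)`, whence the `3 ^ n` in the constant.
          rw [← volume_ball_eq x (by positivity)]
          refine measure_mono (Metric.closedBall_subset_ball ?_)
          have : (0 : ℝ) < (2 ^ N)⁻¹ := by positivity
          linarith
  refine (mul_le_mul_right h6 _).trans (le_of_eq ?_)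
  have e2 : ∀ a : ℕ, ENNReal.ofReal ((a : ℝ) * (2 ^ N : ℝ)⁻¹) = a * (2⁻¹ : ℝ≥0∞) ^ N := by
    intro a
    rw [ENNReal.ofReal_mul (by positivity), ENNReal.ofReal_inv_of_pos h2,
      ENNReal.ofReal_pow (by norm_num), ENNReal.ofReal_natCast, ENNReal.inv_pow]
    simp
  have e2' := e2 2
  have e3' := e2 3
  push_cast at e2' e3'
  rw [e2', e3', hC]
  push_cast
  have h7 : (2 : ℝ≥0∞) ^ N * 2⁻¹ ^ N = 1 := by
    rw [← mul_pow, ENNReal.mul_inv_cancel (by norm_num) (by norm_num), one_pow]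
  calc _ = 2 * A * 2 ^ n * L * 2 * (ballVol n * 3 ^ n) * 2⁻¹ ^ N *
        ((2 : ℝ≥0∞) ^ N * 2⁻¹ ^ N) ^ n := by ring
    _ = _ := by rw [h7, one_pow, mul_one]

lemma volume_ball_five_mul (c : Eu n) {r : ℝ} (hr : 0 < r) :
    volume (Metric.ball c (5 * r)) ≤ 5 ^ n * volume (Metric.ball c r) := by
  rw [volume_ball_mul c c (by norm_num) hr]
  simp

/-- The weak type bound for the unrestricted maximal function on `ℝⁿ`. -/
lemma volume_maxSet_le (φ : Eu n → ℝ≥0∞) (t : ℝ≥0∞) :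
    t * volume (⋃ R : ℕ, maxSet volume φ t R) ≤ 5 ^ n * ∫⁻ x, φ x :=
  measure_iUnion_maxSet_le (fun c _ hr => volume_ball_five_mul c hr) φ t

/-- Two sets of small density in a ball do not cover it. -/
lemma exists_mem_ball_notMem {X : Type*} [MeasurableSpace X] {μ : Measure X} {B S T : Set X}
    (h : μ (B ∩ S) + μ (B ∩ T) < μ B) : ∃ z ∈ B, z ∉ S ∧ z ∉ T := by
  by_contra! hcon
  refine absurd h (not_lt.2 ((measure_mono fun z hz => ?_).trans (measure_union_le _ _)))
  by_cases hzS : z ∈ S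
  · exact Or.inl ⟨hz, hzS⟩
  · exact Or.inr ⟨hz, hcon z hz hzS⟩

set_option maxHeartbeats 800000 in
/-- The weak type `(1,1)` bound for the maximal truncated operator. -/
theorem exists_maximal_truncation_weak_type (hn : 0 < n) (hΦ : IsRadialCutoff Φ) : ∃ C : ℝ≥0,
    ∀ (j : Fin n) (f : Eu n → ℂ), LocallyIntegrable f volume → ∀ t : ℝ≥0∞,
      t * volume {x | ∃ N, t < ‖conv (rieszTrunc Φ j N) f x‖ₑ} ≤ C * ∫⁻ x, ‖f x‖ₑ := by
  obtain ⟨A, hA⟩ := exists_isCZKernel_rieszTrunc hΦ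
  obtain ⟨W, hW⟩ := exists_conv_rieszTrunc_weak_type hn hΦ
  set V := ballVol n
  have hV : (V : ℝ≥0∞) ≠ 0 := by exact_mod_cast (ballVol_pos n).ne'
  -- The terms are the constants lost in the local part, in the oscillation estimate and in the weak
  -- type bound at height `t / 4`; the last 1 keeps `P` nonzero. The choice `ε * P = 1 / 4` makes
  -- these losses affordable.
  set P : ℝ≥0 := A * V * 4 ^ n + A * 2 ^ (n + 2) * V + 4 * W * 2 ^ n + 1 with hP
  have hP0 : P ≠ 0 := by positivity
  set ε : ℝ≥0 := (4 * P)⁻¹ with hε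
  have hε0 : ε ≠ 0 := by positivity
  have hεP : ε * P = 4⁻¹ := by rw [hε]; field_simp
  refine ⟨5 ^ n * ε⁻¹ + 2 * 5 ^ n * (4 * W), fun j f hf t => ?_⟩
  rcases eq_or_ne t 0 with rfl | ht0
  · simp
  rcases eq_or_ne t ∞ with rfl | ht
  · simp
  -- The finest of the truncations `k ≤ m`, namely the `m`-th, plays the role of the full operator
  -- in Cotlar's inequality. The bound does not depend on `m`, so monotone convergence gives the
  -- supremum.
  have hSm : ∀ m : ℕ, t * volume {x | ∃ k ≤ m, t < ‖conv (rieszTrunc Φ j k) f x‖ₑ} ≤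
      (5 ^ n * ε⁻¹ + 2 * 5 ^ n * (4 * W) : ℝ≥0) * ∫⁻ x, ‖f x‖ₑ := by
    intro m
    set G := {z | t / 4 < ‖conv (rieszTrunc Φ j m) f z‖ₑ} with hG
    have hGm : MeasurableSet G :=
      measurableSet_lt measurable_const ((hA j m).continuous_conv hf).measurable.enorm
    set M₁ := ⋃ R : ℕ, maxSet volume (fun y => ‖f y‖ₑ) (ε * t) R with hM₁
    set M₂ := ⋃ R : ℕ, maxSet volume (G.indicator 1) 2⁻¹ R with hM₂
    -- With `δ = 2 ^ (-k)`, the function is split at distance `4 * δ` from `x`. The `k`-th and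
    -- `m`-th truncations of the far part agree at `x`, and the value at `x` is close to that at a
    -- nearby `z`. There the far part is the difference of two terms of size at most `t / 4`; such a
    -- `z` exists because the forbidden sets fill at most `1 / 2 + 1 / 4` of the ball of radius `2 *
    -- δ`.
    have hcover : {x | ∃ k ≤ m, t < ‖conv (rieszTrunc Φ j k) f x‖ₑ} ⊆ M₁ ∪ M₂ := by
      rintro x ⟨k, hkm, hk⟩
      by_contra hx
      rw [Set.mem_union, not_or] at hx
      obtain ⟨hx1, hx2⟩ := hx
      refine absurd hk (not_lt.2 ?_)
      have h2k : (0 : ℝ) < 2 ^ k := by positivity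
      obtain ⟨δ, hδ0, hδ⟩ : ∃ δ : ℝ, 0 < δ ∧ 2 ^ k * δ = 1 :=
        ⟨(2 ^ k)⁻¹, by positivity, mul_inv_cancel₀ h2k.ne'⟩
      have havg : ∀ r, 0 < r → ∫⁻ y in Metric.ball x r, ‖f y‖ₑ ≤
          ε * t * (V * ENNReal.ofReal r ^ n) := by
        intro r hr
        have := setLIntegral_le_of_notMem_iUnion_maxSet hx1 hr (Metric.mem_ball_self hr)
        rwa [volume_ball_eq x hr] at this
      set f₁ := (Metric.ball x (4 * δ)).indicator f with hf₁
      set f₂ := (Metric.ball x (4 * δ))ᶜ.indicator f with hf₂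
      have hl1 : LocallyIntegrable f₁ volume := hf.indicator measurableSet_ball
      have hl2 : LocallyIntegrable f₂ volume := hf.indicator measurableSet_ball.compl
      have hf1n : ∫⁻ y, ‖f₁ y‖ₑ ≤ ε * t * (V * ENNReal.ofReal (4 * δ) ^ n) := by
        simp only [hf₁, enorm_indicator_eq_indicator_enorm]
        rw [lintegral_indicator measurableSet_ball]
        exact havg _ (by positivity)
      have hadd : ∀ i z, conv (rieszTrunc Φ j i) f z =
          conv (rieszTrunc Φ j i) f₁ z + conv (rieszTrunc Φ j i) f₂ z := fun i z =>
        (hA j i).conv_indicator_add hf measurableSet_ball z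
      -- the local part
      have hloc : ‖conv (rieszTrunc Φ j k) f₁ x‖ₑ ≤ A * V * 4 ^ n * (ε * t) := by
        have hK : ∀ z, ‖rieszTrunc Φ j k z‖ₑ ≤ A * ENNReal.ofReal (2 ^ k) ^ n := by
          intro z
          rcases lt_or_ge (2 ^ k * ‖z‖) 1 with hz | hz
          · rw [rieszTrunc_eq_zero_of_lt hΦ k hz]; simp
          · have := abs_le_of_mul_norm_pow_le h2k ((hA j k).size z) hz
            rw [← ofReal_norm, ← ENNReal.ofReal_coe_nnreal, ← ENNReal.ofReal_pow h2k.le,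
              ← ENNReal.ofReal_mul (p := (A : ℝ)) A.2]
            exact ENNReal.ofReal_le_ofReal this
        calc _ ≤ ∫⁻ y, ‖rieszTrunc Φ j k (x - y)‖ₑ * ‖f₁ y‖ₑ := enorm_conv_le _ _ _
          _ ≤ ∫⁻ y, A * ENNReal.ofReal (2 ^ k) ^ n * ‖f₁ y‖ₑ :=
            lintegral_mono fun y => mul_le_mul_left (hK _) _
          _ = A * ENNReal.ofReal (2 ^ k) ^ n * ∫⁻ y, ‖f₁ y‖ₑ :=
            lintegral_const_mul' _ _ (by finiteness)
          _ ≤ A * ENNReal.ofReal (2 ^ k) ^ n * (ε * t * (V * ENNReal.ofReal (4 * δ) ^ n)) := by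
            gcongr
          _ = A * V * (ENNReal.ofReal (2 ^ k) * ENNReal.ofReal (4 * δ)) ^ n * (ε * t) := by ring
          _ = _ := by
            rw [← ENNReal.ofReal_mul h2k.le, show (2 : ℝ) ^ k * (4 * δ) = 4 by linear_combination 4 * hδ]
            simp
      -- the truncations agree on the far part
      have hfar : conv (rieszTrunc Φ j k) f₂ x = conv (rieszTrunc Φ j m) f₂ x := by
        refine integral_congr_ae (Eventually.of_forall fun y => ?_)
        by_cases hy : y ∈ Metric.ball x (4 * δ)
        · simp [hf₂, hy]
        · have hy' : 4 * δ ≤ ‖x - y‖ := by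
            rwa [Metric.mem_ball, not_lt, dist_comm, dist_eq_norm] at hy
          have h3 : 4 ≤ 2 ^ k * ‖x - y‖ := by nlinarith
          have h4 : (2 : ℝ) ^ k ≤ 2 ^ m := pow_le_pow_right₀ (by norm_num) hkm
          simp only
          rw [rieszTrunc_eq_rieszKernel hΦ k (by linarith),
            rieszTrunc_eq_rieszKernel hΦ m (by nlinarith [norm_nonneg (x - y)])]
      -- a good point in the ball
      have hvol : volume (Metric.ball x (2 * δ)) = V * ENNReal.ofReal (2 * δ) ^ n :=
        volume_ball_eq x (by positivity)
      have hvol0 : volume (Metric.ball x (2 * δ)) ≠ 0 :=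
        (Metric.measure_ball_pos volume x (by positivity)).ne'
      obtain ⟨z, hz, hz1, hz2⟩ : ∃ z ∈ Metric.ball x (2 * δ), z ∉ G ∧
          z ∉ {z | t / 4 < ‖conv (rieszTrunc Φ j m) f₁ z‖ₑ} := by
        refine exists_mem_ball_notMem (μ := volume) ?_
        have h5 : volume (Metric.ball x (2 * δ) ∩ G) ≤ 2⁻¹ * volume (Metric.ball x (2 * δ)) := by
          have := setLIntegral_le_of_notMem_iUnion_maxSet hx2 (by positivity : 0 < 2 * δ)
            (Metric.mem_ball_self (by positivity))
          rwa [lintegral_indicator_one hGm, Measure.restrict_apply hGm, Set.inter_comm] at this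
        have h6 : volume {z | t / 4 < ‖conv (rieszTrunc Φ j m) f₁ z‖ₑ} ≤
            4⁻¹ * volume (Metric.ball x (2 * δ)) := by
          refine (ENNReal.mul_le_mul_iff_right (a := t / 4) (by simp [ht0]) (by
            simp [ENNReal.div_eq_top, ht])).1 ?_
          refine (hW j m f₁ hl1 (t / 4)).trans ?_
          calc W * ∫⁻ x, ‖f₁ x‖ₑ ≤ W * (ε * t * (V * ENNReal.ofReal (4 * δ) ^ n)) := by gcongr
            _ = t / 4 * ((ε * (4 * W * 2 ^ n)) * (V * ENNReal.ofReal (2 * δ) ^ n)) := by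
              rw [show 4 * δ = 2 * (2 * δ) by ring, ENNReal.ofReal_mul (by norm_num), mul_pow,
                ENNReal.ofReal_ofNat]
              have : t = t / 4 * 4 := (ENNReal.div_mul_cancel (by norm_num) (by norm_num)).symm
              nth_rw 1 [this]
              ring
            _ ≤ t / 4 * (4⁻¹ * (V * ENNReal.ofReal (2 * δ) ^ n)) := by
              refine mul_le_mul_right (mul_le_mul_left ?_ _) _
              have : ε * (4 * W * 2 ^ n) ≤ (4⁻¹ : ℝ≥0) := by
                rw [← hεP, hP]
                refine mul_le_mul_right ?_ _
                rw [add_assoc, add_comm]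
                exact le_add_right (le_add_right le_rfl)
              have h' : ((ε * (4 * W * 2 ^ n) : ℝ≥0) : ℝ≥0∞) ≤ ((4⁻¹ : ℝ≥0) : ℝ≥0∞) := by
                exact_mod_cast this
              rw [ENNReal.coe_inv (by norm_num)] at h'
              push_cast at h'
              exact h'
            _ = _ := by rw [hvol]
        have h7 : volume (Metric.ball x (2 * δ)) ≠ ∞ := measure_ball_lt_top.ne
        calc _ ≤ 2⁻¹ * volume (Metric.ball x (2 * δ)) + 4⁻¹ * volume (Metric.ball x (2 * δ)) :=
              add_le_add h5 ((measure_mono Set.inter_subset_right).trans h6)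
          _ = (2⁻¹ + 4⁻¹) * volume (Metric.ball x (2 * δ)) := by ring
          _ < 1 * volume (Metric.ball x (2 * δ)) := by
              refine (ENNReal.mul_lt_mul_iff_left hvol0 h7).2 ?_
              rw [← ENNReal.toReal_lt_toReal (by finiteness) (by finiteness),
                ENNReal.toReal_add (by finiteness) (by finiteness)]
              norm_num
          _ = _ := one_mul _
      have hosc : ‖conv (rieszTrunc Φ j m) f₂ x - conv (rieszTrunc Φ j m) f₂ z‖ₑ ≤
          A * 2 ^ (n + 2) * (ε * t * V) := by
        refine (hA j m).enorm_conv_sub_le hl2 (c := x) (ρ := 2 * δ) (by positivity)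
          (by simp; positivity) (Metric.mem_ball.1 hz).le (fun y hy => ?_) fun r hr => ?_
        · have : y ∈ Metric.ball x (4 * δ) := by convert hy using 2; ring
          simp [hf₂, this]
        · calc _ ≤ ∫⁻ y in Metric.ball x r, ‖f y‖ₑ := by
                refine lintegral_mono fun y => ?_
                simp only [hf₂, enorm_indicator_eq_indicator_enorm]
                exact Set.indicator_le_self _ _ _
            _ ≤ _ := (havg r (by nlinarith)).trans_eq (by ring)
      have hG' : ‖conv (rieszTrunc Φ j m) f z‖ₑ ≤ t / 4 := not_lt.1 hz1
      have hG'' : ‖conv (rieszTrunc Φ j m) f₁ z‖ₑ ≤ t / 4 := not_lt.1 hz2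
      have hsplit : conv (rieszTrunc Φ j k) f x = conv (rieszTrunc Φ j k) f₁ x +
          (conv (rieszTrunc Φ j m) f₂ x - conv (rieszTrunc Φ j m) f₂ z) +
          (conv (rieszTrunc Φ j m) f z - conv (rieszTrunc Φ j m) f₁ z) := by
        rw [hadd k x, hfar, hadd m z]; ring
      rw [hsplit]
      calc _ ≤ A * V * 4 ^ n * (ε * t) + A * 2 ^ (n + 2) * (ε * t * V) + (t / 4 + t / 4) :=
            (enorm_add_le _ _).trans (add_le_add ((enorm_add_le _ _).trans
              (add_le_add hloc hosc)) (enorm_sub_le.trans (add_le_add hG' hG'')))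
        _ = ((ε * (A * V * 4 ^ n + A * 2 ^ (n + 2) * V) : ℝ≥0) : ℝ≥0∞) * t + (t / 4 + t / 4) := by
            push_cast; ring
        _ ≤ ((4⁻¹ : ℝ≥0) : ℝ≥0∞) * t + (t / 4 + t / 4) := by
            gcongr
            rw [← hεP, hP]
            refine mul_le_mul_right ?_ _
            exact le_add_right (le_add_right le_rfl)
        _ ≤ t := by
            rw [ENNReal.coe_inv (by norm_num), mul_comm]
            push_cast
            rw [← div_eq_mul_inv]
            calc t / 4 + (t / 4 + t / 4) ≤ t / 4 + (t / 4 + t / 4) + t / 4 := le_self_add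
              _ = t / 4 * 4 := by ring
              _ = t := ENNReal.div_mul_cancel (by norm_num) (by norm_num)
    have hv1 : t * volume M₁ ≤ 5 ^ n * (ε : ℝ≥0∞)⁻¹ * ∫⁻ x, ‖f x‖ₑ := by
      have h := volume_maxSet_le (fun y => ‖f y‖ₑ) (ε * t)
      have hε' : (ε : ℝ≥0∞) ≠ 0 := by exact_mod_cast hε0
      calc t * volume M₁ = (ε : ℝ≥0∞)⁻¹ * (ε * t * volume M₁) := by
            rw [← mul_assoc, ← mul_assoc, ENNReal.inv_mul_cancel hε' (by finiteness), one_mul]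
        _ ≤ (ε : ℝ≥0∞)⁻¹ * (5 ^ n * ∫⁻ x, ‖f x‖ₑ) := by gcongr
        _ = _ := by ring
    have hv2 : t * volume M₂ ≤ 2 * 5 ^ n * (4 * W) * ∫⁻ x, ‖f x‖ₑ := by
      have h := volume_maxSet_le (G.indicator 1) 2⁻¹
      rw [lintegral_indicator_one hGm] at h
      have h' := hW j m f hf (t / 4)
      calc t * volume M₂ = 2 * t * (2⁻¹ * volume M₂) := by
            rw [mul_comm 2 t, mul_assoc, ← mul_assoc 2, ENNReal.mul_inv_cancel (by norm_num)
              (by norm_num), one_mul]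
        _ ≤ 2 * t * (5 ^ n * volume G) := by gcongr
        _ = 2 * 5 ^ n * (4 * (t / 4 * volume G)) := by
            have : t = t / 4 * 4 := (ENNReal.div_mul_cancel (by norm_num) (by norm_num)).symm
            nth_rw 1 [this]
            ring
        _ ≤ 2 * 5 ^ n * (4 * (W * ∫⁻ x, ‖f x‖ₑ)) := by gcongr
        _ = _ := by ring
    calc _ ≤ t * (volume M₁ + volume M₂) := by
          gcongr; exact (measure_mono hcover).trans (measure_union_le _ _)
      _ = t * volume M₁ + t * volume M₂ := mul_add _ _ _
      _ ≤ _ := add_le_add hv1 hv2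
      _ = _ := by
        push_cast
        rw [ENNReal.coe_inv hε0]
        ring
  have hmono : Monotone fun m : ℕ => {x | ∃ k ≤ m, t < ‖conv (rieszTrunc Φ j k) f x‖ₑ} :=
    fun m m' h x ⟨k, hk, hx⟩ => ⟨k, hk.trans h, hx⟩
  have hU : {x | ∃ N, t < ‖conv (rieszTrunc Φ j N) f x‖ₑ} =
      ⋃ m : ℕ, {x | ∃ k ≤ m, t < ‖conv (rieszTrunc Φ j k) f x‖ₑ} := by
    ext x
    simp only [Set.mem_ofPred_eq, Set.mem_iUnion]
    exact ⟨fun ⟨N, h⟩ => ⟨N, N, le_rfl, h⟩, fun ⟨_, k, _, h⟩ => ⟨k, h⟩⟩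
  rw [hU, hmono.measure_iUnion, ENNReal.mul_iSup]
  exact iSup_le hSm

end PrincipalValue

/-! ### Almost everywhere existence of the principal value. -/

section PrincipalValueConvergence

variable {n : ℕ} {Φ : Eu n → ℝ}

/-- Convergence is known at every point for a dense class, and the weak type bound for the maximal
truncation shows that the oscillation set of `f` is controlled by the arbitrarily small norm of `f -
g`. -/
theorem ae_cauchySeq_conv_rieszTrunc_of_integrable (hn : 0 < n) (hΦ : IsRadialCutoff Φ) (j : Fin n)
    {f : Eu n → ℂ} (hf : Integrable f) :
    ∀ᵐ x, CauchySeq fun N => conv (rieszTrunc Φ j N) f x := by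
  obtain ⟨A, hA⟩ := exists_isCZKernel_rieszTrunc hΦ
  obtain ⟨C, hC⟩ := exists_maximal_truncation_weak_type hn hΦ
  -- Of the three units in the threshold, two pay for replacing `f` by `g` at `m` and at `m'`, and
  -- one for the Cauchy property of `g`.
  set E : ℕ → Set (Eu n) := fun k => {x | ∀ N, ∃ m ≥ N, ∃ m' ≥ N,
    3 * (k + 1 : ℝ≥0∞)⁻¹ ≤ edist (conv (rieszTrunc Φ j m) f x) (conv (rieszTrunc Φ j m') f x)}
    with hE
  have hE0 : ∀ k, volume (E k) = 0 := by
    intro k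
    set t : ℝ≥0∞ := (k + 1 : ℝ≥0∞)⁻¹ with ht
    have ht0 : t ≠ 0 := by simp [ht]
    have hmul : t * volume (E k) ≤ 0 := by
      refine ENNReal.le_of_forall_pos_le_add fun ε hε _ => ?_
      rw [zero_add]
      set η : ℝ≥0 := ε / (C + 1) with hη
      have hη0 : 0 < η := by positivity
      obtain ⟨g, hg1, hg2, hg3⟩ := (memLp_one_iff_integrable.2 hf).exist_eLpNorm_sub_le
        (by simp) le_rfl (NNReal.coe_pos.2 hη0)
      obtain ⟨L, hL⟩ := hg2.lipschitzWith_of_hasCompactSupport hg1 (by simp)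
      have hgl : LocallyIntegrable g volume := hL.continuous.locallyIntegrable
      have hsub : E k ⊆ {x | ∃ N, t < ‖conv (rieszTrunc Φ j N) (f - g) x‖ₑ} := by
        intro x hx
        by_contra hcon
        simp only [Set.mem_ofPred_eq, not_exists, not_lt] at hcon
        obtain ⟨N, hN⟩ := EMetric.cauchySeq_iff.1 (cauchySeq_conv_rieszTrunc (j := j) hΦ hL x) t
          (pos_iff_ne_zero.2 ht0)
        obtain ⟨m, hm, m', hm', h⟩ := hx N
        have hs : ∀ i, edist (conv (rieszTrunc Φ j i) f x) (conv (rieszTrunc Φ j i) g x) ≤ t := by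
          intro i
          rw [edist_eq_enorm_sub, ← (hA j i).conv_sub hf.locallyIntegrable hgl]
          exact hcon i
        have htt : t ≠ ∞ := by simp [ht]
        have := calc 3 * t ≤ _ := h
          _ ≤ edist (conv (rieszTrunc Φ j m) f x) (conv (rieszTrunc Φ j m) g x) +
              edist (conv (rieszTrunc Φ j m) g x) (conv (rieszTrunc Φ j m') g x) +
              edist (conv (rieszTrunc Φ j m') g x) (conv (rieszTrunc Φ j m') f x) :=
            edist_triangle4 _ _ _ _
          _ ≤ t + edist (conv (rieszTrunc Φ j m) g x) (conv (rieszTrunc Φ j m') g x) + t := by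
            gcongr
            · exact hs m
            · rw [edist_comm]; exact hs m'
          _ < t + t + t := by
            refine ENNReal.add_lt_add_right htt ?_
            exact ENNReal.add_lt_add_left htt (hN m hm m' hm')
          _ = 3 * t := by ring
        exact lt_irrefl _ this
      calc t * volume (E k) ≤ t * volume {x | ∃ N, t < ‖conv (rieszTrunc Φ j N) (f - g) x‖ₑ} := by
            gcongr
        _ ≤ C * ∫⁻ x, ‖(f - g) x‖ₑ := hC j _ (hf.locallyIntegrable.sub hgl) t
        _ ≤ C * η := by
            rw [← eLpNorm_one_eq_lintegral_enorm]
            gcongr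
            simpa using hg3
        _ ≤ ε := by
            have : C * η ≤ ε := by
              rw [hη, mul_div_assoc', div_le_iff₀ (by positivity), mul_comm]
              gcongr
              exact le_self_add
            exact_mod_cast this
    have h0 := le_antisymm hmul (by simp)
    exact (mul_eq_zero.1 h0).resolve_left ht0
  have : ∀ᵐ x, ∀ k, x ∉ E k := ae_all_iff.2 fun k => measure_eq_zero_iff_ae_notMem.1 (hE0 k)
  filter_upwards [this] with x hx
  refine EMetric.cauchySeq_iff.2 fun ε hε => ?_
  obtain ⟨k, hk⟩ := ENNReal.exists_inv_nat_lt (a := ε / 3) (by simpa using hε.ne')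
  have h := hx k
  simp only [hE, Set.mem_ofPred_eq, not_forall, not_exists, not_and, not_le] at h
  obtain ⟨N, hN⟩ := h
  refine ⟨N, fun m hm m' hm' => (hN m hm m' hm').trans_le ?_⟩
  calc 3 * (k + 1 : ℝ≥0∞)⁻¹ ≤ 3 * (ε / 3) := by
        gcongr
        exact (ENNReal.inv_le_inv.2 le_self_add).trans hk.le
    _ = ε := ENNReal.mul_div_cancel (by norm_num) (by norm_num)

theorem ae_cauchySeq_conv_rieszTrunc (hn : 0 < n) (hΦ : IsRadialCutoff Φ) (j : Fin n)
    {f : Eu n → ℂ} (hf : LocallyIntegrable f volume) :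
    ∀ᵐ x, CauchySeq fun N => conv (rieszTrunc Φ j N) f x := by
  obtain ⟨A, hA⟩ := exists_isCZKernel_rieszTrunc hΦ
  have h : ∀ R : ℕ, ∀ᵐ x, CauchySeq fun N =>
      conv (rieszTrunc Φ j N) ((Metric.closedBall 0 (R + 2 : ℝ)).indicator f) x := fun R =>
    ae_cauchySeq_conv_rieszTrunc_of_integrable hn hΦ j
      ((integrable_indicator_iff measurableSet_closedBall).2
        (hf.integrableOn_isCompact (isCompact_closedBall 0 _)))
  filter_upwards [ae_all_iff.2 h] with x hx
  obtain ⟨R, hR⟩ := exists_nat_ge ‖x‖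
  convert hx R using 2 with N
  refine (hA j N).conv_congr fun y hy => ?_
  rw [Set.indicator_of_mem]
  rw [mem_closedBall_zero_iff]
  calc ‖y‖ ≤ dist y x + ‖x‖ := by
        rw [dist_eq_norm]; simpa using norm_add_le (y - x) x
    _ ≤ R + 2 := by linarith

lemma measurable_rieszKernel (hΦ : IsRadialCutoff Φ) (j : Fin n) :
    Measurable (rieszKernel Φ j) := by
  have := hΦ.smooth.continuous
  unfold rieszKernel
  fun_prop

/-- The kernel `K_j` cut off at distance `ε`. -/
noncomputable def cutKernel (Φ : Eu n → ℝ) (j : Fin n) (ε : ℝ) : Eu n → ℝ :=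
  {z | ε < ‖z‖}.indicator (rieszKernel Φ j)

lemma measurableSet_lt_norm (ε : ℝ) : MeasurableSet {z : Eu n | ε < ‖z‖} :=
  measurableSet_lt measurable_const measurable_norm

lemma measurable_cutKernel (hΦ : IsRadialCutoff Φ) (j : Fin n) (ε : ℝ) :
    Measurable (cutKernel Φ j ε) :=
  (measurable_rieszKernel hΦ j).indicator (measurableSet_lt_norm ε)

lemma indicator_cutKernel (j : Fin n) (f : Eu n → ℂ) (ε : ℝ) (x : Eu n) :
    {y | ε < ‖x - y‖}.indicator (fun y => rieszKernel Φ j (x - y) • f y) =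
      fun y => cutKernel Φ j ε (x - y) • f y := by
  ext y
  by_cases hy : ε < ‖x - y‖ <;> simp [cutKernel, hy, Set.indicator]

lemma cutKernel_eq_zero (hΦ : IsRadialCutoff Φ) {j : Fin n} {ε : ℝ} {z : Eu n} (hz : 2 < ‖z‖) :
    cutKernel Φ j ε z = 0 := by
  rw [cutKernel, Set.indicator_apply_eq_zero]
  intro _
  rw [rieszKernel, hΦ.eq_zero hz, mul_zero]

lemma cutKernel_neg (hΦ : IsRadialCutoff Φ) {j : Fin n} {ε : ℝ} (z : Eu n) :
    cutKernel Φ j ε (-z) = -cutKernel Φ j ε z := by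
  by_cases hz : ε < ‖z‖
  · simp only [cutKernel, Set.indicator, Set.mem_ofPred_eq, norm_neg, hz, if_true, rieszKernel,
      hΦ.radial (-z) z (norm_neg z), PiLp.neg_apply]
    ring
  · simp [cutKernel, Set.indicator, hz]

lemma abs_cutKernel_le {S : ℝ≥0} (hΦ : IsRadialCutoff Φ) (hS : ∀ z, Φ z ≤ S) {j : Fin n} {ε R : ℝ}
    (hR : 0 < R) (hε : 1 ≤ R * ε) (z : Eu n) : |cutKernel Φ j ε z| ≤ S * R ^ n := by
  by_cases hz : ε < ‖z‖
  · rw [cutKernel, Set.indicator_of_mem (by exact hz)]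
    exact abs_le_of_mul_norm_pow_le hR (abs_rieszKernel_mul_le hΦ hS z) (hε.trans (by gcongr))
  · rw [cutKernel, Set.indicator_of_notMem (by exact hz), abs_zero]
    positivity

lemma integrable_cutKernel_smul (hΦ : IsRadialCutoff Φ) (j : Fin n) {f : Eu n → ℂ}
    (hf : LocallyIntegrable f volume) {ε : ℝ} (hε : 0 < ε) (x : Eu n) :
    Integrable fun y => cutKernel Φ j ε (x - y) • f y := by
  obtain ⟨S, hS⟩ := hΦ.exists_bound
  exact integrable_bounded_kernel (measurable_cutKernel hΦ j ε)
    (abs_cutKernel_le hΦ hS (inv_pos.2 hε) (inv_mul_cancel₀ hε.ne').ge)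
    (fun z hz => cutKernel_eq_zero hΦ hz) hf x

lemma rieszCut_eq (j : Fin n) (f : Eu n → ℂ) (ε : ℝ) (x : Eu n) :
    rieszCut Φ j f ε x = ∫ y, cutKernel Φ j ε (x - y) • f y := by
  rw [rieszCut, ← indicator_cutKernel, integral_indicator]
  exact measurableSet_lt measurable_const (by fun_prop)

/-- For `ε` comparable to `2 ^ (-N)`, the sharp and the smooth truncation differ by an odd kernel of
size `2 ^ (N * n)` supported at scale `2 ^ (-N)`. Its action is bounded by a mean oscillation of
`f`, which vanishes in the limit at Lebesgue points. -/
lemma enorm_rieszCut_sub_conv_le {S A : ℝ≥0} (hΦ : IsRadialCutoff Φ) (hS : ∀ z, Φ z ≤ S)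
    {j : Fin n} {N : ℕ} (hA : IsCZKernel A (rieszTrunc Φ j N)) {f : Eu n → ℂ}
    (hf : LocallyIntegrable f volume) {ε : ℝ} (hε : 0 < ε) (h1 : 2 ^ N ≤ ε⁻¹)
    (h2 : ε⁻¹ < 2 ^ (N + 1)) (x : Eu n) :
    ‖rieszCut Φ j f ε x - conv (rieszTrunc Φ j N) f x‖ₑ ≤ (S + A) * 4 ^ n * ballVol n *
      ((∫⁻ y in Metric.closedBall x (2 * (2 ^ N : ℝ)⁻¹), ‖f y - f x‖ₑ) /
        volume (Metric.closedBall x (2 * (2 ^ N : ℝ)⁻¹))) := by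
  have hN : (0 : ℝ) < 2 ^ N := by positivity
  rw [le_inv_comm₀ hN hε] at h1
  rw [inv_lt_iff_one_lt_mul₀ hε, pow_succ] at h2
  set D : Eu n → ℝ := fun z => cutKernel Φ j ε z - rieszTrunc Φ j N z with hD
  have hDm : Measurable D := (measurable_cutKernel hΦ j ε).sub hA.cont.measurable
  have hDM : ∀ z, |D z| ≤ (((S + A) * (2 * 2 ^ N) ^ n : ℝ≥0) : ℝ) := by
    intro z
    push_cast
    have h3 : (0 : ℝ) ≤ A * (2 * 2 ^ N) ^ n := by positivity
    have h4 := abs_cutKernel_le (j := j) (ε := ε) hΦ hS (R := 2 * 2 ^ N) (by positivity) (by linarith) z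
    have h5 : |rieszTrunc Φ j N z| ≤ A * (2 * 2 ^ N) ^ n := by
      rcases lt_or_ge (2 * 2 ^ N * ‖z‖) 1 with hz | hz
      · rw [rieszTrunc_eq_zero_of_lt hΦ N (by nlinarith [norm_nonneg z]), abs_zero]
        exact h3
      · exact abs_le_of_mul_norm_pow_le (by positivity) (hA.size z) hz
    exact (abs_sub _ _).trans (by linarith)
  have hDr : ∀ z, 2 * (2 ^ N : ℝ)⁻¹ < ‖z‖ → D z = 0 := by
    intro z hz
    have h6 : ε < ‖z‖ := by linarith [inv_pos.2 hN]
    rw [← div_eq_mul_inv, div_lt_iff₀ hN] at hz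
    simp only [hD]
    rw [rieszTrunc_eq_rieszKernel hΦ N (by linarith), cutKernel,
      Set.indicator_of_mem (by exact h6), sub_self]
  have hDo : ∀ z, D (-z) = -D z := fun z => by
    simp only [hD, rieszTrunc_neg hΦ, cutKernel_neg hΦ]; ring
  have e : rieszCut Φ j f ε x - conv (rieszTrunc Φ j N) f x = ∫ y, D (x - y) • f y := by
    rw [rieszCut_eq, conv, ← integral_sub (integrable_cutKernel_smul hΦ j hf hε x)
      (hA.integrable hf x)]
    simp only [hD, sub_smul]
  rw [e]
  refine (enorm_integral_odd_kernel_le hDm hDM hDr hDo hf x).trans (le_of_eq ?_)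
  have hr : (0 : ℝ) < 2 * (2 ^ N : ℝ)⁻¹ := by positivity
  have : Nonempty (Fin n) := ⟨j⟩
  have hv : volume (Metric.closedBall x (2 * (2 ^ N : ℝ)⁻¹)) =
      ballVol n * ENNReal.ofReal (2 * (2 ^ N : ℝ)⁻¹) ^ n := by
    rw [Measure.addHaar_closedBall_eq_addHaar_ball, volume_ball_eq x hr]
  have hv0 : volume (Metric.closedBall x (2 * (2 ^ N : ℝ)⁻¹)) ≠ 0 :=
    (Metric.measure_closedBall_pos volume x hr).ne'
  have hv1 : volume (Metric.closedBall x (2 * (2 ^ N : ℝ)⁻¹)) ≠ ∞ := measure_closedBall_lt_top.ne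
  have e3 : (((S + A) * (2 * 2 ^ N) ^ n : ℝ≥0) : ℝ≥0∞) =
      (S + A) * 4 ^ n * ballVol n / volume (Metric.closedBall x (2 * (2 ^ N : ℝ)⁻¹)) := by
    rw [ENNReal.eq_div_iff hv0 hv1, hv, ENNReal.ofReal_mul (by norm_num),
      ENNReal.ofReal_inv_of_pos hN, ENNReal.ofReal_pow (by norm_num)]
    push_cast
    simp only [ENNReal.ofReal_ofNat]
    have h7 : ((2 : ℝ≥0∞) ^ N)⁻¹ * 2 ^ N = 1 := ENNReal.inv_mul_cancel (by simp) (by simp)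
    calc ballVol n * (2 * ((2 : ℝ≥0∞) ^ N)⁻¹) ^ n * ((S + A) * (2 * 2 ^ N) ^ n)
        = (S + A) * (4 * (((2 : ℝ≥0∞) ^ N)⁻¹ * 2 ^ N)) ^ n * ballVol n := by
          rw [show (4 : ℝ≥0∞) = 2 * 2 by norm_num]
          simp only [mul_pow]
          ring
      _ = _ := by rw [h7, mul_one]
  rw [e3, ENNReal.mul_comm_div]

theorem tendsto_rieszCut (hΦ : IsRadialCutoff Φ) {j : Fin n} {f : Eu n → ℂ}
    (hf : LocallyIntegrable f volume) {x : Eu n} (hx : Tendsto (fun r : ℝ =>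
      (∫⁻ y in Metric.closedBall x r, ‖f y - f x‖ₑ) / volume (Metric.closedBall x r))
      (𝓝[>] 0) (𝓝 0)) {l : ℂ} (hl : Tendsto (fun N => conv (rieszTrunc Φ j N) f x) atTop (𝓝 l)) :
    Tendsto (fun ε : ℝ => rieszCut Φ j f ε x) (𝓝[>] 0) (𝓝 l) := by
  obtain ⟨A, hA⟩ := exists_isCZKernel_rieszTrunc hΦ
  obtain ⟨S, hS⟩ := hΦ.exists_bound
  have hr : Tendsto (fun N : ℕ => 2 * (2 ^ N : ℝ)⁻¹) atTop (𝓝[>] 0) := by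
    refine tendsto_nhdsWithin_iff.2 ⟨?_, Eventually.of_forall fun N => ?_⟩
    · have h := (tendsto_pow_atTop_nhds_zero_of_lt_one (r := (2 : ℝ)⁻¹) (by norm_num)
        (by norm_num)).const_mul 2
      simpa [inv_pow] using h
    · rw [Set.mem_Ioi]; positivity
  have h1 : Tendsto (fun N : ℕ => (S + A) * 4 ^ n * ballVol n *
      ((∫⁻ y in Metric.closedBall x (2 * (2 ^ N : ℝ)⁻¹), ‖f y - f x‖ₑ) /
        volume (Metric.closedBall x (2 * (2 ^ N : ℝ)⁻¹))) +
      ‖conv (rieszTrunc Φ j N) f x - l‖ₑ) atTop (𝓝 0) := by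
    have h2 := ENNReal.Tendsto.const_mul (a := (S + A) * 4 ^ n * ballVol n) (hx.comp hr)
      (Or.inr (by finiteness))
    have h3 := tendsto_iff_edist_tendsto_0.1 hl
    simp only [edist_eq_enorm_sub] at h3
    simpa using h2.add h3
  refine EMetric.tendsto_nhds.2 fun δ hδ => ?_
  obtain ⟨N₀, hN₀⟩ := eventually_atTop.1 (h1.eventually_lt_const hδ)
  have h4 : Set.Ioo (0 : ℝ) ((2 : ℝ) ^ N₀)⁻¹ ∈ 𝓝[>] (0 : ℝ) :=
    Ioo_mem_nhdsGT (by positivity)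
  filter_upwards [h4] with ε hε
  have h5 : (2 : ℝ) ^ N₀ < ε⁻¹ := (lt_inv_comm₀ hε.1 (by positivity)).1 hε.2
  have h5' : (1 : ℝ) ≤ 2 ^ N₀ := one_le_pow₀ (by norm_num)
  -- Each `ε` is paired with the `N` of its own dyadic scale, which is at least `N₀` once `ε < 2 ^
  -- (-N₀)`.
  obtain ⟨N, hN1, hN2⟩ := exists_nat_pow_near (h5'.trans h5.le) one_lt_two
  have h6 : N₀ ≤ N := by
    have := (pow_lt_pow_iff_right₀ (one_lt_two (α := ℝ))).1 (h5.trans hN2)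
    omega
  refine lt_of_le_of_lt ?_ (hN₀ N h6)
  rw [edist_eq_enorm_sub]
  calc _ = ‖(rieszCut Φ j f ε x - conv (rieszTrunc Φ j N) f x) +
        (conv (rieszTrunc Φ j N) f x - l)‖ₑ := by congr 1; ring
    _ ≤ _ := (enorm_add_le _ _).trans (add_le_add
        (enorm_rieszCut_sub_conv_le hΦ hS (hA j N) hf hε.1 hN1 hN2 x) le_rfl)

/-- The principal value exists almost everywhere and is the limit of the smooth truncations. -/
theorem ae_rieszExistsAt_and_tendsto (hn : 0 < n) (hΦ : IsRadialCutoff Φ) (j : Fin n)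
    {f : Eu n → ℂ} (hf : LocallyIntegrable f volume) :
    ∀ᵐ x, RieszExistsAt Φ j f x ∧
      Tendsto (fun N => conv (rieszTrunc Φ j N) f x) atTop (𝓝 (truncRiesz Φ j f x)) := by
  filter_upwards [ae_cauchySeq_conv_rieszTrunc hn hΦ j hf, ae_tendsto_lintegral_enorm_sub_div hf]
    with x hx1 hx2
  obtain ⟨l, hl⟩ := cauchySeq_tendsto_of_complete hx1
  have h := tendsto_rieszCut hΦ hf hx2 hl
  refine ⟨⟨fun ε hε => ?_, l, h⟩, ?_⟩
  · rw [← integrable_indicator_iff (measurableSet_lt measurable_const (by fun_prop)),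
      indicator_cutKernel]
    exact integrable_cutKernel_smul hΦ j hf hε x
  · rwa [truncRiesz, h.limUnder_eq]

lemma aestronglyMeasurable_truncRiesz (hn : 0 < n) (hΦ : IsRadialCutoff Φ) (j : Fin n)
    {f : Eu n → ℂ} (hf : LocallyIntegrable f volume) :
    AEStronglyMeasurable (truncRiesz Φ j f) volume := by
  obtain ⟨A, hA⟩ := exists_isCZKernel_rieszTrunc hΦ
  exact aestronglyMeasurable_of_tendsto_ae atTop
    (fun N => ((hA j N).continuous_conv hf).aestronglyMeasurable)
    ((ae_rieszExistsAt_and_tendsto hn hΦ j hf).mono fun x hx => hx.2)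

end PrincipalValueConvergence

/-! ### The stopping-time step of the sparse domination. -/

section SparseStep

variable {n : ℕ} {A W : ℝ≥0} {K : Eu n → ℝ}

/-- A ball surrounding the cube `cell ℓ m`. -/
def cellBall (ℓ : ℝ) (m : Fin n → ℤ) : Set (Eu n) := Metric.ball (cellCenter ℓ m) (8 * n * ℓ)

lemma measurableSet_cellBall (ℓ : ℝ) (m : Fin n → ℤ) : MeasurableSet (cellBall ℓ m) :=
  measurableSet_ball

lemma cell_subset_cellBall (hn : 0 < n) {ℓ : ℝ} (hℓ : 0 < ℓ) (m : Fin n → ℤ) :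
    cell ℓ m ⊆ cellBall ℓ m := by
  have hn' : (0 : ℝ) < n := by exact_mod_cast hn
  exact cell_subset_ball_center hn hℓ m (by nlinarith [mul_pos hn' hℓ])

lemma volume_cellBall (hn : 0 < n) {ℓ : ℝ} (hℓ : 0 < ℓ) (m : Fin n → ℤ) :
    volume (cellBall ℓ m) = ballVol n * (8 * n) ^ n * volume (cell ℓ m) := by
  have hn' : (0 : ℝ) < n := by exact_mod_cast hn
  rw [cellBall, volume_ball_eq _ (by positivity), volume_cell hℓ, ENNReal.ofReal_mul (by positivity),
    mul_pow, ENNReal.ofReal_mul (by norm_num), ENNReal.ofReal_natCast]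
  simp only [ENNReal.ofReal_ofNat]
  ring

lemma cellBall_subset_cellBall {ℓ ρ : ℝ} (hℓ : 0 < ℓ) (hρ : 0 < ρ)
    (hle : 2 * ρ ≤ ℓ) {m m' : Fin n → ℤ} (hsub : cell ρ m' ⊆ cell ℓ m) :
    cellBall ρ m' ⊆ cellBall ℓ m := by
  have h := dist_cellCenter_le hℓ (hsub (cell_nonempty hρ m'))
  refine Metric.ball_subset_ball' ?_
  have hn' : (0 : ℝ) ≤ n := by positivity
  nlinarith [mul_nonneg hn' (by linarith : 0 ≤ ℓ - 2 * ρ), mul_nonneg hn' hℓ.le]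

/-- On a cube which is not filled by the exceptional set at level `t`, the convolution is
controlled by `t` and its localisation. -/
theorem IsCZKernel.enorm_conv_le_on_cell (hK : IsCZKernel A K) (hn : 0 < n)
    (hW : ∀ f : Eu n → ℂ, LocallyIntegrable f volume → ∀ t : ℝ≥0∞,
      t * volume {x | t < ‖conv K f x‖ₑ} ≤ W * ∫⁻ x, ‖f x‖ₑ)
    {F : Eu n → ℂ} (hF : LocallyIntegrable F volume) {t : ℝ≥0∞} (ht0 : t ≠ 0) (ht : t ≠ ∞)
    {ρ : ℝ} (hρ : 0 < ρ) {m : Fin n → ℤ}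
    (hE : volume (cell ρ m ∩ ({x | t < ‖conv K F x‖ₑ} ∪
      ⋃ R : ℕ, maxSet volume (fun y => ‖F y‖ₑ) t R)) ≤ 2⁻¹ * volume (cell ρ m))
    {x : Eu n} (hx : x ∈ cell ρ m) :
    ‖conv K F x‖ₑ ≤ (1 + (4 * W * (ballVol n * (8 * n) ^ n) + 1) + A * 2 ^ (n + 2) * ballVol n) * t +
      ‖conv K ((cellBall ρ m).indicator F) x‖ₑ := by
  have hn' : (0 : ℝ) < n := by exact_mod_cast hn
  set E := {x | t < ‖conv K F x‖ₑ} ∪ ⋃ R : ℕ, maxSet volume (fun y => ‖F y‖ₑ) t R with hEdef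
  set V : ℝ≥0∞ := ballVol n * (8 * n) ^ n with hV
  have hVt : V ≠ ∞ := by simp [hV, ENNReal.mul_eq_top]
  -- By weak type, the set where the convolution of `f₁` exceeds `L * t` has at most a quarter of
  -- the volume of the cube. With at most half lost to `E`, a good point `z` remains. The added 1
  -- keeps the level nonzero.
  set L : ℝ≥0∞ := 4 * W * V + 1 with hL
  have hLt : L ≠ ∞ := by finiteness
  set f₁ := (cellBall ρ m).indicator F with hf₁
  set f₂ := (cellBall ρ m)ᶜ.indicator F with hf₂
  have hl1 : LocallyIntegrable f₁ volume := hF.indicator (measurableSet_cellBall _ _)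
  have hl2 : LocallyIntegrable f₂ volume := hF.indicator (measurableSet_cellBall _ _).compl
  have hQ0 := volume_cell_ne_zero hρ m
  have hQt := volume_cell_ne_top hρ m
  have havg : ∀ z ∈ cell ρ m, z ∉ E → ∀ r, n * ρ ≤ r → ∫⁻ y in Metric.ball (cellCenter ρ m) r,
      ‖F y‖ₑ ≤ t * (ballVol n * ENNReal.ofReal r ^ n) := by
    intro z hz hzE r hr
    have hr0 : 0 < r := lt_of_lt_of_le (by positivity) hr
    have := setLIntegral_le_of_notMem_iUnion_maxSet (fun h => hzE (Or.inr h)) hr0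
      (cell_subset_ball_center hn hρ m hr hz)
    rwa [volume_ball_eq _ hr0] at this
  obtain ⟨z₀, hz₀, hz₀E⟩ : ∃ z ∈ cell ρ m, z ∉ E := by
    obtain ⟨z, hz, hzE, -⟩ := exists_mem_ball_notMem (μ := volume) (B := cell ρ m) (S := E)
      (T := ∅) (by
        rw [Set.inter_empty, measure_empty, add_zero]
        refine hE.trans_lt ?_
        calc _ < 1 * volume (cell ρ m) :=
              (ENNReal.mul_lt_mul_iff_left hQ0 hQt).2 (by simp)
          _ = _ := one_mul _)
    exact ⟨z, hz, hzE⟩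
  have hf1n : ∫⁻ y, ‖f₁ y‖ₑ ≤ t * (V * volume (cell ρ m)) := by
    simp only [hf₁, enorm_indicator_eq_indicator_enorm]
    rw [lintegral_indicator (measurableSet_cellBall _ _), hV, ← volume_cellBall hn hρ m, cellBall,
      volume_ball_eq _ (by positivity)]
    exact havg z₀ hz₀ hz₀E _ (by nlinarith [mul_pos hn' hρ])
  obtain ⟨z, hz, hz1, hz2⟩ : ∃ z ∈ cell ρ m, z ∉ E ∧ z ∉ {z | L * t < ‖conv K f₁ z‖ₑ} := by
    refine exists_mem_ball_notMem (μ := volume) ?_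
    have h6 : volume {z | L * t < ‖conv K f₁ z‖ₑ} ≤ 4⁻¹ * volume (cell ρ m) := by
      have hLt0 : L * t ≠ 0 := mul_ne_zero (by simp [hL]) ht0
      refine (ENNReal.mul_le_mul_iff_right (a := L * t) hLt0 (by finiteness)).1 ?_
      calc _ ≤ W * ∫⁻ x, ‖f₁ x‖ₑ := hW f₁ hl1 (L * t)
        _ ≤ W * (t * (V * volume (cell ρ m))) := by gcongr
        _ = (4 * 4⁻¹) * (W * V) * t * volume (cell ρ m) := by
          rw [ENNReal.mul_inv_cancel (by norm_num) (by norm_num)]; ring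
        _ = (4 * W * V) * t * (4⁻¹ * volume (cell ρ m)) := by ring
        _ ≤ L * t * (4⁻¹ * volume (cell ρ m)) := by
          gcongr
          exact le_self_add
    calc _ ≤ 2⁻¹ * volume (cell ρ m) + 4⁻¹ * volume (cell ρ m) :=
          add_le_add hE ((measure_mono Set.inter_subset_right).trans h6)
      _ = (2⁻¹ + 4⁻¹) * volume (cell ρ m) := by ring
      _ < 1 * volume (cell ρ m) := by
          refine (ENNReal.mul_lt_mul_iff_left hQ0 hQt).2 ?_
          rw [← ENNReal.toReal_lt_toReal (by finiteness) (by finiteness),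
            ENNReal.toReal_add (by finiteness) (by finiteness)]
          norm_num
      _ = _ := one_mul _
  have hdist : ∀ y ∈ cell ρ m, dist y (cellCenter ρ m) ≤ 4 * n * ρ := fun y hy =>
    (dist_cellCenter_le hρ hy).trans (by nlinarith [mul_pos hn' hρ])
  have hosc : ‖conv K f₂ x - conv K f₂ z‖ₑ ≤ A * 2 ^ (n + 2) * (t * ballVol n) := by
    refine hK.enorm_conv_sub_le hl2 (c := cellCenter ρ m) (ρ := 4 * n * ρ) (by positivity)
      (hdist x hx) (hdist z hz) (fun y hy => ?_) fun r hr => ?_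
    · have : y ∈ cellBall ρ m := by rw [cellBall]; convert hy using 2; ring
      simp [hf₂, this]
    · calc _ ≤ ∫⁻ y in Metric.ball (cellCenter ρ m) r, ‖F y‖ₑ := by
            refine lintegral_mono fun y => ?_
            simp only [hf₂, enorm_indicator_eq_indicator_enorm]
            exact Set.indicator_le_self _ _ _
        _ ≤ _ := (havg z₀ hz₀ hz₀E r (by nlinarith [mul_pos hn' hρ])).trans_eq (by ring)
  have hG' : ‖conv K F z‖ₑ ≤ t := not_lt.1 fun h => hz1 (Or.inl h)
  have hG'' : ‖conv K f₁ z‖ₑ ≤ L * t := not_lt.1 hz2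
  have hadd := hK.conv_indicator_add hF (measurableSet_cellBall ρ m)
  have hsplit : conv K F x = ((conv K f₂ x - conv K f₂ z) + (conv K F z - conv K f₁ z)) +
      conv K f₁ x := by
    rw [hadd x, hadd z]; ring
  rw [hsplit]
  calc _ ≤ (A * 2 ^ (n + 2) * (t * ballVol n) + (t + L * t)) + ‖conv K f₁ x‖ₑ :=
        (enorm_add_le _ _).trans (add_le_add ((enorm_add_le _ _).trans
          (add_le_add hosc (_root_.enorm_sub_le.trans (add_le_add hG' hG'')))) le_rfl)
    _ = _ := by ring

lemma mul_measure_biUnion_le {X ι : Type*} [MeasurableSpace X] {μ ν : Measure X} {S : Set ι}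
    (hS : S.Countable) {s : ι → Set X} (hd : S.PairwiseDisjoint s)
    (hs : ∀ i ∈ S, MeasurableSet (s i)) {t : ℝ≥0∞} (h : ∀ i ∈ S, t * μ (s i) ≤ ν (s i)) :
    t * μ (⋃ i ∈ S, s i) ≤ ν (⋃ i ∈ S, s i) := by
  rw [measure_biUnion hS hd hs, measure_biUnion hS hd hs, ← ENNReal.tsum_mul_left]
  exact ENNReal.tsum_le_tsum fun i => h i.1 i.2

set_option maxHeartbeats 400000 in
/-- One step of the sparse domination: off subcubes of small total measure the localised operator
is controlled by the average of the function, on each subcube by this average and the operator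
localised there. -/
theorem exists_sparse_step (hn : 0 < n) (A W : ℝ≥0) : ∃ C : ℝ≥0, ∀ K : Eu n → ℝ,
    IsCZKernel A K → (∀ f : Eu n → ℂ, LocallyIntegrable f volume → ∀ t : ℝ≥0∞,
      t * volume {x | t < ‖conv K f x‖ₑ} ≤ W * ∫⁻ x, ‖f x‖ₑ) →
    ∀ f : Eu n → ℂ, LocallyIntegrable f volume → ∀ ℓ : ℝ, 0 < ℓ → ∀ m : Fin n → ℤ,
    ∃ S : Set (ℕ × (Fin n → ℤ)), S.PairwiseDisjoint (dyadic ℓ) ∧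
      (∀ q ∈ S, dyadic ℓ q ⊆ cell ℓ m) ∧
      2 * volume (⋃ q ∈ S, dyadic ℓ q) ≤ volume (cell ℓ m) ∧
      (∀ᵐ x, x ∈ cell ℓ m \ ⋃ q ∈ S, dyadic ℓ q →
        ‖conv K ((cellBall ℓ m).indicator f) x‖ₑ ≤
          C * ((∫⁻ y in cellBall ℓ m, ‖f y‖ₑ) / volume (cell ℓ m))) ∧
      ∀ q ∈ S, ∀ x ∈ dyadic ℓ q, ‖conv K ((cellBall ℓ m).indicator f) x‖ₑ ≤
          C * ((∫⁻ y in cellBall ℓ m, ‖f y‖ₑ) / volume (cell ℓ m)) +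
          ‖conv K ((cellBall (ℓ / 2 ^ q.1) q.2).indicator f) x‖ₑ := by
  -- At height `L * a` the two weak type bounds leave an exceptional set of volume at most `2 ^ (-(n
  -- + 2))` times that of the cube.
  set L : ℝ≥0 := (W + 5 ^ n) * (2 ^ (n + 2)) with hL
  have hL0 : L ≠ 0 := by positivity
  set C₀ : ℝ≥0 := 1 + (4 * W * (ballVol n * (8 * n) ^ n) + 1) + A * 2 ^ (n + 2) * ballVol n with hC₀
  have hC1 : 1 ≤ C₀ := by rw [hC₀, add_assoc]; exact le_self_add
  refine ⟨C₀ * L, fun K hK hW f hf ℓ hℓ m => ?_⟩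
  have hQ0 := volume_cell_ne_zero hℓ m
  have hQt := volume_cell_ne_top hℓ m
  set F := (cellBall ℓ m).indicator f with hFdef
  have hF : LocallyIntegrable F volume := hf.indicator (measurableSet_cellBall _ _)
  set a : ℝ≥0∞ := (∫⁻ y in cellBall ℓ m, ‖f y‖ₑ) / volume (cell ℓ m) with ha
  have hint : ∫⁻ y in cellBall ℓ m, ‖f y‖ₑ ≠ ∞ := by
    have h1 : IntegrableOn f (cellBall ℓ m) :=
      (hf.integrableOn_isCompact (isCompact_closedBall _ _)).mono_set Metric.ball_subset_closedBall
    exact h1.2.ne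
  have hat : a ≠ ∞ := ENNReal.div_ne_top hint hQ0
  have haQ : a * volume (cell ℓ m) = ∫⁻ y, ‖F y‖ₑ := by
    rw [ha, ENNReal.div_mul_cancel hQ0 hQt, ← lintegral_indicator (measurableSet_cellBall _ _)]
    simp only [hFdef, enorm_indicator_eq_indicator_enorm]
  rcases eq_or_ne a 0 with ha0 | ha0
  · refine ⟨∅, Set.pairwiseDisjoint_empty, by simp, by simp, Eventually.of_forall fun x _ => ?_,
      by simp⟩
    have h0 : ∫⁻ y, ‖F y‖ₑ = 0 := by rw [← haQ, ha0, zero_mul]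
    have h1 : F =ᵐ[volume] 0 := by
      have := (lintegral_eq_zero_iff' hF.aestronglyMeasurable.enorm).1 h0
      filter_upwards [this] with y hy
      simpa using hy
    rw [conv_congr_ae h1]
    simp [conv]
  set t : ℝ≥0∞ := L * a with htdef
  have ht0 : t ≠ 0 := mul_ne_zero (by exact_mod_cast hL0) ha0
  have ht : t ≠ ∞ := by finiteness
  set E₁ := {x | t < ‖conv K F x‖ₑ} with hE₁
  set E₂ := ⋃ R : ℕ, maxSet volume (fun y => ‖F y‖ₑ) t R with hE₂
  have hE₁m : MeasurableSet E₁ :=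
    measurableSet_lt measurable_const (hK.continuous_conv hF).measurable.enorm
  have hE₂m : MeasurableSet E₂ := .iUnion fun R => (isOpen_maxSet _ _ _ _).measurableSet
  have hEm : MeasurableSet (E₁ ∪ E₂) := hE₁m.union hE₂m
  -- Cubes where the exceptional set has density above `τ` have total volume at most half of the
  -- cube, while maximality caps the density at `2 ^ n * τ = 1 / 2`, as `enorm_conv_le_on_cell`
  -- requires.
  set τ : ℝ≥0∞ := (2 ^ (n + 1))⁻¹ with hτ
  have hτ0 : τ ≠ 0 := by simp [hτ]
  have hτt : τ ≠ ∞ := by simp [hτ]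
  have hvolE : 2 * volume (E₁ ∪ E₂) ≤ τ * volume (cell ℓ m) := by
    refine (ENNReal.mul_le_mul_iff_right ht0 ht).1 ?_
    calc t * (2 * volume (E₁ ∪ E₂)) ≤ t * (2 * (volume E₁ + volume E₂)) := by
          gcongr; exact measure_union_le _ _
      _ = 2 * (t * volume E₁ + t * volume E₂) := by ring
      _ ≤ 2 * (W * (∫⁻ y, ‖F y‖ₑ) + 5 ^ n * ∫⁻ y, ‖F y‖ₑ) := by
          exact mul_le_mul_right (add_le_add (hW F hF t) (volume_maxSet_le (fun y => ‖F y‖ₑ) t)) _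
      _ = 2 * (W + 5 ^ n) * a * volume (cell ℓ m) * (2 ^ (n + 1) * τ) := by
          rw [hτ, ENNReal.mul_inv_cancel (by simp) (by simp), ← haQ]
          ring
      _ = t * (τ * volume (cell ℓ m)) := by
          rw [htdef, hL]
          push_cast
          ring
  obtain ⟨S₀, hdisj, hlow, hup, hcov⟩ :=
    exists_stopping_cubes (volume.restrict (E₁ ∪ E₂)) τ hℓ
  have hpos : ∀ k : ℕ, 0 < ℓ / 2 ^ k := fun k => by positivity
  set S : Set (ℕ × (Fin n → ℤ)) := {q ∈ S₀ | dyadic ℓ q ⊆ cell ℓ m} with hS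
  have hSdisj : S.PairwiseDisjoint (dyadic ℓ) := hdisj.subset fun q hq => hq.1
  have hmeas : ∀ q : ℕ × (Fin n → ℤ), MeasurableSet (dyadic ℓ q) := fun q => measurableSet_cell _ _
  have hcovQ : ∀ x ∈ cell ℓ m, x ∈ ⋃ q ∈ S₀, dyadic ℓ q → x ∈ ⋃ q ∈ S, dyadic ℓ q := by
    intro x hx hxU
    simp only [Set.mem_iUnion, exists_prop] at hxU ⊢
    obtain ⟨q, hq, hxq⟩ := hxU
    refine ⟨q, ⟨hq, fun y hy => ?_⟩, hxq⟩
    have h := cellIdx_eq_of_le (s := ℓ) (Nat.zero_le q.1) (hy.trans hxq.symm)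
    rw [pow_zero, div_one] at h
    exact h.trans hx
  have hlow' : ∀ q ∈ S, τ * volume (dyadic ℓ q) ≤ volume.restrict (E₁ ∪ E₂) (dyadic ℓ q) :=
    fun q hq => (hlow q hq.1).le
  have hsum : τ * volume (⋃ q ∈ S, dyadic ℓ q) ≤ volume (E₁ ∪ E₂) := by
    calc τ * volume (⋃ q ∈ S, dyadic ℓ q) ≤ volume.restrict (E₁ ∪ E₂) (⋃ q ∈ S, dyadic ℓ q) :=
          mul_measure_biUnion_le S.to_countable hSdisj (fun q _ => hmeas q) hlow'
      _ ≤ volume.restrict (E₁ ∪ E₂) Set.univ := measure_mono (Set.subset_univ _)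
      _ = _ := by simp
  have hhalf : 2 * volume (⋃ q ∈ S, dyadic ℓ q) ≤ volume (cell ℓ m) := by
    refine (ENNReal.mul_le_mul_iff_right hτ0 hτt).1 ?_
    calc τ * (2 * volume (⋃ q ∈ S, dyadic ℓ q)) = 2 * (τ * volume (⋃ q ∈ S, dyadic ℓ q)) := by ring
      _ ≤ 2 * volume (E₁ ∪ E₂) := by gcongr
      _ ≤ _ := hvolE
  -- The cube itself is too thinly met by the exceptional set to be selected. Hence each selected
  -- cube has a parent and at most half the side.
  have hlevel : ∀ q ∈ S, q.1 ≠ 0 := by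
    intro q hq h0
    have h1 : volume (dyadic ℓ q) = volume (cell ℓ m) := by
      rw [volume_cell (hpos _), volume_cell hℓ, h0, pow_zero, div_one]
    have h2 := hlow q hq.1
    rw [h1] at h2
    have h3 : volume.restrict (E₁ ∪ E₂) (dyadic ℓ q) ≤ τ * volume (cell ℓ m) :=
      calc _ ≤ volume.restrict (E₁ ∪ E₂) Set.univ := measure_mono (Set.subset_univ _)
        _ = volume (E₁ ∪ E₂) := by simp
        _ ≤ 2 * volume (E₁ ∪ E₂) := le_mul_of_one_le_left zero_le (by norm_num)
        _ ≤ _ := hvolE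
    exact absurd h2 (not_lt.2 h3)
  refine ⟨S, hSdisj, fun q hq => hq.2, hhalf, ?_, fun q hq x hx => ?_⟩
  · have hind : LocallyIntegrable ((E₁ ∪ E₂).indicator fun _ => (1 : ℝ)) volume :=
      (continuous_const.locallyIntegrable).indicator hEm
    filter_upwards [ae_enorm_le_of_dyadic_averages_le hn hind hℓ] with x hx hxQ
    have h1 : ‖(E₁ ∪ E₂).indicator (fun _ => (1 : ℝ)) x‖ₑ ≤ τ := by
      refine hx τ fun k => ?_
      simp only [enorm_indicator_eq_indicator_enorm, enorm_one]
      rw [lintegral_indicator hEm, setLIntegral_one, Measure.restrict_apply hEm, Set.inter_comm,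
        ← Measure.restrict_apply (measurableSet_cell _ _)]
      by_contra! hcon
      exact hxQ.2 (hcovQ x hxQ.1 (hcov x k hcon))
    have h2 : x ∉ E₁ ∪ E₂ := by
      intro hxE
      rw [Set.indicator_of_mem hxE, enorm_one] at h1
      refine absurd h1 (not_le.2 ?_)
      rw [hτ, ENNReal.inv_lt_one]
      exact one_lt_pow₀ (by norm_num) (by omega)
    have h3 : ‖conv K F x‖ₑ ≤ t := not_lt.1 fun h => h2 (Or.inl h)
    refine h3.trans ?_
    rw [htdef]
    push_cast
    gcongr
    exact le_mul_of_one_le_left zero_le (by exact_mod_cast hC1)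
  · have hk := hlevel q hq
    have hle : 2 * (ℓ / 2 ^ q.1) ≤ ℓ := by
      have : (2 : ℝ) ≤ 2 ^ q.1 := le_self_pow₀ (by norm_num) hk
      rw [← mul_div_assoc, div_le_iff₀ (by positivity)]
      nlinarith
    have h1 : volume (dyadic ℓ q ∩ (E₁ ∪ E₂)) ≤ 2⁻¹ * volume (dyadic ℓ q) := by
      rw [← Measure.restrict_apply (hmeas q)]
      refine (hup q hq.1 hk).trans_eq ?_
      rw [← mul_assoc, hτ, pow_succ, ENNReal.mul_inv (by simp) (by simp), ← mul_assoc,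
        ENNReal.mul_inv_cancel (by simp) (by simp), one_mul]
    have h2 := hK.enorm_conv_le_on_cell hn hW hF ht0 ht (hpos q.1) h1 hx
    have h3 : (cellBall (ℓ / 2 ^ q.1) q.2).indicator F =
        (cellBall (ℓ / 2 ^ q.1) q.2).indicator f := by
      rw [hFdef, Set.indicator_indicator,
        Set.inter_eq_left.2 (cellBall_subset_cellBall hℓ (hpos q.1) hle hq.2)]
    rw [h3] at h2
    refine h2.trans_eq ?_
    rw [htdef, hC₀]
    push_cast
    ring

end SparseStep

/-! ### Iteration of the sparse step. -/

section SparseDomination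

variable {n : ℕ}

/-- The local sparse domination principle: a measure which dominates the averages over large
subsets of cubes dominates the localised operator. -/
theorem exists_lintegral_conv_mul_le (hn : 0 < n) (A W : ℝ≥0) : ∃ C : ℝ≥0, ∀ K : Eu n → ℝ,
    IsCZKernel A K → (∀ f : Eu n → ℂ, LocallyIntegrable f volume → ∀ t : ℝ≥0∞,
      t * volume {x | t < ‖conv K f x‖ₑ} ≤ W * ∫⁻ x, ‖f x‖ₑ) →
    ∀ f : Eu n → ℂ, Integrable f → ∀ G : Eu n → ℝ≥0∞, AEMeasurable G volume →
    ∀ ν : Measure (Eu n), (∀ (ℓ : ℝ) (m : Fin n → ℤ) (E : Set (Eu n)), 0 < ℓ → ℓ ≤ 1 →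
      MeasurableSet E → E ⊆ cell ℓ m → volume (cell ℓ m) ≤ 2 * volume E →
      C * ((∫⁻ y in cellBall ℓ m, ‖f y‖ₑ) / volume (cell ℓ m)) * ∫⁻ y in cell ℓ m, G y ≤ ν E) →
    ∀ (ℓ : ℝ) (m : Fin n → ℤ), 0 < ℓ → ℓ ≤ 1 → ∫⁻ y in cell ℓ m, G y ≠ ∞ →
      ∫⁻ x in cell ℓ m, ‖conv K ((cellBall ℓ m).indicator f) x‖ₑ * G x ≤ ν (cell ℓ m) := by
  obtain ⟨C, hC⟩ := exists_sparse_step hn A W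
  refine ⟨C, fun K hK hW f hf G hG ν hν ℓ₀ m₀ hℓ₀ hℓ₀1 hfin => ?_⟩
  obtain ⟨b, hb⟩ := hK.exists_bound
  -- This bound depends on `K` and `f`, but it only multiplies a remainder that tends to zero, so it
  -- does not enter the constant.
  set M : ℝ≥0∞ := b * ∫⁻ y, ‖f y‖ₑ with hM
  have hMt : M ≠ ∞ := ENNReal.mul_ne_top (by simp) hf.2.ne
  have hTM : ∀ (B : Set (Eu n)) x, ‖conv K (B.indicator f) x‖ₑ ≤ M := by
    intro B x
    refine (enorm_conv_le _ _ _).trans ?_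
    rw [hM, ← lintegral_const_mul' _ _ (by simp)]
    refine lintegral_mono fun y => mul_le_mul' (hb _) ?_
    rw [enorm_indicator_eq_indicator_enorm]
    exact Set.indicator_le_self _ _ _
  -- After `k` generations the uncontrolled set `U` has volume at most `2 ^ (-k)` times that of the
  -- cube. At each generation `ν` of the part outside the subcubes pays for the average. These parts
  -- are disjoint, so additivity of `ν` replaces the bookkeeping of a sparse family.
  have key : ∀ (k : ℕ) (ℓ : ℝ) (m : Fin n → ℤ), 0 < ℓ → ℓ ≤ 1 → ∃ U, MeasurableSet U ∧
      U ⊆ cell ℓ m ∧ 2 ^ k * volume U ≤ volume (cell ℓ m) ∧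
      ∫⁻ x in cell ℓ m, ‖conv K ((cellBall ℓ m).indicator f) x‖ₑ * G x ≤
        ν (cell ℓ m) + ∫⁻ x in U, M * G x := by
    intro k
    induction k with
    | zero =>
      intro ℓ m _ _
      refine ⟨cell ℓ m, measurableSet_cell _ _, subset_rfl, by simp, ?_⟩
      exact le_add_left (lintegral_mono fun x => mul_le_mul_left (hTM _ x) _)
    | succ k ih =>
      intro ℓ m hℓ hℓ1
      obtain ⟨S, hdisj, hsub, hhalf, hoff, hon⟩ := hC K hK hW f hf.locallyIntegrable ℓ hℓ m
      set a : ℝ≥0∞ := C * ((∫⁻ y in cellBall ℓ m, ‖f y‖ₑ) / volume (cell ℓ m)) with ha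
      have hat : a ≠ ∞ := by
        refine ENNReal.mul_ne_top (by simp) (ENNReal.div_ne_top ?_ (volume_cell_ne_zero hℓ m))
        exact ((setLIntegral_le_lintegral _ _).trans_lt hf.2).ne
      have hpos : ∀ q : ℕ × (Fin n → ℤ), 0 < ℓ / 2 ^ q.1 := fun q => by positivity
      have hle : ∀ q : ℕ × (Fin n → ℤ), ℓ / 2 ^ q.1 ≤ 1 := fun q =>
        (div_le_self hℓ.le (one_le_pow₀ (by norm_num))).trans hℓ1
      choose U hUm hUsub hUvol hUint using fun q : ℕ × (Fin n → ℤ) =>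
        ih (ℓ / 2 ^ q.1) q.2 (hpos q) (hle q)
      have hUdisj : S.PairwiseDisjoint U := hdisj.mono_on fun q _ => hUsub q
      have hSc : S.Countable := S.to_countable
      have hPm : ∀ q ∈ S, MeasurableSet (dyadic ℓ q) := fun q _ => measurableSet_cell _ _
      set P := ⋃ q ∈ S, dyadic ℓ q with hP
      have hPmeas : MeasurableSet P := .biUnion hSc hPm
      have hPsub : P ⊆ cell ℓ m := Set.iUnion₂_subset hsub
      refine ⟨⋃ q ∈ S, U q, .biUnion hSc fun q _ => hUm q,
        Set.iUnion₂_subset fun q hq => (hUsub q).trans (hsub q hq), ?_, ?_⟩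
      · refine le_trans ?_ hhalf
        rw [pow_succ', mul_assoc]
        refine mul_le_mul_right ?_ _
        rw [measure_biUnion hSc hUdisj fun q _ => hUm q, measure_biUnion hSc hdisj hPm,
          ← ENNReal.tsum_mul_left]
        exact ENNReal.tsum_le_tsum fun q => hUvol q
      · set T := fun x => ‖conv K ((cellBall ℓ m).indicator f) x‖ₑ * G x with hT
        have h1 : ∫⁻ x in cell ℓ m \ P, T x ≤ a * ∫⁻ x in cell ℓ m \ P, G x := by
          rw [← lintegral_const_mul' _ _ hat]
          refine setLIntegral_mono_ae' ((measurableSet_cell _ _).diff hPmeas) ?_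
          filter_upwards [hoff] with x hx hxQ
          exact mul_le_mul_left (hx hxQ) _
        have h2 : ∀ q ∈ S, ∫⁻ x in dyadic ℓ q, T x ≤ a * (∫⁻ x in dyadic ℓ q, G x) +
            (ν (dyadic ℓ q) + ∫⁻ x in U q, M * G x) := by
          intro q hq
          rw [← lintegral_const_mul' _ _ hat]
          calc _ ≤ ∫⁻ x in dyadic ℓ q, (a * G x +
                ‖conv K ((cellBall (ℓ / 2 ^ q.1) q.2).indicator f) x‖ₑ * G x) := by
                refine setLIntegral_mono' (measurableSet_cell _ _) fun x hx => ?_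
                rw [← add_mul]
                exact mul_le_mul_left (hon q hq x hx) _
            _ = _ := lintegral_add_left' (hG.restrict.const_mul _) _
            _ ≤ _ := add_le_add le_rfl (hUint q)
        have h3 : ∫⁻ x in P, T x ≤ a * (∫⁻ x in P, G x) +
            (ν P + ∫⁻ x in ⋃ q ∈ S, U q, M * G x) := by
          rw [hP, lintegral_biUnion hSc hPm hdisj, lintegral_biUnion hSc hPm hdisj,
            measure_biUnion hSc hdisj hPm, lintegral_biUnion hSc (fun q _ => hUm q) hUdisj,
            ← ENNReal.tsum_mul_left, ← ENNReal.tsum_add, ← ENNReal.tsum_add]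
          exact ENNReal.tsum_le_tsum fun q => h2 q.1 q.2
        have h4 : volume (cell ℓ m) ≤ 2 * volume (cell ℓ m \ P) := by
          have h5 := measure_inter_add_sdiff (μ := volume) (cell ℓ m) hPmeas
          rw [Set.inter_eq_right.2 hPsub] at h5
          refine (ENNReal.add_le_add_iff_left (volume_cell_ne_top hℓ m)).1 ?_
          calc volume (cell ℓ m) + volume (cell ℓ m) =
                2 * volume P + 2 * volume (cell ℓ m \ P) := by rw [← mul_add, h5, two_mul]
            _ ≤ _ := add_le_add hhalf le_rfl
        calc ∫⁻ x in cell ℓ m, T x = (∫⁻ x in P, T x) + ∫⁻ x in cell ℓ m \ P, T x := by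
              rw [← lintegral_inter_add_sdiff T (cell ℓ m) hPmeas, Set.inter_eq_right.2 hPsub]
          _ ≤ (a * (∫⁻ x in P, G x) + (ν P + ∫⁻ x in ⋃ q ∈ S, U q, M * G x)) +
              a * ∫⁻ x in cell ℓ m \ P, G x := add_le_add h3 h1
          _ = a * ((∫⁻ x in P, G x) + ∫⁻ x in cell ℓ m \ P, G x) +
              (ν P + ∫⁻ x in ⋃ q ∈ S, U q, M * G x) := by ring
          _ = a * (∫⁻ x in cell ℓ m, G x) + (ν P + ∫⁻ x in ⋃ q ∈ S, U q, M * G x) := by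
              rw [← lintegral_inter_add_sdiff G (cell ℓ m) hPmeas, Set.inter_eq_right.2 hPsub]
          _ ≤ ν (cell ℓ m \ P) + (ν P + ∫⁻ x in ⋃ q ∈ S, U q, M * G x) := by
              refine add_le_add ?_ le_rfl
              exact hν ℓ m _ hℓ hℓ1 ((measurableSet_cell _ _).diff hPmeas) Set.sdiff_subset h4
          _ = _ := by
              rw [← measure_inter_add_sdiff (cell ℓ m) hPmeas, Set.inter_eq_right.2 hPsub]
              ring
  choose U hUm hUsub hUvol hUint using fun k => key k ℓ₀ m₀ hℓ₀ hℓ₀1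
  have hlim : Tendsto (fun k => volume.restrict (cell ℓ₀ m₀) (U k)) atTop (𝓝 0) := by
    have h1 : ∀ k, volume.restrict (cell ℓ₀ m₀) (U k) ≤
        volume (cell ℓ₀ m₀) * (2⁻¹ : ℝ≥0∞) ^ k := by
      intro k
      refine (Measure.restrict_apply_le _ _).trans ?_
      rw [← ENNReal.inv_pow, ← div_eq_mul_inv, ENNReal.le_div_iff_mul_le (by simp) (by simp), mul_comm]
      exact hUvol k
    have h2 := ENNReal.Tendsto.const_mul (a := volume (cell ℓ₀ m₀))
      (ENNReal.tendsto_pow_atTop_nhds_zero_of_lt_one (r := 2⁻¹) (by simp))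
      (Or.inr (volume_cell_ne_top hℓ₀ m₀))
    rw [mul_zero] at h2
    exact tendsto_of_tendsto_of_tendsto_of_le_of_le tendsto_const_nhds h2 (fun _ => zero_le) h1
  have hMG : ∫⁻ x in cell ℓ₀ m₀, M * G x ≠ ∞ := by
    rw [lintegral_const_mul' _ _ hMt]
    exact ENNReal.mul_ne_top hMt hfin
  have h3 := (tendsto_setLIntegral_zero hMG hlim).const_add (ν (cell ℓ₀ m₀))
  rw [add_zero] at h3
  refine ge_of_tendsto' h3 fun k => (hUint k).trans (add_le_add le_rfl (le_of_eq ?_))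
  rw [Measure.restrict_restrict (hUm k), Set.inter_eq_left.2 (hUsub k)]

end SparseDomination

/-! ### Muckenhoupt pairs and the weighted strong type inequality. -/

section PairsOfWeights

variable {n : ℕ}

/-- A weight and its dual weight satisfying the Muckenhoupt condition on balls of radius at
most `R`. -/
structure IsApPair (w σ : Measure (Eu n)) (p q : ℝ) (A₂ : ℝ≥0) (R : ℝ) : Prop where
  volume_le : ∀ E, MeasurableSet E → volume E ≤ w E ^ p⁻¹ * σ E ^ q⁻¹
  ap : ∀ c r, 0 < r → r ≤ R →
    w (Metric.ball c r) ^ p⁻¹ * σ (Metric.ball c r) ^ q⁻¹ ≤ A₂ * volume (Metric.ball c r)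
  left_ne_top : ∀ c r, w (Metric.ball c r) ≠ ∞
  right_ne_top : ∀ c r, σ (Metric.ball c r) ≠ ∞

variable {w σ : Measure (Eu n)} {p q : ℝ} {A₂ : ℝ≥0} {R : ℝ}

lemma IsApPair.symm (h : IsApPair w σ p q A₂ R) : IsApPair σ w q p A₂ R where
  volume_le E hE := by rw [mul_comm]; exact h.volume_le E hE
  ap c r hr hR := by rw [mul_comm]; exact h.ap c r hr hR
  left_ne_top := h.right_ne_top
  right_ne_top := h.left_ne_top

lemma IsApPair.right_ne_zero (h : IsApPair w σ p q A₂ R) (hq : 0 < q) (c : Eu n) {r : ℝ}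
    (hr : 0 < r) : σ (Metric.ball c r) ≠ 0 := by
  intro h0
  have := h.volume_le _ (measurableSet_ball (x := c) (ε := r))
  rw [h0, ENNReal.zero_rpow_of_pos (inv_pos.2 hq), mul_zero, nonpos_iff_eq_zero] at this
  exact (Metric.measure_ball_pos volume c hr).ne' this

/-- Large subsets of balls carry a large part of the weight. -/
lemma IsApPair.measure_ball_le (h : IsApPair w σ p q A₂ R) (hp : 0 < p) (hq : 0 < q) {c : Eu n}
    {r : ℝ} (hr : 0 < r) (hR : r ≤ R) {E : Set (Eu n)} (hE : MeasurableSet E)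
    (hEc : E ⊆ Metric.ball c r) {k : ℝ≥0} (hk : volume (Metric.ball c r) ≤ k * volume E) :
    w (Metric.ball c r) ≤ ((A₂ * k) ^ p : ℝ≥0) * w E := by
  have hσ0 : σ (Metric.ball c r) ^ q⁻¹ ≠ 0 := by
    have := h.right_ne_zero hq c hr
    simp [ENNReal.rpow_eq_zero_iff, this, h.right_ne_top c r]
  have hσt : σ (Metric.ball c r) ^ q⁻¹ ≠ ∞ :=
    ENNReal.rpow_ne_top_of_nonneg (by positivity) (h.right_ne_top c r)
  have h1 : w (Metric.ball c r) ^ p⁻¹ ≤ (A₂ * k : ℝ≥0) * w E ^ p⁻¹ := by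
    refine (ENNReal.mul_le_mul_iff_left hσ0 hσt).1 ?_
    calc _ ≤ A₂ * volume (Metric.ball c r) := h.ap c r hr hR
      _ ≤ A₂ * (k * (w E ^ p⁻¹ * σ E ^ q⁻¹)) :=
        mul_le_mul_right (hk.trans (mul_le_mul_right (h.volume_le E hE) _)) _
      _ ≤ A₂ * (k * (w E ^ p⁻¹ * σ (Metric.ball c r) ^ q⁻¹)) := by gcongr
      _ = _ := by push_cast; ring
  calc w (Metric.ball c r) = (w (Metric.ball c r) ^ p⁻¹) ^ p := by
        rw [ENNReal.rpow_inv_rpow hp.ne']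
    _ ≤ ((A₂ * k : ℝ≥0) * w E ^ p⁻¹) ^ p := ENNReal.rpow_le_rpow h1 hp.le
    _ = _ := by
        rw [ENNReal.mul_rpow_of_nonneg _ _ hp.le, ENNReal.rpow_inv_rpow hp.ne',
          ENNReal.coe_rpow_of_nonneg _ hp.le]

lemma IsApPair.doubling (h : IsApPair w σ p q A₂ (5 * R)) (hp : 0 < p) (hq : 0 < q) (c : Eu n)
    {r : ℝ} (hr : 0 < r) (hR : r ≤ R) :
    w (Metric.ball c (5 * r)) ≤ ((A₂ * 5 ^ n) ^ p : ℝ≥0) * w (Metric.ball c r) := by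
  refine h.measure_ball_le hp hq (by positivity) (by linarith) measurableSet_ball
    (Metric.ball_subset_ball (by linarith)) ?_
  push_cast
  exact volume_ball_five_mul c hr

/-- The averages over a cube are dominated by maximal functions on large subsets. -/
lemma IsApPair.average_mul_le (h : IsApPair w σ p q A₂ R) (hpq : p.HolderConjugate q) {c : Eu n}
    {r : ℝ} (hr : 0 < r) (hR : r ≤ R) {E : Set (Eu n)} (hE : MeasurableSet E)
    (hEc : E ⊆ Metric.ball c r) {k : ℝ≥0} (hk : volume (Metric.ball c r) ≤ k * volume E) (φ g : Eu n → ℝ≥0∞)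
    {θ : ℝ≥0} (hθ : θ ≠ 0) :
    (∫⁻ y in Metric.ball c r, φ y ∂σ) / volume (Metric.ball c r) * ∫⁻ y in Metric.ball c r, g y ∂w ≤
      (∫⁻ x in E, (A₂ * ((A₂ * k) ^ q) ^ p⁻¹ * ((A₂ * k) ^ p) ^ q⁻¹ * θ : ℝ≥0) ^ p *
        maxFn σ φ R x ^ p ∂σ) +
      ∫⁻ x in E, (θ⁻¹ : ℝ≥0) ^ q * maxFn w g R x ^ q ∂w := by
  have hp := hpq.pos
  have hq := hpq.symm.pos
  set B := Metric.ball c r with hB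
  have hs0 : σ B ≠ 0 := h.right_ne_zero hq c hr
  have hu0 : w B ≠ 0 := h.symm.right_ne_zero hp c hr
  have hst : σ B ≠ ∞ := h.right_ne_top c r
  have hut : w B ≠ ∞ := h.left_ne_top c r
  have hv0 : volume B ≠ 0 := (Metric.measure_ball_pos volume c hr).ne'
  have hvt : volume B ≠ ∞ := measure_ball_lt_top.ne
  have hu := h.measure_ball_le hp hq hr hR hE hEc hk
  have hs := h.symm.measure_ball_le hq hp hr hR hE hEc hk
  set Γ := (∫⁻ y in B, g y ∂w) / w B with hΓ
  set Ψ := (∫⁻ y in B, φ y ∂σ) / σ B with hΨ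
  set a : ℝ≥0 := ((A₂ * k) ^ q) ^ p⁻¹ with ha
  set b : ℝ≥0 := ((A₂ * k) ^ p) ^ q⁻¹ with hb
  -- The product of the masses splits into two Muckenhoupt quantities because `1 / p + 1 / q = 1`.
  -- One is bounded by the condition itself; in the other the ball is exchanged for its large subset
  -- `E`.
  have e1 : σ B * w B = (w B ^ p⁻¹ * σ B ^ q⁻¹) * (σ B ^ p⁻¹ * w B ^ q⁻¹) := by
    have e2 : ∀ x : ℝ≥0∞, x ≠ 0 → x ≠ ∞ → x ^ p⁻¹ * x ^ q⁻¹ = x := fun x hx0 hxt => by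
      rw [← ENNReal.rpow_add _ _ hx0 hxt, hpq.inv_add_inv_eq_one, ENNReal.rpow_one]
    calc σ B * w B = (σ B ^ p⁻¹ * σ B ^ q⁻¹) * (w B ^ p⁻¹ * w B ^ q⁻¹) := by
          rw [e2 _ hs0 hst, e2 _ hu0 hut]
      _ = _ := by ring
  have h1 : σ B ^ p⁻¹ ≤ a * σ E ^ p⁻¹ := by
    calc _ ≤ (((A₂ * k) ^ q : ℝ≥0) * σ E) ^ p⁻¹ := ENNReal.rpow_le_rpow hs (by positivity)
      _ = _ := by
        rw [ENNReal.mul_rpow_of_nonneg _ _ (by positivity), ha,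
          ENNReal.coe_rpow_of_nonneg _ (by positivity : 0 ≤ p⁻¹)]
  have h2 : w B ^ q⁻¹ ≤ b * w E ^ q⁻¹ := by
    calc _ ≤ (((A₂ * k) ^ p : ℝ≥0) * w E) ^ q⁻¹ := ENNReal.rpow_le_rpow hu (by positivity)
      _ = _ := by
        rw [ENNReal.mul_rpow_of_nonneg _ _ (by positivity), hb,
          ENNReal.coe_rpow_of_nonneg _ (by positivity : 0 ≤ q⁻¹)]
  have h3 : σ B * w B / volume B ≤ A₂ * (a * σ E ^ p⁻¹) * (b * w E ^ q⁻¹) := by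
    refine ENNReal.div_le_of_le_mul ?_
    calc _ ≤ A₂ * volume B * ((a * σ E ^ p⁻¹) * (b * w E ^ q⁻¹)) := by
          rw [e1]
          exact mul_le_mul' (h.ap c r hr hR) (mul_le_mul' h1 h2)
      _ = _ := by ring
  -- Inserting `θ * θ⁻¹` before Young's inequality shrinks the `g` term at the expense of the `φ`
  -- term, in view of the later absorption.
  have hθθ : (θ : ℝ≥0∞) * (θ⁻¹ : ℝ≥0) = 1 := by
    rw [← ENNReal.coe_mul, mul_inv_cancel₀ hθ, ENNReal.coe_one]
  calc _ = Ψ * Γ * (σ B * w B / volume B) := by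
        rw [hΨ, hΓ]
        have e3 : (∫⁻ y in B, φ y ∂σ) = (∫⁻ y in B, φ y ∂σ) / σ B * σ B :=
          (ENNReal.div_mul_cancel hs0 hst).symm
        have e4 : (∫⁻ y in B, g y ∂w) = (∫⁻ y in B, g y ∂w) / w B * w B :=
          (ENNReal.div_mul_cancel hu0 hut).symm
        nth_rw 1 [e3, e4]
        simp only [div_eq_mul_inv]
        ring
    _ ≤ Ψ * Γ * (A₂ * (a * σ E ^ p⁻¹) * (b * w E ^ q⁻¹)) := mul_le_mul_right h3 _
    _ = ((A₂ * a * b : ℝ≥0) * Ψ * σ E ^ p⁻¹) * (Γ * w E ^ q⁻¹) * (θ * (θ⁻¹ : ℝ≥0)) := by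
        rw [hθθ]; push_cast; ring
    _ = ((A₂ * a * b * θ : ℝ≥0) * Ψ * σ E ^ p⁻¹) * ((θ⁻¹ : ℝ≥0) * Γ * w E ^ q⁻¹) := by
        push_cast; ring
    _ ≤ ((A₂ * a * b * θ : ℝ≥0) * Ψ * σ E ^ p⁻¹) ^ p + ((θ⁻¹ : ℝ≥0) * Γ * w E ^ q⁻¹) ^ q := by
        refine (ENNReal.young_inequality _ _ hpq).trans (add_le_add ?_ ?_)
        · refine ENNReal.div_le_of_le_mul (le_mul_of_one_le_right zero_le ?_)
          exact ENNReal.one_le_ofReal.2 hpq.lt.le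
        · refine ENNReal.div_le_of_le_mul (le_mul_of_one_le_right zero_le ?_)
          exact ENNReal.one_le_ofReal.2 hpq.symm.lt.le
    _ = ((A₂ * a * b * θ : ℝ≥0) ^ p * Ψ ^ p) * σ E + ((θ⁻¹ : ℝ≥0) ^ q * Γ ^ q) * w E := by
        rw [ENNReal.mul_rpow_of_nonneg _ _ hp.le, ENNReal.mul_rpow_of_nonneg _ _ hp.le,
          ENNReal.mul_rpow_of_nonneg _ _ hq.le, ENNReal.mul_rpow_of_nonneg _ _ hq.le,
          ENNReal.rpow_inv_rpow hp.ne', ENNReal.rpow_inv_rpow hq.ne']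
    _ ≤ _ := by
        rw [← setLIntegral_const, ← setLIntegral_const]
        refine add_le_add (setLIntegral_mono' hE fun x hx => ?_)
          (setLIntegral_mono' hE fun x hx => ?_)
        · gcongr
          exact le_maxFn hr hR (hEc hx)
        · gcongr
          exact le_maxFn hr hR (hEc hx)

lemma IsApPair.mono (h : IsApPair w σ p q A₂ R) {R' : ℝ} (hR : R' ≤ R) : IsApPair w σ p q A₂ R' where
  volume_le := h.volume_le
  ap c r hr hr' := h.ap c r hr (hr'.trans hR)
  left_ne_top := h.left_ne_top
  right_ne_top := h.right_ne_top

lemma setLIntegral_withDensity {X : Type*} [MeasurableSpace X] {μ : Measure X} {ω g : X → ℝ≥0∞}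
    (hω : AEMeasurable ω μ) (hg : AEMeasurable g μ) {S : Set X} (hS : MeasurableSet S) :
    ∫⁻ x in S, g x ∂(μ.withDensity ω) = ∫⁻ x in S, ω x * g x ∂μ := by
  rw [restrict_withDensity hS, lintegral_withDensity_eq_lintegral_mul₀ hω.restrict hg.restrict]
  rfl

/-- The unit cells whose surrounding ball contains `y` are disjoint and lie in the ball of radius `9
* n` about `y`; comparing volumes counts them. -/
lemma tsum_indicator_cellBall_le (hn : 0 < n) (y : Eu n) :
    ∑' m : Fin n → ℤ, (cellBall 1 m).indicator (1 : Eu n → ℝ≥0∞) y ≤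
      (ballVol n * (9 * n) ^ n : ℝ≥0) := by
  have hn' : (1 : ℝ) ≤ n := by exact_mod_cast hn
  have h1 : ∀ m : Fin n → ℤ, (cellBall 1 m).indicator (1 : Eu n → ℝ≥0∞) y ≤
      volume.restrict (Metric.ball y (9 * n)) (cell 1 m) := by
    intro m
    by_cases hy : y ∈ cellBall 1 m
    · rw [Set.indicator_of_mem hy, Measure.restrict_apply (measurableSet_cell _ _),
        Set.inter_eq_left.2, volume_cell one_pos]
      · simp
      · intro x hx
        have h2 := dist_cellCenter_le one_pos hx
        rw [cellBall, Metric.mem_ball] at hy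
        rw [Metric.mem_ball]
        have := dist_triangle_right x y (cellCenter 1 m)
        linarith
    · rw [Set.indicator_of_notMem hy]; exact zero_le
  calc _ ≤ ∑' m : Fin n → ℤ, volume.restrict (Metric.ball y (9 * n)) (cell 1 m) :=
        ENNReal.tsum_le_tsum h1
    _ = volume.restrict (Metric.ball y (9 * n)) (⋃ m : Fin n → ℤ, cell 1 m) :=
        (measure_iUnion (fun m m' h => disjoint_cell 1 h) fun m => measurableSet_cell _ _).symm
    _ = _ := by
        rw [iUnion_cell, Measure.restrict_apply_univ, volume_ball_eq _ (by positivity),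
          ENNReal.ofReal_mul (by norm_num), ENNReal.ofReal_natCast]
        push_cast
        simp

set_option maxHeartbeats 800000 in
/-- The two-measure weighted strong type inequality. -/
theorem exists_lintegral_conv_rpow_le (hn : 0 < n) (A W A₂ : ℝ≥0) (hpq : p.HolderConjugate q) :
    ∃ C : ℝ≥0, ∀ K : Eu n → ℝ, IsCZKernel A K →
    (∀ f : Eu n → ℂ, LocallyIntegrable f volume → ∀ t : ℝ≥0∞,
      t * volume {x | t < ‖conv K f x‖ₑ} ≤ W * ∫⁻ x, ‖f x‖ₑ) →
    ∀ ω : Eu n → ℝ≥0∞, AEMeasurable ω volume → ∀ σ : Measure (Eu n),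
    IsApPair (volume.withDensity ω) σ p q A₂ (5 * (8 * n)) →
    ∀ f : Eu n → ℂ, LocallyIntegrable f volume → ∀ φ : Eu n → ℝ≥0∞, Measurable φ →
    (∀ S, MeasurableSet S → ∫⁻ x in S, ‖f x‖ₑ = ∫⁻ x in S, φ x ∂σ) →
    ∫⁻ x, ‖conv K f x‖ₑ ^ p ∂(volume.withDensity ω) ≤ C * ∫⁻ x, φ x ^ p ∂σ := by
  have hp := hpq.pos
  have hq := hpq.symm.pos
  have hn' : (1 : ℝ) ≤ n := by exact_mod_cast hn
  obtain ⟨C₁, hC₁⟩ := exists_lintegral_conv_mul_le hn A W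
  obtain ⟨C₂, hC₂⟩ := lintegral_maxFn_rpow_le hpq.symm.lt ((A₂ * 5 ^ n) ^ p)
  obtain ⟨C₃, hC₃⟩ := lintegral_maxFn_rpow_le hpq.lt ((A₂ * 5 ^ n) ^ q)
  -- `c₀` is the volume ratio of the surrounding ball to the cell. As `E` fills half the cell, the
  -- ball is at most `k = 2 * c₀` times `E`.
  set c₀ : ℝ≥0 := ballVol n * (8 * n) ^ n with hc₀
  set k : ℝ≥0 := c₀ * 2 with hk
  set b : ℝ≥0 := C₁ * c₀ with hb
  -- Chosen so that the term carrying `I` gets coefficient at most `1 / 2`; being at least 1, `θ`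
  -- also satisfies `θ⁻¹ ^ q ≤ θ⁻¹`.
  set θ : ℝ≥0 := 2 * (b * C₂) + 1 with hθ
  have hθ0 : θ ≠ 0 := by positivity
  set κ : ℝ≥0 := A₂ * ((A₂ * k) ^ q) ^ p⁻¹ * ((A₂ * k) ^ p) ^ q⁻¹ * θ with hκ
  have hsmall : b * ((θ⁻¹ : ℝ≥0) ^ q * C₂) ≤ 2⁻¹ := by
    have h1 : (θ⁻¹ : ℝ≥0) ^ q ≤ θ⁻¹ := by
      have h2 : θ⁻¹ ≤ 1 := inv_le_one_of_one_le₀ (by rw [hθ]; exact le_add_self)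
      calc (θ⁻¹ : ℝ≥0) ^ q ≤ (θ⁻¹ : ℝ≥0) ^ (1 : ℝ) :=
            NNReal.rpow_le_rpow_of_exponent_ge (by positivity) h2 hpq.symm.lt.le
        _ = _ := NNReal.rpow_one _
    calc b * ((θ⁻¹ : ℝ≥0) ^ q * C₂) ≤ b * (θ⁻¹ * C₂) := by gcongr
      _ = (2 * (b * C₂)) * θ⁻¹ / 2 := by ring
      _ ≤ θ * θ⁻¹ / 2 := by gcongr; rw [hθ]; exact le_self_add
      _ = 2⁻¹ := by rw [mul_inv_cancel₀ hθ0, one_div]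
  set C' : ℝ≥0 := b * (κ ^ p * C₃) with hC'
  refine ⟨2 * C' * (ballVol n * (9 * n) ^ n), fun K hK hW ω hω σ h f hf φ hφ hfφ => ?_⟩
  set w := (volume : Measure (Eu n)).withDensity ω with hw
  have h8 : IsApPair w σ p q A₂ (8 * n) := h.mono (by linarith)
  set T := conv K f with hT
  have hTc : Continuous T := hK.continuous_conv hf
  have hTm : Measurable fun x => ‖T x‖ₑ := hTc.measurable.enorm
  -- the estimate on a unit cube
  have hcell : ∀ m : Fin n → ℤ, ∫⁻ x in cell 1 m, ‖T x‖ₑ ^ p ∂w ≤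
      2 * C' * ∫⁻ x in cellBall 1 m, φ x ^ p ∂σ := by
    intro m
    set Q := cell (1 : ℝ) m with hQ
    set B := cellBall (1 : ℝ) m with hB
    have hQm : MeasurableSet Q := measurableSet_cell _ _
    have hBm : MeasurableSet B := measurableSet_cellBall _ _
    have hQB : Q ⊆ B := cell_subset_cellBall hn one_pos m
    have hf₀ : Integrable (B.indicator f) :=
      (integrable_indicator_iff hBm).2 ((hf.integrableOn_isCompact
        (isCompact_closedBall _ _)).mono_set Metric.ball_subset_closedBall)
    obtain ⟨M, hM⟩ : ∃ M : ℝ≥0, ∀ x ∈ Q, ‖T x‖ₑ ≤ M := by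
      obtain ⟨M, hM⟩ := (isCompact_closedBall (cellCenter 1 m) (8 * n * 1)).exists_bound_of_continuousOn
        hTc.continuousOn
      refine ⟨M.toNNReal, fun x hx => ?_⟩
      rw [← ofReal_norm]
      exact ENNReal.ofReal_le_ofReal (hM x (Metric.ball_subset_closedBall (hQB hx)))
    have hwQ : w Q ≠ ∞ := ((measure_mono hQB).trans_lt (h.left_ne_top _ _).lt_top).ne
    set I := ∫⁻ x in Q, ‖T x‖ₑ ^ p ∂w with hI
    -- Finiteness is needed to subtract half of `I` from both sides at the end.
    have hIt : I ≠ ∞ := by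
      have : I ≤ (M : ℝ≥0∞) ^ p * w Q := by
        rw [← setLIntegral_const]
        refine setLIntegral_mono' hQm fun x hx => ?_
        gcongr
        exact hM x hx
      exact (this.trans_lt (ENNReal.mul_lt_top (by finiteness) hwQ.lt_top)).ne
    -- The dual function: on `Q` both `‖T x‖ₑ * g x` and `g x ^ q` equal `‖T x‖ₑ ^ p`.
    set g : Eu n → ℝ≥0∞ := Q.indicator fun x => ‖T x‖ₑ ^ (p - 1) with hg
    have hgm : Measurable g := (hTm.pow_const _).indicator hQm
    have hGint : ∀ S, MeasurableSet S → ∫⁻ x in S, ω x * g x = ∫⁻ x in S, g x ∂w :=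
      fun S hS => (setLIntegral_withDensity hω hgm.aemeasurable hS).symm
    set φ₀ := B.indicator φ with hφ₀
    have hφ₀m : Measurable φ₀ := hφ.indicator hBm
    -- This measure dominates the products of averages by `average_mul_le`, and its mass on `Q` is
    -- bounded by the maximal theorems for `σ` and `w`.
    set ν : Measure (Eu n) := (b : ℝ≥0∞) •
      (σ.withDensity (fun x => (κ : ℝ≥0∞) ^ p * maxFn σ φ₀ (8 * n) x ^ p) +
        w.withDensity (fun x => ((θ⁻¹ : ℝ≥0) : ℝ≥0∞) ^ q * maxFn w g (8 * n) x ^ q)) with hν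
    have hmain := hC₁ K hK hW (B.indicator f) hf₀ (fun x => ω x * g x) (hω.mul hgm.aemeasurable) ν
      (by
        intro ℓ m' E hℓ hℓ1 hE hEsub hEvol
        have hr : (0 : ℝ) < 8 * n * ℓ := by positivity
        have hsub := cell_subset_cellBall hn hℓ m'
        have hc0 : (c₀ : ℝ≥0∞) ≠ 0 := by
          have := (ballVol_pos n).ne'
          have h0 : c₀ ≠ 0 := by positivity
          exact_mod_cast h0
        have hvB : volume (cellBall ℓ m') = c₀ * volume (cell ℓ m') := by
          rw [volume_cellBall hn hℓ, hc₀]; push_cast; ring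
        have h1 := h8.average_mul_le hpq (c := cellCenter ℓ m') hr (by nlinarith) hE
          (hEsub.trans hsub) (k := k) (by
            rw [← cellBall, hvB, hk]
            push_cast
            rw [mul_assoc]
            gcongr) φ₀ g hθ0
        have h2 : ∫⁻ y in cellBall ℓ m', ‖B.indicator f y‖ₑ = ∫⁻ y in cellBall ℓ m', φ₀ y ∂σ := by
          simp only [enorm_indicator_eq_indicator_enorm, hφ₀]
          rw [setLIntegral_indicator hBm, setLIntegral_indicator hBm,
            hfφ _ (hBm.inter (measurableSet_cellBall _ _))]
        have h3 : ∫⁻ y in cell ℓ m', ω y * g y ≤ ∫⁻ y in cellBall ℓ m', g y ∂w := by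
          rw [hGint _ (measurableSet_cell _ _)]
          exact lintegral_mono_set hsub
        have h4 : ∀ a : ℝ≥0∞, a / volume (cell ℓ m') = c₀ * (a / volume (cellBall ℓ m')) := by
          intro a
          rw [hvB, ← mul_div_assoc, ENNReal.mul_div_mul_left _ _ hc0 (by simp)]
        rw [h2, h4]
        calc _ ≤ (b : ℝ≥0∞) * ((∫⁻ y in cellBall ℓ m', φ₀ y ∂σ) / volume (cellBall ℓ m') *
              ∫⁻ y in cellBall ℓ m', g y ∂w) := by
              rw [hb]
              push_cast
              refine (mul_le_mul_right h3 _).trans_eq (by ring)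
          _ ≤ _ := mul_le_mul_right h1 _
          _ = ν E := by
              rw [hν, Measure.smul_apply, Measure.add_apply, withDensity_apply _ hE,
                withDensity_apply _ hE, smul_eq_mul])
      1 m one_pos le_rfl (by
        rw [hGint _ hQm]
        have : ∫⁻ x in Q, g x ∂w ≤ (M : ℝ≥0∞) ^ (p - 1) * w Q := by
          rw [← setLIntegral_const]
          refine setLIntegral_mono' hQm fun x hx => ?_
          rw [hg, Set.indicator_of_mem hx]
          have := hpq.sub_one_pos
          exact ENNReal.rpow_le_rpow (hM x hx) this.le
        have h0 := hpq.sub_one_pos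
        exact (this.trans_lt (ENNReal.mul_lt_top (by finiteness) hwQ.lt_top)).ne)
    have hleft : ∫⁻ x in Q, ‖conv K (B.indicator (B.indicator f)) x‖ₑ * (ω x * g x) = I := by
      rw [hI, hw, setLIntegral_withDensity hω (hTm.pow_const _).aemeasurable hQm]
      refine setLIntegral_congr_fun hQm fun x hx => ?_
      -- Every point within the range 2 of the unit cell lies in the surrounding ball, so localising
      -- `f` changes nothing on `Q`.
      have e1 : conv K (B.indicator (B.indicator f)) x = T x := by
        rw [Set.indicator_indicator, Set.inter_self]
        refine hK.conv_congr fun y hy => Set.indicator_of_mem ?_ _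
        have h5 := dist_cellCenter_le one_pos hx
        rw [hB, cellBall, Metric.mem_ball]
        have := dist_triangle y x (cellCenter 1 m)
        linarith
      rw [e1, hg, Set.indicator_of_mem hx]
      calc ‖T x‖ₑ * (ω x * ‖T x‖ₑ ^ (p - 1)) = ω x * (‖T x‖ₑ ^ (1 : ℝ) * ‖T x‖ₑ ^ (p - 1)) := by
            rw [ENNReal.rpow_one]; ring
        _ = _ := by
            rw [← ENNReal.rpow_add_of_nonneg _ _ zero_le_one hpq.sub_one_pos.le]
            congr 2; ring
    have hgq : ∫⁻ x, g x ^ q ∂w = I := by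
      rw [hI, ← lintegral_indicator hQm]
      refine lintegral_congr fun x => ?_
      by_cases hx : x ∈ Q
      · rw [hg, Set.indicator_of_mem hx, Set.indicator_of_mem hx, ← ENNReal.rpow_mul,
          hpq.sub_one_mul_conj]
      · rw [hg, Set.indicator_of_notMem hx, Set.indicator_of_notMem hx,
          ENNReal.zero_rpow_of_pos hq]
    have hφp : ∫⁻ x, φ₀ x ^ p ∂σ = ∫⁻ x in B, φ x ^ p ∂σ := by
      rw [← lintegral_indicator hBm]
      refine lintegral_congr fun x => ?_
      by_cases hx : x ∈ B
      · rw [hφ₀, Set.indicator_of_mem hx, Set.indicator_of_mem hx]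
      · rw [hφ₀, Set.indicator_of_notMem hx, Set.indicator_of_notMem hx,
          ENNReal.zero_rpow_of_pos hp]
    have hνQ : ν Q ≤ C' * (∫⁻ x in B, φ x ^ p ∂σ) + 2⁻¹ * I := by
      have h5 := hC₂ w (8 * n) (fun c r hr hR => h.doubling hp hq c hr hR) g hgm
      have h6 := hC₃ σ (8 * n) (fun c r hr hR => h.symm.doubling hq hp c hr hR) φ₀ hφ₀m
      rw [hgq] at h5
      rw [hφp] at h6
      rw [hν, Measure.smul_apply, Measure.add_apply, withDensity_apply _ hQm,
        withDensity_apply _ hQm, smul_eq_mul, mul_add,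
        lintegral_const_mul' _ _ (by finiteness), lintegral_const_mul' _ _ (by finiteness)]
      refine add_le_add ?_ ?_
      · calc _ ≤ (b : ℝ≥0∞) * ((κ : ℝ≥0∞) ^ p * (C₃ * ∫⁻ x in B, φ x ^ p ∂σ)) := by
              gcongr
              exact (setLIntegral_le_lintegral _ _).trans h6
          _ = _ := by
              rw [hC']
              push_cast
              rw [ENNReal.coe_rpow_of_nonneg _ hp.le]
              ring
      · calc _ ≤ (b : ℝ≥0∞) * (((θ⁻¹ : ℝ≥0) : ℝ≥0∞) ^ q * (C₂ * I)) := by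
              gcongr
              exact (setLIntegral_le_lintegral _ _).trans h5
          _ = ((b * ((θ⁻¹ : ℝ≥0) ^ q * C₂) : ℝ≥0) : ℝ≥0∞) * I := by
              push_cast
              rw [ENNReal.coe_rpow_of_nonneg _ hq.le]
              ring
          _ ≤ ((2⁻¹ : ℝ≥0) : ℝ≥0∞) * I := by gcongr
          _ = _ := by rw [ENNReal.coe_inv (by norm_num)]; rfl
    rw [hleft] at hmain
    have h7 := hmain.trans hνQ
    have h9 : 2⁻¹ * I ≠ ∞ := by finiteness
    have h10 : 2⁻¹ * I ≤ C' * ∫⁻ x in B, φ x ^ p ∂σ := by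
      refine (ENNReal.add_le_add_iff_right h9).1 ?_
      rwa [← add_mul, ENNReal.inv_two_add_inv_two, one_mul]
    calc I = 2 * (2⁻¹ * I) := by
          rw [← mul_assoc, ENNReal.mul_inv_cancel (by norm_num) (by norm_num), one_mul]
      _ ≤ 2 * (C' * ∫⁻ x in B, φ x ^ p ∂σ) := by gcongr
      _ = _ := by ring
  calc ∫⁻ x, ‖T x‖ₑ ^ p ∂w = ∑' m : Fin n → ℤ, ∫⁻ x in cell 1 m, ‖T x‖ₑ ^ p ∂w := by
        rw [← lintegral_iUnion (fun m => measurableSet_cell 1 m) (fun m m' h => disjoint_cell 1 h),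
          iUnion_cell, setLIntegral_univ]
    _ ≤ ∑' m : Fin n → ℤ, 2 * C' * ∫⁻ x in cellBall 1 m, φ x ^ p ∂σ := ENNReal.tsum_le_tsum hcell
    _ = 2 * C' * ∑' m : Fin n → ℤ, ∫⁻ x, (cellBall 1 m).indicator 1 x * φ x ^ p ∂σ := by
        rw [ENNReal.tsum_mul_left]
        congr 2
        funext m
        rw [← lintegral_indicator (measurableSet_cellBall _ _)]
        refine lintegral_congr fun x => ?_
        by_cases hx : x ∈ cellBall 1 m <;> simp [hx]
    _ = 2 * C' * ∫⁻ x, (∑' m : Fin n → ℤ, (cellBall 1 m).indicator 1 x) * φ x ^ p ∂σ := by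
        simp only [← ENNReal.tsum_mul_right]
        congr 1
        refine (lintegral_tsum fun m => ?_).symm
        exact (Measurable.mul (measurable_one.indicator (measurableSet_cellBall 1 m))
          (hφ.pow_const p)).aemeasurable
    _ ≤ 2 * C' * ∫⁻ x, (ballVol n * (9 * n) ^ n : ℝ≥0) * φ x ^ p ∂σ := by
        gcongr with x
        exact tsum_indicator_cellBall_le hn x
    _ = _ := by
        rw [lintegral_const_mul' _ _ ENNReal.coe_ne_top]
        push_cast
        ring

end PairsOfWeights

/-! ### From small balls to balls of any bounded radius. -/

section Chaining

variable {n : ℕ}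

/-- Doubling at one scale compares the masses of balls of that scale along chains. -/
lemma measure_ball_le_pow_mul {μ : Measure (Eu n)} {D : ℝ≥0} {δ : ℝ}
    (hD : ∀ c, μ (Metric.ball c (2 * δ)) ≤ D * μ (Metric.ball c δ)) (N : ℕ) {y z : Eu n}
    (h : dist y z ≤ N * δ) : μ (Metric.ball y δ) ≤ D ^ N * μ (Metric.ball z δ) := by
  induction N generalizing y z with
  | zero =>
    have : y = z := dist_le_zero.1 (by simpa using h)
    simp [this]
  | succ N ih =>
    set a : ℝ := (N : ℝ) / (N + 1) with ha
    have hN : (0 : ℝ) < N + 1 := by positivity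
    set z' := AffineMap.lineMap y z a with hz'
    push_cast at h
    have h1 : dist y z' ≤ N * δ := by
      rw [hz', dist_left_lineMap, Real.norm_eq_abs, abs_of_nonneg (by positivity), ha]
      calc _ ≤ (N : ℝ) / (N + 1) * ((N + 1) * δ) := by gcongr
        _ = N * δ := by field_simp
    have h2 : dist z' z ≤ δ := by
      have e : 1 - a = 1 / (N + 1) := by rw [ha]; field_simp; ring
      rw [hz', dist_lineMap_right, e, Real.norm_eq_abs, abs_of_nonneg (by positivity)]
      calc _ ≤ 1 / ((N : ℝ) + 1) * ((N + 1) * δ) := by gcongr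
        _ = δ := by field_simp
    calc μ (Metric.ball y δ) ≤ D ^ N * μ (Metric.ball z' δ) := ih h1
      _ ≤ D ^ N * μ (Metric.ball z (2 * δ)) := by
        gcongr
        exact Metric.ball_subset_ball' (by linarith)
      _ ≤ D ^ N * (D * μ (Metric.ball z δ)) := by gcongr; exact hD z
      _ = _ := by ring

/-- A ball is covered by finitely many translates of a small ball. -/
lemma exists_finset_ball_subset (δ R : ℝ) (hδ : 0 < δ) : ∃ t : Finset (Eu n),
    (∀ v ∈ t, ‖v‖ ≤ R) ∧ ∀ c, Metric.ball c R ⊆ ⋃ v ∈ t, Metric.ball (c + v) δ := by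
  obtain ⟨t, ht, htf, hcov⟩ := (isCompact_closedBall (0 : Eu n) R).finite_cover_balls hδ
  refine ⟨htf.toFinset, fun v hv => by simpa using ht (htf.mem_toFinset.1 hv), fun c x hx => ?_⟩
  have h1 : x - c ∈ Metric.closedBall (0 : Eu n) R := by
    rw [mem_closedBall_zero_iff, ← dist_eq_norm]
    exact (Metric.mem_ball.1 hx).le
  obtain ⟨v, hv, hxv⟩ := Set.mem_iUnion₂.1 (hcov h1)
  refine Set.mem_iUnion₂.2 ⟨v, htf.mem_toFinset.2 hv, ?_⟩
  rw [Metric.mem_ball, dist_eq_norm] at hxv ⊢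
  rwa [← sub_sub]

/-- Finitely many small balls cover the large one, their number not depending on the centre. Each is
joined to the target ball by a chain of at most `N ≥ 2 * R / δ` steps, at a cost of `D` per step. -/
lemma exists_measure_ball_le (D : ℝ≥0) (δ R : ℝ) (hδ : 0 < δ) : ∃ N : ℝ≥0,
    ∀ μ : Measure (Eu n), (∀ c, μ (Metric.ball c (2 * δ)) ≤ D * μ (Metric.ball c δ)) →
    ∀ c y, dist y c ≤ R → μ (Metric.ball c R) ≤ N * μ (Metric.ball y δ) := by
  obtain ⟨t, ht, hcov⟩ := exists_finset_ball_subset (n := n) δ R hδ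
  obtain ⟨N, hN⟩ := exists_nat_ge (2 * R / δ)
  rw [div_le_iff₀ hδ] at hN
  refine ⟨t.card * D ^ N, fun μ hD c y hy => ?_⟩
  calc μ (Metric.ball c R) ≤ ∑ v ∈ t, μ (Metric.ball (c + v) δ) :=
        (measure_mono (hcov c)).trans (measure_biUnion_finset_le _ _)
    _ ≤ ∑ v ∈ t, D ^ N * μ (Metric.ball y δ) := by
        refine Finset.sum_le_sum fun v hv => measure_ball_le_pow_mul hD N (hN.trans' ?_)
        have h1 : dist (c + v) c ≤ R := by simpa using ht v hv
        have := dist_triangle_right (c + v) y c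
        linarith
    _ = _ := by
        rw [Finset.sum_const, nsmul_eq_mul]
        push_cast
        ring

/-- Doubling passes from radius `r` to `5 * r`, so the condition up to radius `R₀` can be used at
radius `R₀ / 5`. -/
lemma IsApPair.exists_measure_ball_le {w σ : Measure (Eu n)} {p q : ℝ} {A₂ : ℝ≥0} {R₀ : ℝ}
    (h : IsApPair w σ p q A₂ R₀) (hp : 0 < p) (hq : 0 < q) (hR₀ : 0 < R₀) (R : ℝ) :
    ∃ N : ℝ≥0, ∀ c y, dist y c ≤ R →
      w (Metric.ball c R) ≤ N * w (Metric.ball y (R₀ / 5)) := by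
  obtain ⟨N, hN⟩ := _root_.exists_measure_ball_le (n := n) ((A₂ * 5 ^ n) ^ p) (R₀ / 5) R
    (by positivity)
  have h5 : IsApPair w σ p q A₂ (5 * (R₀ / 5)) := h.mono (by linarith)
  refine ⟨N, hN w fun c => ?_⟩
  refine le_trans (measure_mono (Metric.ball_subset_ball ?_))
    (h5.doubling hp hq c (by positivity) le_rfl)
  linarith

/-- The Muckenhoupt condition on small balls implies the condition on large balls. -/
theorem IsApPair.exists_of_pos {w σ : Measure (Eu n)} {p q : ℝ} {A₂ : ℝ≥0} {R₀ : ℝ}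
    (h : IsApPair w σ p q A₂ R₀) (hp : 0 < p) (hq : 0 < q) (hR₀ : 0 < R₀) (R : ℝ) :
    ∃ A₂' : ℝ≥0, IsApPair w σ p q A₂' R := by
  obtain ⟨N, hN⟩ := h.exists_measure_ball_le hp hq hR₀ R
  obtain ⟨N', hN'⟩ := h.symm.exists_measure_ball_le hq hp hR₀ R
  refine ⟨A₂ + N ^ p⁻¹ * N' ^ q⁻¹ * A₂, h.volume_le, fun c r hr hrR => ?_, h.left_ne_top,
    h.right_ne_top⟩
  push_cast
  rw [add_mul]
  rcases le_total r (R₀ / 5) with hr5 | hr5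
  · exact (h.ap c r hr (by linarith)).trans le_self_add
  · refine le_trans ?_ le_add_self
    have hRc : dist c c ≤ R := by rw [dist_self]; linarith
    have h1 : ∀ {μ : Measure (Eu n)} {M : ℝ≥0} {s : ℝ}, 0 < s →
        μ (Metric.ball c R) ≤ M * μ (Metric.ball c (R₀ / 5)) →
        μ (Metric.ball c r) ^ s⁻¹ ≤ (M ^ s⁻¹ : ℝ≥0) * μ (Metric.ball c (R₀ / 5)) ^ s⁻¹ := by
      intro μ M s hs hM
      have hs' : 0 ≤ s⁻¹ := by positivity
      rw [ENNReal.coe_rpow_of_nonneg _ hs', ← ENNReal.mul_rpow_of_nonneg _ _ hs']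
      exact ENNReal.rpow_le_rpow
        ((measure_mono (Metric.ball_subset_ball hrR)).trans hM) hs'
    calc _ ≤ ((N ^ p⁻¹ : ℝ≥0) * w (Metric.ball c (R₀ / 5)) ^ p⁻¹) *
          ((N' ^ q⁻¹ : ℝ≥0) * σ (Metric.ball c (R₀ / 5)) ^ q⁻¹) :=
          mul_le_mul' (h1 hp (hN c c hRc)) (h1 hq (hN' c c hRc))
      _ = (N ^ p⁻¹ : ℝ≥0) * (N' ^ q⁻¹ : ℝ≥0) * (w (Metric.ball c (R₀ / 5)) ^ p⁻¹ *
          σ (Metric.ball c (R₀ / 5)) ^ q⁻¹) := by ring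
      _ ≤ (N ^ p⁻¹ : ℝ≥0) * (N' ^ q⁻¹ : ℝ≥0) * (A₂ * volume (Metric.ball c r)) := by
          refine mul_le_mul_right ((h.ap c _ (by positivity) (by linarith)).trans ?_) _
          gcongr
      _ = _ := by ring

end Chaining

/-! ### Local A_p weights as Muckenhoupt pairs. -/

section Weights

variable {n : ℕ} {p : ℝ} {w : Eu n → ℝ}

lemma volume_cube (x : Eu n) (t : ℝ) : volume (cube x t) = ENNReal.ofReal t ^ n := by
  have h : cube x t = (MeasurableEquiv.toLp 2 (Fin n → ℝ)).symm ⁻¹'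
      (Set.univ.pi fun i => Set.Icc (x i - t / 2) (x i + t / 2)) := by
    ext y
    simp only [cube, Set.mem_ofPred_eq, Set.mem_preimage, Set.mem_pi, Set.mem_univ, true_imp_iff,
      Set.mem_Icc, abs_le]
    refine forall_congr' fun i => ?_
    change _ ↔ x i - t / 2 ≤ y i ∧ y i ≤ x i + t / 2
    constructor <;> rintro ⟨h1, h2⟩ <;> constructor <;> linarith
  rw [h, (EuclideanSpace.volume_preserving_symm_measurableEquiv_toLp (Fin n)).measure_preimage
    (MeasurableSet.univ_pi fun i => measurableSet_Icc).nullMeasurableSet, volume_pi_pi]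
  have : ∀ i, (x i + t / 2 - (x i - t / 2)) = t := fun i => by ring
  simp [this]

lemma ball_subset_cube (x : Eu n) (r : ℝ) : Metric.ball x r ⊆ cube x (2 * r) := by
  intro y hy i
  have h1 := PiLp.norm_apply_le (y - x) i
  rw [Metric.mem_ball, dist_eq_norm] at hy
  rw [PiLp.sub_apply, Real.norm_eq_abs] at h1
  linarith

/-- The dual weight `w^(-p'/p) dx`. -/
noncomputable def dualMeasure (p : ℝ) (w : Eu n → ℝ) : Measure (Eu n) :=
  volume.withDensity fun x => ENNReal.ofReal (w x) ^ (-(p.conjExponent / p))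

lemma IsWeight.aemeasurable (h : IsWeight w) :
    AEMeasurable (fun x => ENNReal.ofReal (w x)) volume :=
  h.locallyIntegrable.aestronglyMeasurable.aemeasurable.ennreal_ofReal

lemma weightMeasure_apply_ball (w : Eu n → ℝ) (x : Eu n) (r : ℝ) : weightMeasure w (Metric.ball x r) =
    ∫⁻ y in Metric.ball x r, ENNReal.ofReal (w y) :=
  withDensity_apply _ measurableSet_ball

/-- For `r ≤ 1 / 2` the concentric cube of side `2 * r` contains the ball and has volume at most 1,
so it is admissible in the supremum. -/
lemma weightMeasure_ball_mul_le (hp : 1 < p) (w : Eu n → ℝ) (x : Eu n) {r : ℝ} (hr : 0 < r)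
    (hr2 : r ≤ 1 / 2) : weightMeasure w (Metric.ball x r) *
      dualMeasure p w (Metric.ball x r) ^ (p / p.conjExponent) ≤
      apLocConst p w * (ENNReal.ofReal (2 * r) ^ n) ^ p := by
  have hq : 0 < p.conjExponent := (Real.HolderConjugate.conjExponent hp).symm.pos
  have hv := volume_cube x (2 * r)
  have hr0 : ENNReal.ofReal (2 * r) ^ n ≠ 0 := by
    have : ENNReal.ofReal (2 * r) ≠ 0 := by simp [hr]
    exact pow_ne_zero _ this
  have hrt : ENNReal.ofReal (2 * r) ^ n ≠ ∞ := by finiteness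
  have h1 : volume (cube x (2 * r)) ≤ 1 := by
    rw [hv]
    refine pow_le_one₀ zero_le ?_
    rw [← ENNReal.ofReal_one]
    exact ENNReal.ofReal_le_ofReal (by linarith)
  have h2 := le_iSup_of_le (f := fun x : Eu n => ⨆ (t : ℝ) (_ : 0 < t)
    (_ : volume (cube x t) ≤ 1), ((∫⁻ y in cube x t, ENNReal.ofReal (w y)) *
      (∫⁻ y in cube x t, ENNReal.ofReal (w y) ^ (-(p.conjExponent / p))) ^ (p / p.conjExponent))
        / volume (cube x t) ^ p) x <| le_iSup_of_le (2 * r) <|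
    le_iSup_of_le (by positivity : 0 < 2 * r) <| le_iSup_of_le h1 le_rfl
  change _ ≤ apLocConst p w at h2
  rw [hv, ENNReal.div_le_iff (ENNReal.rpow_pos (pos_iff_ne_zero.2 hr0) hrt).ne'
    (ENNReal.rpow_ne_top_of_nonneg (by linarith) hrt)] at h2
  refine le_trans ?_ h2
  rw [weightMeasure_apply_ball, dualMeasure, withDensity_apply _ measurableSet_ball]
  gcongr
  all_goals exact ball_subset_cube x r

lemma IsApLoc.dualMeasure_ball_ne_top (hp : 1 < p) (h : IsApLoc p w) {x : Eu n} {r : ℝ} (hr : 0 < r)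
    (hr2 : r ≤ 1 / 2) (h0 : weightMeasure w (Metric.ball x r) ≠ 0) :
    dualMeasure p w (Metric.ball x r) ≠ ∞ := by
  have hq : 0 < p.conjExponent := (Real.HolderConjugate.conjExponent hp).symm.pos
  intro htop
  have := weightMeasure_ball_mul_le hp w x hr hr2
  rw [htop, ENNReal.top_rpow_of_pos (by positivity), ENNReal.mul_top h0, top_le_iff] at this
  exact ENNReal.mul_ne_top h.2.ne (ENNReal.rpow_ne_top_of_nonneg (by linarith) (by finiteness)) this

/-- Zero to a negative power is `∞`, so finite dual mass forces the weight to be positive almost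
everywhere. -/
lemma ae_ne_zero_of_dualMeasure_ne_top (hp : 1 < p) (hw : IsWeight w) {x : Eu n} {r : ℝ}
    (h : dualMeasure p w (Metric.ball x r) ≠ ∞) :
    ∀ᵐ y, y ∈ Metric.ball x r → ENNReal.ofReal (w y) ≠ 0 := by
  have hq : 0 < p.conjExponent := (Real.HolderConjugate.conjExponent hp).symm.pos
  rw [dualMeasure, withDensity_apply _ measurableSet_ball] at h
  rw [← ae_restrict_iff' measurableSet_ball]
  filter_upwards [ae_lt_top' (hw.aemeasurable.restrict.pow_const _) h] with y hy h0
  rw [h0, ENNReal.zero_rpow_of_neg (by simp only [Left.neg_neg_iff]; positivity)] at hy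
  exact lt_irrefl _ hy

lemma weightMeasure_ne_zero {x y : Eu n} {r s : ℝ} (hs : 0 < s) (hw : IsWeight w)
    (h : ∀ᵐ z, z ∈ Metric.ball x r → ENNReal.ofReal (w z) ≠ 0)
    (hsub : Metric.ball y s ⊆ Metric.ball x r) : weightMeasure w (Metric.ball y s) ≠ 0 := by
  intro h0
  rw [weightMeasure_apply_ball, lintegral_eq_zero_iff' hw.aemeasurable.restrict] at h0
  have h1 := (ae_restrict_iff' measurableSet_ball).1 h0
  refine (Metric.measure_ball_pos volume y hs).ne' (measure_eq_zero_iff_ae_notMem.2 ?_)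
  filter_upwards [h, h1] with z hz hz' hzy
  exact hz (hsub hzy) (hz' hzy)

/-- A connectedness argument. If a ball has positive mass, finiteness of the A_p constant makes the
dual mass finite on the concentric ball of radius `1 / 2`. The weight is then positive almost
everywhere there, and neighbouring balls have positive mass. The set of such centres is thus clopen,
and it is nonempty because the weight is not null. -/
lemma IsApLoc.weightMeasure_ball_ne_zero (hp : 1 < p) (h : IsApLoc p w) (x : Eu n) :
    weightMeasure w (Metric.ball x (1 / 4)) ≠ 0 := by
  set S : Set (Eu n) := {x | weightMeasure w (Metric.ball x (1 / 4)) ≠ 0} with hS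
  have key : ∀ x ∈ S, ∀ y, dist y x < 1 / 4 → y ∈ S := by
    intro x hx y hy
    have h0 : weightMeasure w (Metric.ball x (1 / 2)) ≠ 0 := fun h0 =>
      hx (measure_mono_null (Metric.ball_subset_ball (by norm_num)) h0)
    refine weightMeasure_ne_zero (by norm_num) h.1 (ae_ne_zero_of_dualMeasure_ne_top hp h.1
      (h.dualMeasure_ball_ne_top hp (by norm_num) le_rfl h0)) (Metric.ball_subset_ball' ?_)
    linarith
  have hclopen : IsClopen S := by
    refine ⟨⟨Metric.isOpen_iff.2 fun y hy => ⟨1 / 4, by norm_num, fun z hz hzS => ?_⟩⟩,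
      Metric.isOpen_iff.2 fun y hy => ⟨1 / 4, by norm_num, fun z hz => key y hy z hz⟩⟩
    exact hy (key z hzS y (by rwa [dist_comm]))
  have hne : S.Nonempty := by
    by_contra hcon
    rw [Set.not_nonempty_iff_eq_empty] at hcon
    have h1 : weightMeasure w Set.univ = 0 := by
      refine measure_null_of_locally_null _ fun y _ => ⟨Metric.ball y (1 / 4),
        mem_nhdsWithin_of_mem_nhds (Metric.ball_mem_nhds y (by norm_num)), ?_⟩
      by_contra hy
      have : y ∈ S := hy
      rw [hcon] at this
      exact this
    rw [weightMeasure, withDensity_apply _ MeasurableSet.univ, setLIntegral_univ,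
      lintegral_eq_zero_iff' h.1.aemeasurable] at h1
    refine h.1.not_ae_zero ?_
    filter_upwards [h1] with y hy
    exact le_antisymm (ENNReal.ofReal_eq_zero.1 hy) (h.1.nonneg y)
  have := hclopen.eq_univ hne
  exact (this ▸ Set.mem_univ x : x ∈ S)

lemma IsApLoc.dualMeasure_half_ne_top (hp : 1 < p) (h : IsApLoc p w) (x : Eu n) :
    dualMeasure p w (Metric.ball x (1 / 2)) ≠ ∞ :=
  h.dualMeasure_ball_ne_top hp (by norm_num) le_rfl fun h0 => h.weightMeasure_ball_ne_zero hp x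
    (measure_mono_null (Metric.ball_subset_ball (by norm_num)) h0)

lemma IsApLoc.ae_ne_zero (hp : 1 < p) (h : IsApLoc p w) : ∀ᵐ x, ENNReal.ofReal (w x) ≠ 0 := by
  rw [ae_iff]
  refine measure_null_of_locally_null _ fun x _ => ⟨_,
    inter_mem_nhdsWithin _ (Metric.ball_mem_nhds x (by norm_num : (0 : ℝ) < 1 / 2)), ?_⟩
  refine measure_eq_zero_iff_ae_notMem.2 ?_
  filter_upwards [ae_ne_zero_of_dualMeasure_ne_top hp h.1 (h.dualMeasure_half_ne_top hp x)]
    with y hy hy'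
  exact hy'.1 (hy hy'.2)

lemma IsWeight.weightMeasure_ball_ne_top (hw : IsWeight w) (x : Eu n) (r : ℝ) :
    weightMeasure w (Metric.ball x r) ≠ ∞ := by
  have h1 : IntegrableOn w (Metric.ball x r) :=
    (hw.locallyIntegrable.integrableOn_isCompact (isCompact_closedBall x r)).mono_set
      Metric.ball_subset_closedBall
  rw [weightMeasure_apply_ball]
  exact ((lintegral_mono fun y => Real.ofReal_le_enorm (w y)).trans_lt h1.2).ne

lemma IsApLoc.dualMeasure_ball_lt_top (hp : 1 < p) (h : IsApLoc p w) (x : Eu n) (r : ℝ) :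
    dualMeasure p w (Metric.ball x r) ≠ ∞ := by
  have : IsLocallyFiniteMeasure (dualMeasure p w) := ⟨fun y => ⟨_,
    Metric.ball_mem_nhds y (by norm_num : (0 : ℝ) < 1 / 2),
    (h.dualMeasure_half_ne_top hp y).lt_top⟩⟩
  exact ((measure_mono Metric.ball_subset_closedBall).trans_lt
    (isCompact_closedBall x r).measure_lt_top).ne

/-- Hölder's inequality for a weight and its dual weight. -/
lemma IsApLoc.setLIntegral_le (hp : 1 < p) (h : IsApLoc p w) {g : Eu n → ℝ≥0∞}
    (hg : AEMeasurable g volume) {S : Set (Eu n)} (hS : MeasurableSet S) :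
    ∫⁻ x in S, g x ≤ (∫⁻ x in S, g x ^ p ∂(weightMeasure w)) ^ p⁻¹ *
      dualMeasure p w S ^ p.conjExponent⁻¹ := by
  have hpq := Real.HolderConjugate.conjExponent hp
  set q := p.conjExponent with hq
  have hp0 := hpq.pos
  have hq0 := hpq.symm.pos
  have hω := h.1.aemeasurable
  have h1 := ENNReal.lintegral_mul_le_Lp_mul_Lq (volume.restrict S) hpq
    (f := fun x => g x * ENNReal.ofReal (w x) ^ p⁻¹) (g := fun x => ENNReal.ofReal (w x) ^ (-p⁻¹))
    (hg.mul (hω.pow_const _)).restrict (hω.pow_const _).restrict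
  have e1 : ∫⁻ x in S, g x = ∫⁻ x in S, ((fun x => g x * ENNReal.ofReal (w x) ^ p⁻¹) *
      fun x => ENNReal.ofReal (w x) ^ (-p⁻¹)) x := by
    refine lintegral_congr_ae (ae_restrict_of_ae ?_)
    filter_upwards [h.ae_ne_zero hp] with x hx
    rw [Pi.mul_apply, mul_assoc, ← ENNReal.rpow_add _ _ hx (by simp), add_neg_cancel,
      ENNReal.rpow_zero, mul_one]
  have e2 : ∫⁻ x in S, g x ^ p ∂(weightMeasure w) =
      ∫⁻ x in S, (g x * ENNReal.ofReal (w x) ^ p⁻¹) ^ p := by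
    rw [weightMeasure, setLIntegral_withDensity hω (hg.pow_const _) hS]
    refine lintegral_congr fun x => ?_
    rw [ENNReal.mul_rpow_of_nonneg _ _ hp0.le, ENNReal.rpow_inv_rpow hp0.ne', mul_comm]
  have e3 : dualMeasure p w S = ∫⁻ x in S, (ENNReal.ofReal (w x) ^ (-p⁻¹)) ^ q := by
    rw [dualMeasure, withDensity_apply _ hS]
    refine lintegral_congr fun x => ?_
    rw [← ENNReal.rpow_mul, ← hq]
    congr 1
    ring
  rw [one_div, one_div] at h1
  rw [e1, e2, e3]
  exact h1

/-- A local Muckenhoupt weight satisfies the Muckenhoupt condition on balls of any bounded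
radius. -/
theorem IsApLoc.exists_isApPair (hp : 1 < p) (h : IsApLoc p w) (R : ℝ) :
    ∃ A₂ : ℝ≥0, IsApPair (weightMeasure w) (dualMeasure p w) p p.conjExponent A₂ R := by
  have hpq := Real.HolderConjugate.conjExponent hp
  have hp0 := hpq.pos
  have hq0 := hpq.symm.pos
  have h2 : IsApPair (weightMeasure w) (dualMeasure p w) p p.conjExponent
      ((apLocConst p w ^ p⁻¹).toNNReal * 2 ^ n * (ballVol n)⁻¹) (1 / 2) := by
    refine ⟨fun E hE => ?_, fun c r hr hr2 => ?_, h.1.weightMeasure_ball_ne_top,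
      h.dualMeasure_ball_lt_top hp⟩
    · have := h.setLIntegral_le hp (g := fun _ => 1) aemeasurable_const hE
      simpa using this
    · have h3 := ENNReal.rpow_le_rpow (weightMeasure_ball_mul_le hp w c hr hr2)
        (by positivity : 0 ≤ p⁻¹)
      rw [ENNReal.mul_rpow_of_nonneg _ _ (by positivity), ENNReal.mul_rpow_of_nonneg _ _
        (by positivity), ENNReal.rpow_rpow_inv hp0.ne', ← ENNReal.rpow_mul] at h3
      have e : p / p.conjExponent * p⁻¹ = p.conjExponent⁻¹ := by field_simp
      rw [e] at h3
      refine h3.trans_eq ?_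
      have hV : (ballVol n : ℝ≥0∞) ≠ 0 := by exact_mod_cast (ballVol_pos n).ne'
      rw [volume_ball_eq _ hr]
      push_cast
      rw [ENNReal.coe_toNNReal (ENNReal.rpow_ne_top_of_nonneg (by positivity) h.2.ne),
        ENNReal.coe_inv (ballVol_pos n).ne', ENNReal.ofReal_mul (by norm_num), mul_pow,
        ENNReal.ofReal_ofNat]
      calc _ = apLocConst p w ^ p⁻¹ * (2 ^ n * ENNReal.ofReal r ^ n) *
            ((ballVol n : ℝ≥0∞)⁻¹ * ballVol n) := by
            rw [ENNReal.inv_mul_cancel hV (by simp), mul_one]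
        _ = _ := by ring
  exact h2.exists_of_pos hp0 hq0 (by norm_num) R

/-- Transfers measurability of `f` from `w dx` to Lebesgue measure. -/
lemma IsApLoc.volume_absolutelyContinuous (hp : 1 < p) (h : IsApLoc p w) :
    volume ≪ weightMeasure w :=
  withDensity_absolutelyContinuous' h.1.aemeasurable (h.ae_ne_zero hp)

lemma weightMeasure_absolutelyContinuous (w : Eu n → ℝ) : weightMeasure w ≪ volume :=
  withDensity_absolutelyContinuous _ _

lemma IsApLoc.locallyIntegrable (hp : 1 < p) (h : IsApLoc p w) {f : Eu n → ℂ}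
    (hf : MemLp f (ENNReal.ofReal p) (weightMeasure w)) : LocallyIntegrable f volume := by
  have hp0 : 0 < p := by linarith
  have hq0 := (Real.HolderConjugate.conjExponent hp).symm.pos
  have hfm : AEStronglyMeasurable f volume := hf.1.mono_ac (h.volume_absolutelyContinuous hp)
  intro x
  refine ⟨Metric.ball x 1, Metric.ball_mem_nhds x one_pos, hfm.restrict, ?_⟩
  refine (h.setLIntegral_le hp hfm.enorm measurableSet_ball).trans_lt ?_
  have h1 : ∫⁻ y in Metric.ball x 1, ‖f y‖ₑ ^ p ∂(weightMeasure w) ≠ ∞ := by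
    have := lintegral_rpow_enorm_lt_top_of_eLpNorm_lt_top (by simpa using hp0) (by simp) hf.2
    rw [ENNReal.toReal_ofReal hp0.le] at this
    exact ((setLIntegral_le_lintegral _ _).trans_lt this).ne
  exact ENNReal.mul_lt_top (ENNReal.rpow_lt_top_of_nonneg (by positivity) h1)
    (ENNReal.rpow_lt_top_of_nonneg (by positivity) (h.dualMeasure_ball_lt_top hp x 1))

/-- The weighted strong type inequality, uniformly over kernels. -/
theorem IsApLoc.exists_lintegral_conv_le (hn : 0 < n) (hp : 1 < p) (h : IsApLoc p w) (A W : ℝ≥0) :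
    ∃ C : ℝ≥0, ∀ K : Eu n → ℝ, IsCZKernel A K →
    (∀ f : Eu n → ℂ, LocallyIntegrable f volume → ∀ t : ℝ≥0∞,
      t * volume {x | t < ‖conv K f x‖ₑ} ≤ W * ∫⁻ x, ‖f x‖ₑ) →
    ∀ f : Eu n → ℂ, LocallyIntegrable f volume →
    ∫⁻ x, ‖conv K f x‖ₑ ^ p ∂(weightMeasure w) ≤ C * ∫⁻ x, ‖f x‖ₑ ^ p ∂(weightMeasure w) := by
  have hpq := Real.HolderConjugate.conjExponent hp
  obtain ⟨A₂, hA₂⟩ := h.exists_isApPair hp (5 * (8 * n))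
  obtain ⟨C, hC⟩ := exists_lintegral_conv_rpow_le hn A W A₂ hpq
  refine ⟨C, fun K hK hW f hf => ?_⟩
  have hω := h.1.aemeasurable
  set q := p.conjExponent with hq
  have hp0 := hpq.pos
  have hq0 := hpq.symm.pos
  -- The density of `|f| dx` with respect to the dual weight. Since `q - q / p = 1`, the integral of
  -- `ψ ^ p` against the dual weight is that of `|f| ^ p` against `w`.
  set ψ : Eu n → ℝ≥0∞ := fun x => ‖f x‖ₑ * ENNReal.ofReal (w x) ^ (q / p) with hψ
  have hψm : AEMeasurable ψ volume := hf.aestronglyMeasurable.enorm.mul (hω.pow_const _)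
  have hac : dualMeasure p w ≪ volume := withDensity_absolutelyContinuous _ _
  have hae : hψm.mk ψ =ᵐ[dualMeasure p w] ψ := hac.ae_eq hψm.ae_eq_mk.symm
  have hdm : AEMeasurable (fun x => ENNReal.ofReal (w x) ^ (-(q / p))) volume := hω.pow_const _
  have h1 := hC K hK hW _ hω (dualMeasure p w) hA₂ f hf (hψm.mk ψ) hψm.measurable_mk (by
    intro S hS
    rw [lintegral_congr_ae (ae_restrict_of_ae hae), dualMeasure,
      setLIntegral_withDensity hdm hψm hS]
    refine lintegral_congr_ae (ae_restrict_of_ae ?_)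
    filter_upwards [h.ae_ne_zero hp] with x hx
    rw [hψ, mul_left_comm, ← ENNReal.rpow_add _ _ hx (by simp), neg_add_cancel,
      ENNReal.rpow_zero, mul_one])
  refine h1.trans_eq ?_
  congr 1
  have e1 : ∫⁻ x, hψm.mk ψ x ^ p ∂(dualMeasure p w) = ∫⁻ x, ψ x ^ p ∂(dualMeasure p w) :=
    lintegral_congr_ae (hae.fun_comp fun y => y ^ p)
  rw [e1, ← setLIntegral_univ, ← setLIntegral_univ (μ := weightMeasure w), dualMeasure, weightMeasure,
    setLIntegral_withDensity hdm (hψm.pow_const _) MeasurableSet.univ,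
    setLIntegral_withDensity hω (hf.aestronglyMeasurable.enorm.pow_const _) MeasurableSet.univ]
  refine lintegral_congr_ae (ae_restrict_of_ae ?_)
  filter_upwards [h.ae_ne_zero hp] with x hx
  rw [hψ, ENNReal.mul_rpow_of_nonneg _ _ hp0.le, mul_left_comm, ← ENNReal.rpow_mul,
    ← ENNReal.rpow_add _ _ hx (by simp), mul_comm]
  have e : -(q / p) + q / p * p = 1 := by
    have := hpq.sub_one_mul_conj
    field_simp
    linarith
  rw [e, ENNReal.rpow_one]

end Weights

/-! ### Local A₁ weights. -/

section EndpointWeights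

variable {n : ℕ} {w : Eu n → ℝ}

/-- The mean of `w⁻¹` is at most its essential supremum. The inclusion in `A_2` brings positivity,
doubling and the `L²` bound to A₁ weights. -/
lemma apLocConst_two_le (w : Eu n → ℝ) : apLocConst 2 w ≤ a1LocConst w := by
  refine iSup_mono fun x => iSup_mono fun t => iSup_mono fun ht => iSup_mono fun hv => ?_
  have e : (2 : ℝ).conjExponent = 2 := by norm_num [Real.conjExponent]
  have hv0 : volume (cube x t) ≠ 0 := by
    have : ENNReal.ofReal t ≠ 0 := by simp [ht]
    rw [volume_cube]
    exact pow_ne_zero _ this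
  have hvt : volume (cube x t) ≠ ∞ := (hv.trans_lt (by simp)).ne
  rw [e, div_self two_ne_zero, ENNReal.rpow_one, ENNReal.rpow_two]
  simp only [ENNReal.rpow_neg_one]
  have h1 : ∫⁻ y in cube x t, (ENNReal.ofReal (w y))⁻¹ ≤
      essSup (fun y => (ENNReal.ofReal (w y))⁻¹) (volume.restrict (cube x t)) *
        volume (cube x t) := by
    rw [← setLIntegral_const]
    exact lintegral_mono_ae (ENNReal.ae_le_essSup _)
  calc _ ≤ ((∫⁻ y in cube x t, ENNReal.ofReal (w y)) *
        (essSup (fun y => (ENNReal.ofReal (w y))⁻¹) (volume.restrict (cube x t)) *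
        volume (cube x t))) / volume (cube x t) ^ 2 := by gcongr
    _ = _ := by
        rw [← mul_assoc, sq, ENNReal.mul_div_mul_right _ _ hv0 hvt]

lemma IsA1Loc.isApLoc_two (h : IsA1Loc w) : IsApLoc 2 w :=
  ⟨h.1, (apLocConst_two_le w).trans_lt h.2⟩

/-- The essential supremum condition says that the mean of `w` over the ball is at most a constant
times `w x` for almost every `x`; this is integrated against `g`. -/
lemma IsA1Loc.isA1Measure_half (h : IsA1Loc w) : IsA1Measure (weightMeasure w)
    ((a1LocConst w).toNNReal * 2 ^ n * (ballVol n)⁻¹) (1 / 2) := by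
  intro c r hr hr2 g hg
  have hω := h.1.aemeasurable
  have hv := volume_cube c (2 * r)
  have hv1 : volume (cube c (2 * r)) ≤ 1 := by
    rw [hv]
    refine pow_le_one₀ zero_le ?_
    rw [← ENNReal.ofReal_one]
    exact ENNReal.ofReal_le_ofReal (by linarith)
  have hv0 : volume (cube c (2 * r)) ≠ 0 := by
    have : ENNReal.ofReal (2 * r) ≠ 0 := by simp [hr]
    rw [hv]
    exact pow_ne_zero _ this
  have hvt : volume (cube c (2 * r)) ≠ ∞ := (hv1.trans_lt (by simp)).ne
  set s := essSup (fun y => (ENNReal.ofReal (w y))⁻¹) (volume.restrict (cube c (2 * r))) with hs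
  have h2 := le_iSup_of_le (f := fun x : Eu n => ⨆ (t : ℝ) (_ : 0 < t)
    (_ : volume (cube x t) ≤ 1), ((∫⁻ y in cube x t, ENNReal.ofReal (w y)) *
      essSup (fun y => (ENNReal.ofReal (w y))⁻¹) (volume.restrict (cube x t)))
        / volume (cube x t)) c <| le_iSup_of_le (2 * r) <|
    le_iSup_of_le (by positivity : 0 < 2 * r) <| le_iSup_of_le hv1 le_rfl
  change _ ≤ a1LocConst w at h2
  rw [ENNReal.div_le_iff hv0 hvt] at h2
  have hsub := ball_subset_cube c r
  have h3 : weightMeasure w (Metric.ball c r) * s ≤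
      a1LocConst w * volume (cube c (2 * r)) := by
    refine le_trans (mul_le_mul_left ?_ _) h2
    rw [weightMeasure_apply_ball]
    exact lintegral_mono_set hsub
  have h4 : ∀ᵐ x ∂(volume.restrict (Metric.ball c r)), weightMeasure w (Metric.ball c r) ≤
      a1LocConst w * volume (cube c (2 * r)) * ENNReal.ofReal (w x) := by
    have h5 : ∀ᵐ x ∂(volume.restrict (Metric.ball c r)), (ENNReal.ofReal (w x))⁻¹ ≤ s :=
      ae_mono (Measure.restrict_mono_set _ hsub) (ENNReal.ae_le_essSup _)
    filter_upwards [h5, ae_restrict_of_ae (h.isApLoc_two.ae_ne_zero (by norm_num))] with x hx hx0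
    rw [← ENNReal.div_le_iff hx0 (by simp), div_eq_mul_inv]
    exact (mul_le_mul_right hx _).trans h3
  have hV : (ballVol n : ℝ≥0∞) ≠ 0 := by exact_mod_cast (ballVol_pos n).ne'
  have hM : a1LocConst w * volume (cube c (2 * r)) =
      ((a1LocConst w).toNNReal * 2 ^ n * (ballVol n)⁻¹ : ℝ≥0) * volume (Metric.ball c r) := by
    rw [hv, volume_ball_eq _ hr]
    push_cast
    rw [ENNReal.coe_toNNReal h.2.ne, ENNReal.coe_inv (ballVol_pos n).ne',
      ENNReal.ofReal_mul (by norm_num), mul_pow, ENNReal.ofReal_ofNat]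
    calc _ = a1LocConst w * (2 ^ n * ENNReal.ofReal r ^ n) *
          ((ballVol n : ℝ≥0∞)⁻¹ * ballVol n) := by
          rw [ENNReal.inv_mul_cancel hV (by simp), mul_one]
      _ = _ := by ring
  rw [← hM]
  rw [← lintegral_const_mul' _ _ (h.1.weightMeasure_ball_ne_top c r)]
  calc _ ≤ ∫⁻ x in Metric.ball c r, a1LocConst w * volume (cube c (2 * r)) *
        (ENNReal.ofReal (w x) * g x) := by
        refine lintegral_mono_ae (h4.mono fun x hx => ?_)
        rw [← mul_assoc]
        exact mul_le_mul_left hx _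
    _ = _ := by
        rw [lintegral_const_mul' _ _ (ENNReal.mul_ne_top h.2.ne hvt)]
        exact congrArg _ (setLIntegral_withDensity hω hg measurableSet_ball).symm

theorem IsA1Loc.exists_isA1Measure (h : IsA1Loc w) (R : ℝ) :
    ∃ A₁ : ℝ≥0, IsA1Measure (weightMeasure w) A₁ R := by
  have h2 := h.isApLoc_two
  -- The radius `5 / 2` makes the comparison ball, one fifth as large, have the radius `1 / 2` at
  -- which the A₁ inequality is available.
  obtain ⟨A₂, hA₂⟩ := h2.exists_isApPair one_lt_two (5 / 2)
  have hpq := Real.HolderConjugate.conjExponent (one_lt_two (α := ℝ))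
  obtain ⟨N, hN⟩ := hA₂.exists_measure_ball_le hpq.pos hpq.symm.pos (by norm_num) R
  obtain ⟨t, ht, hcov⟩ := exists_finset_ball_subset (n := n) (1 / 2) R (by norm_num)
  have hA := h.isA1Measure_half
  set A : ℝ≥0 := (a1LocConst w).toNNReal * 2 ^ n * (ballVol n)⁻¹
  refine ⟨A + t.card * N * A, fun c r hr hrR g hg => ?_⟩
  push_cast
  rw [add_mul, add_mul]
  rcases le_total r (1 / 2) with hr2 | hr2
  · exact (hA c r hr hr2 g hg).trans le_self_add
  refine le_trans ?_ le_add_self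
  set B := Metric.ball c r with hB
  have hBm : MeasurableSet B := measurableSet_ball
  set g₀ := B.indicator g with hg₀
  have hg₀m : AEMeasurable g₀ volume := hg.indicator hBm
  have h3 : ∫⁻ y in B, g y ≤ ∑ v ∈ t, ∫⁻ y in Metric.ball (c + v) (1 / 2), g₀ y := by
    calc ∫⁻ y in B, g y = ∫⁻ y in B, g₀ y :=
          setLIntegral_congr_fun hBm fun y hy => (Set.indicator_of_mem hy _).symm
      _ ≤ ∫⁻ y in ⋃ v : t, Metric.ball (c + v) (1 / 2), g₀ y := by
          refine lintegral_mono_set ((Metric.ball_subset_ball hrR).trans fun x hx => ?_)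
          obtain ⟨v, hv, hxv⟩ := Set.mem_iUnion₂.1 (hcov c hx)
          exact Set.mem_iUnion.2 ⟨⟨v, hv⟩, hxv⟩
      _ ≤ ∑' v : t, ∫⁻ y in Metric.ball (c + v) (1 / 2), g₀ y := lintegral_iUnion_le _ _
      _ = _ := by
          rw [tsum_fintype, Finset.univ_eq_attach,
            Finset.sum_attach t fun v => ∫⁻ y in Metric.ball (c + v) (1 / 2), g₀ y]
  have h4 : ∀ v ∈ t, weightMeasure w B * ∫⁻ y in Metric.ball (c + v) (1 / 2), g₀ y ≤
      N * A * volume B * ∫⁻ y in B, g y ∂(weightMeasure w) := by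
    intro v hv
    have h5 : weightMeasure w B ≤ N * weightMeasure w (Metric.ball (c + v) (1 / 2)) := by
      refine (measure_mono (Metric.ball_subset_ball hrR)).trans ?_
      have := hN c (c + v) (by simpa using ht v hv)
      norm_num at this ⊢
      exact this
    calc _ ≤ N * weightMeasure w (Metric.ball (c + v) (1 / 2)) *
          ∫⁻ y in Metric.ball (c + v) (1 / 2), g₀ y := mul_le_mul_left h5 _
      _ = N * (weightMeasure w (Metric.ball (c + v) (1 / 2)) *
          ∫⁻ y in Metric.ball (c + v) (1 / 2), g₀ y) := mul_assoc _ _ _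
      _ ≤ N * (A * volume (Metric.ball (c + v) (1 / 2)) *
          ∫⁻ y in Metric.ball (c + v) (1 / 2), g₀ y ∂(weightMeasure w)) :=
          mul_le_mul_right (hA _ _ (by norm_num) le_rfl g₀ hg₀m) _
      _ ≤ N * (A * volume B * ∫⁻ y in B, g y ∂(weightMeasure w)) := by
          refine mul_le_mul_right (mul_le_mul' (mul_le_mul_right ?_ _) ?_) _
          · rw [volume_ball_eq _ (by norm_num), hB, volume_ball_eq _ hr]
            gcongr
          · rw [← lintegral_indicator hBm]
            exact setLIntegral_le_lintegral _ _
      _ = _ := by ring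
  calc _ ≤ weightMeasure w B * ∑ v ∈ t, ∫⁻ y in Metric.ball (c + v) (1 / 2), g₀ y :=
        mul_le_mul_right h3 _
    _ = ∑ v ∈ t, weightMeasure w B * ∫⁻ y in Metric.ball (c + v) (1 / 2), g₀ y :=
        Finset.mul_sum _ _ _
    _ ≤ ∑ v ∈ t, N * A * volume B * ∫⁻ y in B, g y ∂(weightMeasure w) := Finset.sum_le_sum h4
    _ = _ := by
        rw [Finset.sum_const, nsmul_eq_mul]
        ring

/-- In the A₁ inequality for `|f|` on a small ball, the mass of the ball is nonzero, so a finite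
right side forces a finite integral of `|f|`. -/
lemma IsA1Loc.locallyIntegrable (h : IsA1Loc w) {f : Eu n → ℂ}
    (hf : MemLp f 1 (weightMeasure w)) : LocallyIntegrable f volume := by
  have h2 := h.isApLoc_two
  have hfm : AEStronglyMeasurable f volume :=
    hf.1.mono_ac (h2.volume_absolutelyContinuous one_lt_two)
  intro x
  refine ⟨Metric.ball x (1 / 4), Metric.ball_mem_nhds x (by norm_num), hfm.restrict, ?_⟩
  have h1 := h.isA1Measure_half x (1 / 4) (by norm_num) (by norm_num) _ hfm.enorm
  have h3 : ∫⁻ y in Metric.ball x (1 / 4), ‖f y‖ₑ ∂(weightMeasure w) ≠ ∞ := by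
    have := hf.2
    rw [eLpNorm_one_eq_lintegral_enorm] at this
    exact ((setLIntegral_le_lintegral _ _).trans_lt this).ne
  rw [HasFiniteIntegral]
  by_contra htop
  rw [not_lt, top_le_iff] at htop
  rw [htop, ENNReal.mul_top (h2.weightMeasure_ball_ne_zero one_lt_two x), top_le_iff] at h1
  exact ENNReal.mul_ne_top (ENNReal.mul_ne_top ENNReal.coe_ne_top measure_ball_lt_top.ne) h3 h1

end EndpointWeights

/-! ### Passage to the limit in weak type bounds. -/

section Limits

/-- Weak type bounds pass to almost everywhere limits. -/
lemma mul_measure_lt_enorm_le_of_tendsto {X : Type*} [MeasurableSpace X] {μ : Measure X}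
    {F : ℕ → X → ℂ} {G : X → ℂ} (hlim : ∀ᵐ x ∂μ, Tendsto (fun N => F N x) atTop (𝓝 (G x)))
    {t M : ℝ≥0∞} (h : ∀ N, t * μ {x | t < ‖F N x‖ₑ} ≤ M) : t * μ {x | t < ‖G x‖ₑ} ≤ M := by
  -- The strict inequality `t < ‖G x‖ₑ` persists for all late `N`, so these increasing sets exhaust
  -- the level set of `G` up to a null set.
  set E : ℕ → Set X := fun N => ⋂ k ≥ N, {x | t < ‖F k x‖ₑ} with hE
  have hmono : Monotone E := fun N N' hN x hx => by
    simp only [hE, Set.mem_iInter] at hx ⊢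
    exact fun k hk => hx k (le_trans hN hk)
  have h1 : μ {x | t < ‖G x‖ₑ} ≤ μ (⋃ N, E N) := by
    refine measure_mono_ae ?_
    filter_upwards [hlim] with x hx hxt
    have h2 := (hx.enorm).eventually_const_lt (show t < ‖G x‖ₑ from hxt)
    obtain ⟨N, hN⟩ := eventually_atTop.1 h2
    exact Set.mem_iUnion.2 ⟨N, Set.mem_iInter₂.2 hN⟩
  calc t * μ {x | t < ‖G x‖ₑ} ≤ t * μ (⋃ N, E N) := mul_le_mul_right h1 _
    _ = ⨆ N, t * μ (E N) := by rw [hmono.measure_iUnion, ENNReal.mul_iSup]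
    _ ≤ M := iSup_le fun N => le_trans (mul_le_mul_right
        (measure_mono (Set.iInter₂_subset N le_rfl)) _) (h N)

end Limits

/-! ### The weighted strong and weak type theorem. -/

theorem lemma3p2 (n : ℕ) (Φ : EuclideanSpace ℝ (Fin n) → ℝ) (hΦ : IsRadialCutoff Φ) :
    (∀ (p : ℝ) (w : EuclideanSpace ℝ (Fin n) → ℝ), 1 < p → IsApLoc p w →
      ∃ C : ℝ≥0, ∀ (j : Fin n) (f : EuclideanSpace ℝ (Fin n) → ℂ),
        MemLp f (ENNReal.ofReal p) (weightMeasure w) →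
          (∀ᵐ x, RieszExistsAt Φ j f x) ∧
          AEStronglyMeasurable (truncRiesz Φ j f) volume ∧
          eLpNorm (truncRiesz Φ j f) (ENNReal.ofReal p) (weightMeasure w) ≤
            C * eLpNorm f (ENNReal.ofReal p) (weightMeasure w)) ∧
    (∀ w : EuclideanSpace ℝ (Fin n) → ℝ, IsA1Loc w →
      ∃ C : ℝ≥0, ∀ (j : Fin n) (f : EuclideanSpace ℝ (Fin n) → ℂ),
        MemLp f 1 (weightMeasure w) →
          (∀ᵐ x, RieszExistsAt Φ j f x) ∧
          AEStronglyMeasurable (truncRiesz Φ j f) volume ∧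
          weakL1Norm (truncRiesz Φ j f) (weightMeasure w) ≤
            C * eLpNorm f 1 (weightMeasure w)) := by
  rcases Nat.eq_zero_or_pos n with rfl | hn
  · exact ⟨fun _ _ _ _ => ⟨0, fun j => j.elim0⟩, fun _ _ => ⟨0, fun j => j.elim0⟩⟩
  obtain ⟨A, hA⟩ := exists_isCZKernel_rieszTrunc hΦ
  obtain ⟨W, hW⟩ := exists_conv_rieszTrunc_weak_type hn hΦ
  refine ⟨fun p w hp h => ?_, fun w h => ?_⟩
  · have hp0 : 0 < p := by linarith
    obtain ⟨C, hC⟩ := h.exists_lintegral_conv_le hn hp A W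
    refine ⟨C ^ p⁻¹, fun j f hf => ?_⟩
    have hfl := h.locallyIntegrable hp hf
    have hae := ae_rieszExistsAt_and_tendsto hn hΦ j hfl
    refine ⟨hae.mono fun x hx => hx.1, aestronglyMeasurable_truncRiesz hn hΦ j hfl, ?_⟩
    have hac := weightMeasure_absolutelyContinuous w
    have e : ∀ g : Eu n → ℂ, eLpNorm g (ENNReal.ofReal p) (weightMeasure w) =
        (∫⁻ x, ‖g x‖ₑ ^ p ∂(weightMeasure w)) ^ p⁻¹ := fun g => by
      rw [eLpNorm_eq_lintegral_rpow_enorm_toReal (by simpa using hp0) (by simp),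
        ENNReal.toReal_ofReal hp0.le, one_div]
    have hbound : ∀ N, eLpNorm (conv (rieszTrunc Φ j N) f) (ENNReal.ofReal p) (weightMeasure w) ≤
        (C ^ p⁻¹ : ℝ≥0) * eLpNorm f (ENNReal.ofReal p) (weightMeasure w) := fun N => by
      have hp' : 0 ≤ p⁻¹ := by positivity
      rw [e, e, ENNReal.coe_rpow_of_nonneg _ hp', ← ENNReal.mul_rpow_of_nonneg _ _ hp']
      exact ENNReal.rpow_le_rpow (hC _ (hA j N) (hW j N) f hfl) hp'
    -- Fatou's lemma. Convergence holds almost everywhere for `dx`, hence for the absolutely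
    -- continuous `w dx`.
    refine (Lp.eLpNorm_lim_le_liminf_eLpNorm (fun N =>
      ((hA j N).continuous_conv hfl).aestronglyMeasurable) _
      (hac.ae_le (hae.mono fun x hx => hx.2))).trans ?_
    exact (liminf_le_liminf (Eventually.of_forall hbound)).trans_eq (liminf_const _)
  · obtain ⟨A₁, hA₁⟩ := h.exists_isA1Measure (8 * n)
    -- The case `p = 2` of the strong type supplies the bound on `L²_w` that the good part of the
    -- Calderón–Zygmund decomposition needs.
    obtain ⟨B, hB⟩ := h.isApLoc_two.exists_lintegral_conv_le hn one_lt_two A W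
    obtain ⟨C, hC⟩ := conv_weak_type hn A A₁ B
    refine ⟨C, fun j f hf => ?_⟩
    have hfl := h.locallyIntegrable hf
    have hae := ae_rieszExistsAt_and_tendsto hn hΦ j hfl
    refine ⟨hae.mono fun x hx => hx.1, aestronglyMeasurable_truncRiesz hn hΦ j hfl, ?_⟩
    have hac := weightMeasure_absolutelyContinuous w
    have hweak : ∀ N, ∀ t : ℝ≥0∞, t * weightMeasure w {x | t < ‖conv (rieszTrunc Φ j N) f x‖ₑ} ≤
        C * eLpNorm f 1 (weightMeasure w) := fun N t => by
      rw [eLpNorm_one_eq_lintegral_enorm]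
      refine hC _ hA₁ hac _ (hA j N) (fun g hg => ?_) f hfl t
      have := hB _ (hA j N) (hW j N) g hg
      simpa only [ENNReal.rpow_two] using this
    refine iSup₂_le fun t ht => ?_
    have e : {x | t < ‖truncRiesz Φ j f x‖} = {x | ENNReal.ofReal t < ‖truncRiesz Φ j f x‖ₑ} := by
      ext x
      rw [Set.mem_ofPred_eq, Set.mem_ofPred_eq, ← ofReal_norm,
        ENNReal.ofReal_lt_ofReal_iff_of_nonneg ht.le]
    rw [e]
    exact mul_measure_lt_enorm_le_of_tendsto (hac.ae_le (hae.mono fun x hx => hx.2))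
      fun N => hweak N _
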